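/- Let $m:[0,\infty)\to\mathbb R$ be Lipschitz and bounded with either $m>0$ or $m<0$, let $Y_{n}=m(n/T)+\epsilon_n$, $1\le n\le T$, with $E\epsilon_n=0$, and fix $\Xi\in(1,\infty)$ and $s_0\in(0,1)$. Let $K:[0,\infty)\to\mathbb R$ be a bounded kernel (negative values and unbounded support are allowed) such that * $K$ is continuous Lebesgue-almost everywhere; * $\int_0^xK(u)\,du>0$ for all $0<x\le\Xi$; * there are $C,\eta>0$ such that $K(u)>0$ and $K(v)\le C\,K(u)$ whenever $0<u\le\eta$ and $0<v\le 2u$ (e.g. $K$ is bounded away from $0$ near $0$, or $K(u)$ is of exact order $u^a$ as $u\downarrow0$ for some $a\ge 0$). For $\xi\in[1,\Xi]$ put $h=T/\xi$, $$\widehat m_{h,-i}=\frac{\sum_{j=1}^{i-1}K((i-j)/h)\,Y_j}{\sum_{j=1}^{i-1}K((i-j)/h)},\qquad C_{T,s}(\xi)=-\frac2T\sum_{i=2}^{\lfloor Ts\rfloor}Y_i\,\widehat m_{h,-i}+\frac1T\sum_{i=2}^{\lfloor Ts\rfloor}\widehat m_{h,-i}^{\,2},$$ $$A_\xi(r)=\frac{\int_0^rK(\xi(r-u))\,m(u)\,du}{\int_0^rK(\xi(r-u))\,du},\qquad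 C_\xi(s)=-2\int_0^s m(r)A_\xi(r)\,dr+\int_0^sA_\xi(r)^2\,dr .$$ For a process $\{Z_t\}$ let $\alpha(k)=\sup|P(A\cap B)-P(A)P(B)|$, the supremum being over all $t$, $A\in\sigma(Z_i:i\le t)$ and $B\in\sigma(Z_i:i\ge t+k)$. Call $\{Z_t\}$ a *mixing series* if it is weakly stationary with finite fourth moments, $k\,\alpha(k)\to0$ as $k\to\infty$, and, with all indices running over $1,\dots,T$, $$\sup_{T\ge1}\ T^{-1}\sum_{j,j'}|\mathrm{Cov}(Z_j,Z_{j'})|<\infty,\qquad \sup_{T\ge1}\ T^{-2}\sum_{j,k,j',k'}|\mathrm{Cov}(Z_jZ_k,Z_{j'}Z_{k'})|<\infty .$$ Suppose that either (a) $\{\epsilon_t\}_{t\ge1}$ is a mixing series, or (b) $\{\epsilon_t\}_{t\ge 1}$ is weakly stationary, $E|\epsilon_1|^r<\infty$ for some $r>2$, and $\{\epsilon_t\}$ is $L_2$-near epoch dependent on a (one- or two-sided) mixing series $\{Z_t\}$; that is, there are constants $0\le d_t\le 2\|\epsilon_t-E\epsilon_t\|_2$ and $\nu_l\ge 0$ with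 $\nu_l\downarrow0$ such that $\|\epsilon_t-E(\epsilon_t\mid\sigma(Z_i:t-l\le i\le t+l))\|_2\le d_t\nu_l$ for all $t\ge1$, $l\ge0$. Then for every fixed finite set $\mathcal S\subset[s_0,1]$, $$\max_{s\in\mathcal S}\ \sup_{\xi\in[1,\Xi]}|C_{T,s}(\xi)-C_\xi(s)|=o_P(1),\qquad T\to\infty .$$ Further, let $s\in[s_0,1]$ and $\xi^*_s\in[1,\Xi]$ be such that one of the following holds: (i) $\xi^*_s$ is a well-separated minimum: $\inf\{C_\xi(s):\xi\in[1,\Xi],\ |\xi-\xi^*_s|\ge\rho\}>C_{\xi^*_s}(s)$ for every $\rho>0$; (ii) $\xi\mapsto C_\xi(s)$ is continuously differentiable on $[1,\Xi]$, its derivative has exactly one zero there, this zero is $\xi^*_s$, and $C_\xi(s)$ is minimal at $\xi=\xi^*_s$; (ii') for all large $T$, almost surely, $\xi\mapsto C_{T,s}(\xi)$ is continuously differentiable on $[1,\Xi]$ and its derivative has exactly one zero there; and $\xi^*_s$ is the unique minimizer of $\xi\mapsto C_\xi(s)$ over $[1,\Xi]$. Then $\xi^*_T(s)\to\xi^*_s$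 in probability as $T\to\infty$, for every choice of minimizers $\xi_T^*(s)\in\operatorname{argmin}_{\xi\in[1,\Xi]}C_{T,s}(\xi)$ (existing almost surely for all large $T$). -/

import Mathlib

open MeasureTheory ProbabilityTheory Filter Topology Set

/-! ### Dependence conditions for discrete time processes

A process is a family `Z : ℤ → Ω → ℝ` of which only the coordinates `Z t` with `t ∈ I` matter;
the time set `I` is `Set.Ici 1` for a one-sided process and `Set.univ` for a two-sided one. -/

section Processes

variable {Ω : Type*} [mΩ : MeasurableSpace Ω]

/-- The σ-field `σ(Z_i : i ∈ J)`. -/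
@[reducible] def sigmaField (Z : ℤ → Ω → ℝ) (J : Set ℤ) : MeasurableSpace Ω :=
  ⨆ i ∈ J, MeasurableSpace.comap (Z i) (borel ℝ)

/-- Weak (second order) stationarity on the time set `I`. -/
structure IsWeaklyStationary (μ : Measure Ω) (I : Set ℤ) (Z : ℤ → Ω → ℝ) : Prop where
  measurable : ∀ t ∈ I, Measurable (Z t)
  memLp_two : ∀ t ∈ I, MemLp (Z t) 2 μ
  mean_eq : ∀ s ∈ I, ∀ t ∈ I, ∫ ω, Z s ω ∂μ = ∫ ω, Z t ω ∂μ
  cov_eq : ∀ s ∈ I, ∀ t ∈ I, ∀ k : ℕ,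
    covariance (Z (s + k)) (Z s) μ = covariance (Z (t + k)) (Z t) μ

/-- The strong mixing coefficient `α(k)`: the supremum of `|P(A ∩ B) - P(A) P(B)|` over all times
`t`, all `A ∈ σ(Z_i : i ≤ t)` and all `B ∈ σ(Z_i : i ≥ t + k)`. -/
noncomputable def alphaCoeff (μ : Measure Ω) (I : Set ℤ) (Z : ℤ → Ω → ℝ) (k : ℕ) : ℝ :=
  sSup {x : ℝ | ∃ (t : ℤ) (A B : Set Ω),
    MeasurableSet[sigmaField Z (I ∩ Iic t)] A ∧
    MeasurableSet[sigmaField Z (I ∩ Ici (t + k))] B ∧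
    x = |μ.real (A ∩ B) - μ.real A * μ.real B|}

/-- A weakly stationary, α-mixing process with `k α(k) → 0`, for which the normalized sums of
absolute second and fourth order covariances over `1, …, T` stay bounded in `T`. -/
structure IsMixingSeries (μ : Measure Ω) (I : Set ℤ) (Z : ℤ → Ω → ℝ) : Prop where
  weaklyStationary : IsWeaklyStationary μ I Z
  tendsto_alpha : Tendsto (fun k : ℕ => (k : ℝ) * alphaCoeff μ I Z k) atTop (𝓝 0)
  second_order : ∃ B : ℝ, ∀ T : ℕ, 1 ≤ T →
    (T : ℝ)⁻¹ * ∑ j ∈ Finset.Icc (1 : ℤ) T, ∑ j' ∈ Finset.Icc (1 : ℤ) T,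
      |covariance (Z j) (Z j') μ| ≤ B
  -- fourth moments, so that the fourth order covariances exist
  memLp_four : ∀ t ∈ I, MemLp (Z t) 4 μ
  fourth_order : ∃ B : ℝ, ∀ T : ℕ, 1 ≤ T →
    ((T : ℝ) ^ 2)⁻¹ * ∑ j ∈ Finset.Icc (1 : ℤ) T, ∑ k ∈ Finset.Icc (1 : ℤ) T,
      ∑ j' ∈ Finset.Icc (1 : ℤ) T, ∑ k' ∈ Finset.Icc (1 : ℤ) T,
        |covariance (fun ω => Z j ω * Z k ω) (fun ω => Z j' ω * Z k' ω) μ| ≤ B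

/-- `X` (with time set `I`) is `L_p`-near epoch dependent on `Z` (with time set `J`). -/
def IsNED (μ : Measure Ω) (p : ENNReal) (I : Set ℤ) (X : ℤ → Ω → ℝ) (J : Set ℤ)
    (Z : ℤ → Ω → ℝ) : Prop :=
  ∃ (d : ℤ → ℝ) (ν : ℕ → ℝ),
    (∀ t ∈ I, 0 ≤ d t) ∧
    (∀ t ∈ I, ENNReal.ofReal (d t) ≤ 2 * eLpNorm (fun ω => X t ω - ∫ ω', X t ω' ∂μ) p μ) ∧
    (∀ l, 0 ≤ ν l) ∧ Antitone ν ∧ Tendsto ν atTop (𝓝 0) ∧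
    ∀ t ∈ I, ∀ l : ℕ,
      eLpNorm (X t - μ[X t | sigmaField Z (J ∩ Icc (t - l) (t + l))]) p μ
        ≤ ENNReal.ofReal (d t * ν l)

/-- The two admissible classes of error processes `ε_1, ε_2, …`: strongly mixing series, and
series with a moment of order `r > 2` that are `L_2`-near epoch dependent on a (one- or two-sided)
strongly mixing series. The errors are centred. -/
def IsErrorProcess (μ : Measure Ω) (ε : ℤ → Ω → ℝ) : Prop :=
  (∀ t : ℤ, 1 ≤ t → ∫ ω, ε t ω ∂μ = 0) ∧
  (IsMixingSeries μ (Ici 1) ε ∨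
    (IsWeaklyStationary μ (Ici 1) ε ∧
      (∃ r : ℝ, 2 < r ∧ MemLp (ε 1) (ENNReal.ofReal r) μ) ∧
      ∃ (J : Set ℤ) (Z : ℤ → Ω → ℝ), (J = univ ∨ J = Ici 1) ∧
        IsMixingSeries μ J Z ∧ IsNED μ 2 (Ici 1) ε J Z))

end Processes

/-! ### Model, kernel and sequential cross-validation -/

/-- The regression function: Lipschitz and bounded on `[0, ∞)`, and of one strict sign. -/
structure IsRegressionFunction (m : ℝ → ℝ) : Prop where
  lipschitz : ∃ L, LipschitzOnWith L m (Ici 0)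
  sign : (∀ t, 0 ≤ t → 0 < m t) ∨ (∀ t, 0 ≤ t → m t < 0)
  bounded : ∃ B : ℝ, ∀ t, 0 ≤ t → |m t| ≤ B

/-- A bounded kernel on `[0, ∞)`, possibly with negative values and with unbounded support, for
which Riemann sums converge and the normalizing constants do not degenerate. The condition near `0`
holds for instance if `K` is bounded below by a positive constant near `0`, or if `K u` is of
the exact order `u ^ a` as `u ↓ 0`, for some `a ≥ 0`. -/
structure IsBoundedKernel (K : ℝ → ℝ) (Ξ : ℝ) : Prop where
  bounded : ∃ B : ℝ, ∀ u, 0 ≤ u → |K u| ≤ B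
  ae_continuous : ∀ᵐ u ∂(volume.restrict (Ioi (0 : ℝ))), ContinuousAt K u
  near_zero : ∃ C η : ℝ, 0 < η ∧ ∀ u ∈ Ioc 0 η, 0 < K u ∧ ∀ v ∈ Ioc 0 (2 * u), K v ≤ C * K u
  integral_pos : ∀ x ∈ Ioc 0 Ξ, 0 < ∫ u in (0 : ℝ)..x, K u

section Criterion

variable {Ω : Type*}

/-- The observation `Y_n = Y_{T n} = m (n / T) + ε_n`. -/
noncomputable def obs (m : ℝ → ℝ) (ε : ℤ → Ω → ℝ) (T n : ℕ) (ω : Ω) : ℝ :=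
  m ((n : ℝ) / T) + ε n ω

/-- The normalizing constant `N_{T,-i} = h⁻¹ ∑_{j=1}^{i-1} K((i-j)/h)`. -/
noncomputable def normConst (K : ℝ → ℝ) (h : ℝ) (i : ℕ) : ℝ :=
  h⁻¹ * ∑ j ∈ Finset.Ico 1 i, K (((i : ℝ) - j) / h)

/-- The sequential leave-one-out prediction of `Y_i` from `Y_1, …, Y_{i-1}` with bandwidth `h`. -/
noncomputable def looPred (K m : ℝ → ℝ) (ε : ℤ → Ω → ℝ) (T : ℕ) (h : ℝ) (i : ℕ) (ω : Ω) : ℝ :=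
  (normConst K h i)⁻¹ * (h⁻¹ * ∑ j ∈ Finset.Ico 1 i, K (((i : ℝ) - j) / h) * obs m ε T j ω)

/-- The sequential cross-validation objective `C_{T,s}(ξ)`, with bandwidth `h = T / ξ`. -/
noncomputable def cvObj (K m : ℝ → ℝ) (ε : ℤ → Ω → ℝ) (T : ℕ) (s ξ : ℝ) (ω : Ω) : ℝ :=
  -(2 / (T : ℝ)) * ∑ i ∈ Finset.Icc 2 ⌊(T : ℝ) * s⌋₊,
      obs m ε T i ω * looPred K m ε T (T / ξ) i ω
    + (1 / (T : ℝ)) * ∑ i ∈ Finset.Icc 2 ⌊(T : ℝ) * s⌋₊, looPred K m ε T (T / ξ) i ω ^ 2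

end Criterion

/-- The limiting prediction at time `r`. -/
noncomputable def limPred (K m : ℝ → ℝ) (ξ r : ℝ) : ℝ :=
  (∫ u in (0 : ℝ)..r, ξ * K (ξ * (r - u)) * m u) / ∫ u in (0 : ℝ)..r, ξ * K (ξ * (r - u))

/-- The limiting objective `C_ξ(s)`. -/
noncomputable def limObj (K m : ℝ → ℝ) (s ξ : ℝ) : ℝ :=
  -2 * (∫ r in (0 : ℝ)..s, m r * limPred K m ξ r) + ∫ r in (0 : ℝ)..s, limPred K m ξ r ^ 2

/-! ### Conditions on the minimum -/

/-- `f` has a well-separated minimum over `[1, Ξ]` at `x`: the infimum of `f` over the points of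
`[1, Ξ]` at distance at least `ρ` from `x` exceeds `f x`, for every `ρ > 0`. -/
def WellSeparatedMin (f : ℝ → ℝ) (Ξ x : ℝ) : Prop :=
  x ∈ Icc 1 Ξ ∧ ∀ ρ > 0, ∃ δ > 0, ∀ ξ ∈ Icc 1 Ξ, ρ ≤ |ξ - x| → f x + δ ≤ f ξ

/-- `f` is continuously differentiable on `[1, Ξ]` (one-sidedly at the end points) and its
derivative has exactly one zero there, namely `z`. -/
def OnlyCriticalPoint (f : ℝ → ℝ) (Ξ z : ℝ) : Prop :=
  ∃ f' : ℝ → ℝ, ContinuousOn f' (Icc 1 Ξ) ∧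
    (∀ ξ ∈ Icc 1 Ξ, HasDerivWithinAt f (f' ξ) (Icc 1 Ξ) ξ) ∧
    z ∈ Icc 1 Ξ ∧ ∀ ξ ∈ Icc 1 Ξ, f' ξ = 0 ↔ ξ = z

/-- Conditions under which the asymptotically optimal parameter `x = ξ*_s` is identified:
`C_ξ(s)` has a well-separated minimum at `x`; or `C_ξ(s)` is continuously differentiable in `ξ`
with a single critical point, at which it is minimal; or the random objectives `C_{T,s}` are, for
large `T`, continuously differentiable with a single critical point, and `x` is the unique
minimizer of `C_ξ(s)`. -/
def IdentifiesMin {Ω : Type*} [MeasurableSpace Ω] (μ : Measure Ω) (K m : ℝ → ℝ)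
    (ε : ℤ → Ω → ℝ) (Ξ s x : ℝ) : Prop :=
  WellSeparatedMin (limObj K m s) Ξ x ∨
  (OnlyCriticalPoint (limObj K m s) Ξ x ∧ IsMinOn (limObj K m s) (Icc 1 Ξ) x) ∨
  ((∀ᶠ T : ℕ in atTop, ∀ᵐ ω ∂μ, ∃ z, OnlyCriticalPoint (fun ξ => cvObj K m ε T s ξ ω) Ξ z) ∧
    x ∈ Icc 1 Ξ ∧ ∀ ξ ∈ Icc 1 Ξ, ξ ≠ x → limObj K m s x < limObj K m s ξ)

/-! ### Riemann sums of bounded, almost everywhere continuous functions -/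

/-! Predictions are linear in the data, so with y_i = m(i/T) the prediction of Y_i = y_i + e_i
splits as d_i + R_i, where d_i is computed from the noiseless values and R_i from the errors. The
objective becomes the mean of d_i² - 2 y_i d_i plus cross terms in R_i and e_i.

The noiseless part is a Riemann sum and converges to C_ξ(s) uniformly in ξ and s
(`eventually_abs_sum_discPred_sub_limObj_le`): `K` is bounded and a.e. continuous, and the bandwidth
T/ξ ≥ T/Ξ is uniformly large.

The noise is controlled by quantities free of ξ and s: its mean square V, and Q, a bound for T⁻²
max_{n≤T} (e_1+...+e_n)². To make R_i small, `K` is approximated in L²(0, Ξ) by a Lipschitz φ.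
Cauchy-Schwarz handles K - φ with V, and summation by parts handles φ with Q
(`exists_seqPred_sq_le`). Since d_i varies by O(1/T) per step away from time 0, summation by parts
also handles the mean of d_i e_i. For i ≤ δT the normalizing constants degenerate, but the condition
on `K` near 0 keeps all weights O(1/i) (`exists_weight_bound`), so this range costs O(δ) in mean.
All this is one pathwise inequality, `exists_pathwise_bound`.

Probability enters through E(e_1+...+e_n)² = o(n²) (`IsErrorProcess.exists_variance`), obtained from
summable covariances in case (a) and from covariances vanishing at large lags in case (b). A grid
argument turns this into a bound for the maximum, and Markov's inequality concludes. For the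
minimizers, each identification condition yields a well-separated minimum of the continuous limit,
and the usual argmin argument applies. -/

lemma measurable_comp_ceil (F : ℕ → ℝ) (h : ℝ) : Measurable fun u : ℝ => F ⌈u * h⌉₊ :=
  (measurable_from_nat (f := F)).comp (Nat.measurable_ceil.comp (measurable_id.mul_const h))

lemma intervalIntegrable_of_abs_le {f : ℝ → ℝ} {a b B : ℝ} (ha : 0 ≤ a) (hb : 0 ≤ b)
    (hf : AEStronglyMeasurable f (volume.restrict (Ioi 0))) (hB : ∀ u, 0 ≤ u → |f u| ≤ B) :
    IntervalIntegrable f volume a b := by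
  have hsub : uIoc a b ⊆ Ioi 0 := by
    intro x hx
    rw [uIoc, mem_Ioc] at hx
    exact lt_of_le_of_lt (le_min ha hb) hx.1
  rw [intervalIntegrable_iff]
  have : IsFiniteMeasure (volume.restrict (uIoc a b)) := ⟨by simp [uIoc]⟩
  refine Integrable.of_bound (hf.mono_set hsub) B ?_
  refine (ae_restrict_iff' measurableSet_uIoc).2 (ae_of_all _ fun x hx => ?_)
  exact hB x (le_of_lt (hsub hx))

lemma intervalIntegrable_comp_ceil {F : ℕ → ℝ} {B : ℝ} (hF : ∀ k, |F k| ≤ B) (h a b : ℝ) :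
    IntervalIntegrable (fun u => F ⌈u * h⌉₊) volume a b := by
  rw [intervalIntegrable_iff]
  refine Measure.integrableOn_of_bounded (M := B) ?_
    (measurable_comp_ceil F h).aestronglyMeasurable (ae_of_all _ fun x => hF _)
  rw [uIoc]; simp

/-- Riemann sums are integrals of step functions. -/
lemma integral_comp_ceil (F : ℕ → ℝ) {h : ℝ} (hh : 0 < h) (n : ℕ) :
    IntervalIntegrable (fun u => F ⌈u * h⌉₊) volume 0 (n / h) ∧
      ∫ u in (0 : ℝ)..(n / h), F ⌈u * h⌉₊ = h⁻¹ * ∑ k ∈ Finset.Icc 1 n, F k := by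
  induction n with
  | zero => simp
  | succ n ih =>
    have hle : (n : ℝ) / h ≤ ((n + 1 : ℕ) : ℝ) / h := by gcongr; simp
    have hc : EqOn (fun _ => F (n + 1)) (fun u : ℝ => F ⌈u * h⌉₊)
        (uIoc ((n : ℝ) / h) (((n + 1 : ℕ) : ℝ) / h)) := by
      intro u hu
      rw [uIoc_of_le hle, mem_Ioc, div_lt_iff₀ hh, le_div_iff₀ hh] at hu
      have : ⌈u * h⌉₊ = n + 1 := by
        rw [Nat.ceil_eq_iff (by omega)]
        simpa using hu
      simp [this]
    have hi : IntervalIntegrable (fun u => F ⌈u * h⌉₊) volume ((n : ℝ) / h)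
        (((n + 1 : ℕ) : ℝ) / h) :=
      (intervalIntegrable_const (c := F (n + 1))).congr hc
    refine ⟨ih.1.trans hi, ?_⟩
    rw [← intervalIntegral.integral_add_adjacent_intervals ih.1 hi, ih.2,
      ← intervalIntegral.integral_congr_ae (ae_of_all _ fun u hu => hc hu), intervalIntegral.integral_const,
      Finset.sum_Icc_succ_top (by omega)]
    push_cast
    simp only [smul_eq_mul]
    field_simp
    ring

lemma tendsto_comp_ceil {f : ℝ → ℝ} {u : ℝ} (hu : 0 ≤ u) (hf : ContinuousAt f u) :
    Tendsto (fun h : ℝ => f (⌈u * h⌉₊ / h)) atTop (𝓝 (f u)) :=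
  hf.tendsto.comp (tendsto_nat_ceil_mul_div_atTop hu)

/-- At a point of continuity f(u) is the limit of the step functions f(⌈uh⌉/h), which are measurable
for any f. This supplies the measurability of the kernel. -/
lemma aestronglyMeasurable_of_ae_continuousAt {f : ℝ → ℝ}
    (hc : ∀ᵐ u ∂(volume.restrict (Ioi (0 : ℝ))), ContinuousAt f u) :
    AEStronglyMeasurable f (volume.restrict (Ioi 0)) := by
  refine aestronglyMeasurable_of_tendsto_ae (atTop : Filter ℝ)
    (f := fun (h u : ℝ) => f (⌈u * h⌉₊ / h))
    (fun h => (measurable_comp_ceil (fun k => f (k / h)) h).aestronglyMeasurable) ?_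
  filter_upwards [hc, ae_restrict_mem measurableSet_Ioi] with u hu hu0
  exact tendsto_comp_ceil (le_of_lt hu0) hu

/-- The step functions of mesh `h⁻¹` converge in `L¹` as `h → ∞`. -/
lemma tendsto_integral_abs_comp_ceil_sub {f : ℝ → ℝ} {B : ℝ} (hB : ∀ u, 0 ≤ u → |f u| ≤ B)
    (hc : ∀ᵐ u ∂(volume.restrict (Ioi (0 : ℝ))), ContinuousAt f u) {X : ℝ} (hX : 0 ≤ X) :
    Tendsto (fun h : ℝ => ∫ u in (0 : ℝ)..X, |f (⌈u * h⌉₊ / h) - f u|) atTop (𝓝 0) := by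
  have hf := aestronglyMeasurable_of_ae_continuousAt hc
  have hsub : uIoc 0 X ⊆ Ioi 0 := by rw [uIoc_of_le hX]; exact fun x hx => hx.1
  rw [show 𝓝 (0 : ℝ) = 𝓝 (∫ _u in (0 : ℝ)..X, (0 : ℝ)) by simp]
  refine intervalIntegral.tendsto_integral_filter_of_dominated_convergence (μ := volume)
    (fun _ => 2 * B) (Eventually.of_forall fun h => ?_) ?_ intervalIntegrable_const ?_
  · exact ((measurable_comp_ceil (fun k => f (k / h)) h).aestronglyMeasurable.sub
      (hf.mono_set hsub)).norm
  · filter_upwards [eventually_gt_atTop 0] with h hh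
    refine ae_of_all _ fun u hu => ?_
    have h1 := hB (⌈u * h⌉₊ / h) (by positivity)
    have h2 := hB u (le_of_lt (hsub hu))
    rw [Real.norm_eq_abs, abs_abs]
    rw [abs_le] at h1 h2 ⊢
    constructor <;> linarith
  · rw [ae_restrict_iff' measurableSet_Ioi] at hc
    filter_upwards [hc] with u hu hu0
    have := (tendsto_comp_ceil (le_of_lt (hsub hu0)) (hu (hsub hu0))).sub_const (f u)
    simpa using this.abs

/-! ### Kernel sums and their limits -/

/-- The kernel-weighted sum `h⁻¹ ∑_{j<i} K((i-j)/h) q(j/T)` with `h = T / ξ`. -/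
noncomputable def discSum (K q : ℝ → ℝ) (T : ℕ) (ξ : ℝ) (i : ℕ) : ℝ :=
  ((T : ℝ) / ξ)⁻¹ * ∑ j ∈ Finset.Ico 1 i, K (((i : ℝ) - j) / (T / ξ)) * q ((j : ℝ) / T)

/-- The limit of the kernel-weighted sums. -/
noncomputable def contSum (K q : ℝ → ℝ) (ξ r : ℝ) : ℝ :=
  ∫ v in (0 : ℝ)..ξ * r, K v * q (r - v / ξ)

lemma sum_Ico_reflect_lag (f : ℕ → ℕ → ℝ) (i : ℕ) :
    ∑ j ∈ Finset.Ico 1 i, f (i - j) j = ∑ k ∈ Finset.Icc 1 (i - 1), f k (i - k) := by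
  refine Finset.sum_nbij' (fun j => i - j) (fun k => i - k) ?_ ?_ ?_ ?_ ?_
  · intro j hj; simp only [Finset.mem_Ico, Finset.mem_Icc] at hj ⊢; omega
  · intro j hj; simp only [Finset.mem_Ico, Finset.mem_Icc] at hj ⊢; omega
  · intro j hj; simp only [Finset.mem_Ico] at hj; omega
  · intro j hj; simp only [Finset.mem_Icc] at hj; omega
  · intro j hj
    simp only [Finset.mem_Ico] at hj
    rw [Nat.sub_sub_self hj.2.le]

lemma sum_Ico_lag (f : ℝ → ℝ → ℝ) (i : ℕ) :
    ∑ j ∈ Finset.Ico 1 i, f ((i : ℝ) - j) j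
      = ∑ k ∈ Finset.Icc 1 (i - 1), f k ((i : ℝ) - k) := by
  have h := sum_Ico_reflect_lag (fun a b => f a b) i
  refine Eq.trans (Finset.sum_congr rfl fun j hj => ?_)
    (h.trans (Finset.sum_congr rfl fun k hk => ?_))
  · rw [Finset.mem_Ico] at hj; rw [Nat.cast_sub hj.2.le]
  · rw [Finset.mem_Icc] at hk; rw [Nat.cast_sub (by omega)]

lemma discSum_eq_lag (K q : ℝ → ℝ) (T : ℕ) (ξ : ℝ) (i : ℕ) :
    discSum K q T ξ i = ((T : ℝ) / ξ)⁻¹ *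
      ∑ k ∈ Finset.Icc 1 (i - 1), K ((k : ℝ) / (T / ξ)) * q (((i : ℝ) - k) / T) := by
  rw [discSum, sum_Ico_lag (fun a b => K (a / (T / ξ)) * q (b / T))]

/-- Since T/ξ ≥ T/Ξ, limits in the bandwidth are automatically uniform in ξ. -/
lemma eventually_bandwidth {P : ℝ → Prop} {Ξ : ℝ} (hP : ∀ᶠ h in atTop, P h) :
    ∀ᶠ T : ℕ in atTop, ∀ ξ ∈ Icc 1 Ξ, P (T / ξ) := by
  obtain ⟨a, ha⟩ := eventually_atTop.1 hP
  filter_upwards [(tendsto_natCast_atTop_atTop (R := ℝ)).eventually_ge_atTop (|a| * Ξ)]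
    with T hT ξ hξ
  refine ha _ ((le_abs_self a).trans ?_)
  rw [le_div_iff₀ (by linarith [hξ.1])]
  exact (mul_le_mul_of_nonneg_left hξ.2 (abs_nonneg a)).trans hT

section Deterministic

variable {K : ℝ → ℝ} {B Ξ : ℝ}

lemma integrable_contSum {q : ℝ → ℝ} {Bq : ℝ}
    (hB : ∀ u, 0 ≤ u → |K u| ≤ B)
    (hc : ∀ᵐ u ∂(volume.restrict (Ioi (0 : ℝ))), ContinuousAt K u)
    (hq : Continuous q) (hqB : ∀ x, |q x| ≤ Bq) (ξ r : ℝ) {a b : ℝ} (ha : 0 ≤ a) (hb : 0 ≤ b) :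
    IntervalIntegrable (fun v => K v * q (r - v / ξ)) volume a b := by
  refine intervalIntegrable_of_abs_le (B := B * Bq) ha hb
    ((aestronglyMeasurable_of_ae_continuousAt hc).mul
      (Continuous.aestronglyMeasurable (by fun_prop))) fun u hu => ?_
  rw [abs_mul]
  exact mul_le_mul (hB u hu) (hqB _) (abs_nonneg _) ((abs_nonneg _).trans (hB u hu))

/-- Indexed by lags, the sum is the integral of a step function over [0, b] with b = (i-1)/h.
Replacing the kernel costs an L¹ error over [0, Ξ], which involves neither r nor i. Replacing the
argument of `q` costs L/T pointwise, and the missing interval [b, ξr] has length at most ξ/T. -/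
lemma abs_discSum_sub_contSum_le {q : ℝ → ℝ} {L : NNReal} {Bq : ℝ}
    (hB : ∀ u, 0 ≤ u → |K u| ≤ B)
    (hc : ∀ᵐ u ∂(volume.restrict (Ioi (0 : ℝ))), ContinuousAt K u)
    (hq : LipschitzWith L q) (hqB : ∀ x, |q x| ≤ Bq) {T : ℕ} (hT : 0 < T) {ξ r : ℝ}
    (hξ : ξ ∈ Icc 1 Ξ) (hr : r ∈ Ioc (0 : ℝ) 1) :
    |discSum K q T ξ ⌈r * T⌉₊ - contSum K q ξ r| ≤
      Bq * (∫ u in (0 : ℝ)..Ξ, |K (⌈u * (T / ξ)⌉₊ / (T / ξ)) - K u|)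
        + (B * L * Ξ + B * Bq * Ξ) / T := by
  have hT' : (0 : ℝ) < T := by exact_mod_cast hT
  have hξ0 : 0 < ξ := by linarith [hξ.1]
  have hB0 : 0 ≤ B := (abs_nonneg _).trans (hB 0 le_rfl)
  have hBq0 : 0 ≤ Bq := (abs_nonneg _).trans (hqB 0)
  set h : ℝ := T / ξ with hh
  have hh0 : 0 < h := by positivity
  set i : ℕ := ⌈r * T⌉₊ with hi
  have hi1 : 1 ≤ i := Nat.one_le_ceil_iff.2 (mul_pos hr.1 hT')
  have hir : r * T ≤ i := Nat.le_ceil _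
  have hir' : (i : ℝ) < r * T + 1 := Nat.ceil_lt_add_one (by have := hr.1; positivity)
  have hcast : ((i - 1 : ℕ) : ℝ) = (i : ℝ) - 1 := by rw [Nat.cast_sub hi1]; simp
  set b : ℝ := ((i - 1 : ℕ) : ℝ) / h with hb
  have hb0 : 0 ≤ b := by positivity
  have hbr : b ≤ ξ * r := by
    rw [hb, div_le_iff₀ hh0, hh, hcast]
    have : ξ * r * (T / ξ) = r * T := by field_simp
    linarith
  have hrb : ξ * r - b ≤ ξ / T := by
    have : ξ / T = 1 / h := by rw [hh]; field_simp
    rw [this, hb, hcast, sub_le_iff_le_add, ← add_div, le_div_iff₀ hh0, hh]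
    have : ξ * r * (T / ξ) = r * T := by field_simp
    linarith
  have hrΞ : ξ * r ≤ Ξ := by nlinarith [hξ.1, hξ.2, hr.1, hr.2]
  have hΞ0 : 0 ≤ Ξ := by linarith [hξ.1, hξ.2]
  set F : ℕ → ℝ := fun k => K ((k : ℝ) / h) * q (((i : ℝ) - k) / T) with hF
  obtain ⟨hFi, hFe⟩ := integral_comp_ceil F hh0 (i - 1)
  have hci := fun {a b : ℝ} => integrable_contSum (a := a) (b := b) hB hc hq.continuous hqB ξ r
  rw [discSum_eq_lag, ← hFe, contSum,
    ← intervalIntegral.integral_add_adjacent_intervals (hci le_rfl hb0)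
      (hci hb0 (hb0.trans hbr)), ← sub_sub,
    ← intervalIntegral.integral_sub hFi (hci le_rfl hb0)]
  have hκ : IntervalIntegrable (fun u => |K (⌈u * h⌉₊ / h) - K u|) volume 0 Ξ := by
    refine intervalIntegrable_of_abs_le (B := 2 * B) le_rfl hΞ0
      (((measurable_comp_ceil (fun k => K (k / h)) h).aestronglyMeasurable.sub
        (aestronglyMeasurable_of_ae_continuousAt hc)).norm) fun u hu => ?_
    have h1 := hB (⌈u * h⌉₊ / h) (by positivity)
    have h2 := hB u hu
    rw [abs_abs]
    rw [abs_le] at h1 h2 ⊢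
    constructor <;> linarith
  have hκb : IntervalIntegrable (fun u => |K (⌈u * h⌉₊ / h) - K u|) volume 0 b :=
    hκ.mono_set (by rw [uIcc_of_le hb0, uIcc_of_le hΞ0]; exact Icc_subset_Icc_right (hbr.trans hrΞ))
  have h1 : |∫ u in (0 : ℝ)..b, (F ⌈u * h⌉₊ - K u * q (r - u / ξ))| ≤
      Bq * (∫ u in (0 : ℝ)..Ξ, |K (⌈u * h⌉₊ / h) - K u|) + B * L * Ξ / T := by
    have hpt : ∀ u ∈ Ioc 0 b, ‖F ⌈u * h⌉₊ - K u * q (r - u / ξ)‖ ≤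
        Bq * |K (⌈u * h⌉₊ / h) - K u| + B * (L * (1 / T)) := by
      intro u hu
      have hle : (⌈u * h⌉₊ : ℝ) ≥ u * h := Nat.le_ceil _
      have hlt : (⌈u * h⌉₊ : ℝ) < u * h + 1 := Nat.ceil_lt_add_one (by have := hu.1; positivity)
      have huh : u / ξ = u * h / T := by rw [hh]; field_simp
      -- Both rounding errors, i - rT and ⌈uh⌉ - uh, lie in [0, 1), so they differ by less than 1.
      have hdiff : |((i : ℝ) - ⌈u * h⌉₊) / T - (r - u / ξ)| ≤ 1 / T := by
        have : ((i : ℝ) - ⌈u * h⌉₊) / T - (r - u / ξ)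
            = ((i - r * T) - (⌈u * h⌉₊ - u * h)) / T := by rw [huh]; field_simp; ring
        rw [this, abs_div, abs_of_pos hT']
        gcongr
        rw [abs_le]; constructor <;> linarith
      have hqd : |q (((i : ℝ) - ⌈u * h⌉₊) / T) - q (r - u / ξ)| ≤ L * (1 / T) :=
        (hq.dist_le_mul _ _).trans (mul_le_mul_of_nonneg_left hdiff L.2)
      have : F ⌈u * h⌉₊ - K u * q (r - u / ξ) =
          (K (⌈u * h⌉₊ / h) - K u) * q (((i : ℝ) - ⌈u * h⌉₊) / T)
          + K u * (q (((i : ℝ) - ⌈u * h⌉₊) / T) - q (r - u / ξ)) := by rw [hF]; ring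
      rw [this, Real.norm_eq_abs]
      refine (abs_add_le _ _).trans (add_le_add ?_ ?_)
      · rw [abs_mul, mul_comm]
        exact mul_le_mul_of_nonneg_right (hqB _) (abs_nonneg _)
      · rw [abs_mul]
        exact mul_le_mul (hB u hu.1.le) hqd (abs_nonneg _) hB0
    have hint := (hκb.const_mul Bq).add (intervalIntegrable_const (c := B * (L * (1 / (T : ℝ))))
      (μ := volume) (a := 0) (b := b))
    have := intervalIntegral.norm_integral_le_of_norm_le hb0 (ae_of_all _ hpt) hint
    rw [Real.norm_eq_abs] at this
    refine this.trans ?_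
    rw [intervalIntegral.integral_add (hκb.const_mul Bq) intervalIntegrable_const,
      intervalIntegral.integral_const_mul, intervalIntegral.integral_const]
    refine add_le_add (mul_le_mul_of_nonneg_left ?_ hBq0) ?_
    · exact intervalIntegral.integral_mono_interval le_rfl hb0 (hbr.trans hrΞ)
        (ae_of_all _ fun _ => abs_nonneg _) hκ
    · rw [smul_eq_mul, sub_zero]
      calc b * (B * (L * (1 / T))) ≤ Ξ * (B * (L * (1 / T))) := by
            gcongr; exact hbr.trans hrΞ
        _ = _ := by ring
  have h2 : |∫ u in b..ξ * r, K u * q (r - u / ξ)| ≤ B * Bq * Ξ / T := by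
    have := intervalIntegral.norm_integral_le_of_norm_le_const (a := b) (b := ξ * r)
      (f := fun u => K u * q (r - u / ξ)) (C := B * Bq) (fun u hu => by
        rw [uIoc_of_le hbr] at hu
        rw [Real.norm_eq_abs, abs_mul]
        exact mul_le_mul (hB u (hb0.trans hu.1.le)) (hqB _) (abs_nonneg _) hB0)
    rw [Real.norm_eq_abs] at this
    refine this.trans ?_
    rw [abs_of_nonneg (by linarith), mul_div_assoc]
    gcongr
    exact hrb.trans (by gcongr; exact hξ.2)
  have h3 : (B * L * Ξ + B * Bq * Ξ) / T = B * L * Ξ / T + B * Bq * Ξ / T := add_div _ _ _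
  rw [abs_le] at h1 h2 ⊢
  constructor <;> linarith [h1.1, h1.2, h2.1, h2.2]

lemma eventually_abs_discSum_sub_contSum_le {q : ℝ → ℝ} {L : NNReal} {Bq : ℝ}
    (hB : ∀ u, 0 ≤ u → |K u| ≤ B)
    (hc : ∀ᵐ u ∂(volume.restrict (Ioi (0 : ℝ))), ContinuousAt K u) (hΞ : 0 ≤ Ξ)
    (hq : LipschitzWith L q) (hqB : ∀ x, |q x| ≤ Bq) {ρ : ℝ} (hρ : 0 < ρ) :
    ∀ᶠ T : ℕ in atTop, ∀ ξ ∈ Icc 1 Ξ, ∀ r ∈ Ioc (0 : ℝ) 1,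
      |discSum K q T ξ ⌈r * T⌉₊ - contSum K q ξ r| ≤ ρ := by
  have h1 := (tendsto_integral_abs_comp_ceil_sub hB hc hΞ).const_mul Bq
  rw [mul_zero] at h1
  have h2 := tendsto_const_div_atTop_nhds_zero_nat (B * L * Ξ + B * Bq * Ξ)
  filter_upwards [eventually_bandwidth (Ξ := Ξ) (h1.eventually_le_const (half_pos hρ)),
    h2.eventually_le_const (half_pos hρ), eventually_gt_atTop 0] with T hT1 hT2 hT3 ξ hξ r hr
  have := abs_discSum_sub_contSum_le hB hc hq hqB hT3 hξ hr
  linarith [hT1 ξ hξ]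

lemma normConst_eq_discSum (K : ℝ → ℝ) (T : ℕ) (ξ : ℝ) (i : ℕ) :
    normConst K (T / ξ) i = discSum K (fun _ => 1) T ξ i := by
  simp [normConst, discSum]

lemma contSum_one (K : ℝ → ℝ) (ξ r : ℝ) :
    contSum K (fun _ => 1) ξ r = ∫ v in (0 : ℝ)..ξ * r, K v := by
  simp [contSum]

/-- The primitive of `K` is continuous, hence attains a positive minimum on the compact interval. -/
lemma exists_pos_le_integral (hB : ∀ u, 0 ≤ u → |K u| ≤ B)
    (hc : ∀ᵐ u ∂(volume.restrict (Ioi (0 : ℝ))), ContinuousAt K u)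
    (hpos : ∀ x ∈ Ioc 0 Ξ, 0 < ∫ u in (0 : ℝ)..x, K u) {δ : ℝ} (hδ : 0 < δ) :
    ∃ c > 0, ∀ x ∈ Icc δ Ξ, c ≤ ∫ u in (0 : ℝ)..x, K u := by
  rcases (Icc δ Ξ).eq_empty_or_nonempty with he | hne
  · exact ⟨1, one_pos, fun x hx => by simp [he] at hx⟩
  have hδΞ : δ ≤ Ξ := nonempty_Icc.1 hne
  have h0Ξ : 0 ≤ Ξ := hδ.le.trans hδΞ
  have hcont : ContinuousOn (fun x => ∫ u in (0 : ℝ)..x, K u) (Icc δ Ξ) := by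
    have hi := intervalIntegrable_of_abs_le le_rfl h0Ξ (aestronglyMeasurable_of_ae_continuousAt hc) hB
    have := intervalIntegral.continuousOn_primitive_interval
      ((intervalIntegrable_iff' (by simp)).1 hi)
    rw [uIcc_of_le h0Ξ] at this
    exact this.mono (Icc_subset_Icc_left hδ.le)
  obtain ⟨x₀, hx₀, hmin⟩ := isCompact_Icc.exists_isMinOn hne hcont
  exact ⟨_, hpos x₀ ⟨hδ.trans_le hx₀.1, hx₀.2⟩, fun x hx => hmin hx⟩

/-- The normalizing constants stay away from zero at times bounded away from zero. -/
lemma exists_pos_le_discSum_one (hB : ∀ u, 0 ≤ u → |K u| ≤ B)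
    (hc : ∀ᵐ u ∂(volume.restrict (Ioi (0 : ℝ))), ContinuousAt K u)
    (hpos : ∀ x ∈ Ioc 0 Ξ, 0 < ∫ u in (0 : ℝ)..x, K u) (hΞ : 0 ≤ Ξ) {δ : ℝ} (hδ : 0 < δ) :
    ∃ c > 0, ∀ᶠ T : ℕ in atTop, ∀ ξ ∈ Icc 1 Ξ, ∀ i : ℕ, δ * T ≤ i → i ≤ T →
      c ≤ discSum K (fun _ => 1) T ξ i := by
  obtain ⟨c, hc0, hcle⟩ := exists_pos_le_integral hB hc hpos hδ
  refine ⟨c / 2, half_pos hc0, ?_⟩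
  filter_upwards [eventually_abs_discSum_sub_contSum_le hB hc hΞ
    (LipschitzWith.const (1 : ℝ)) (Bq := 1) (by simp) (half_pos hc0), eventually_gt_atTop 0]
    with T hT hT0 ξ hξ i hi hiT
  have hT' : (0 : ℝ) < T := by exact_mod_cast hT0
  have hiT' : (i : ℝ) ≤ T := by exact_mod_cast hiT
  have hr0 : δ ≤ (i : ℝ) / T := (le_div_iff₀ hT').2 hi
  have hr1 : (i : ℝ) / T ≤ 1 := (div_le_one hT').2 hiT'
  have := hT ξ hξ ((i : ℝ) / T) ⟨hδ.trans_le hr0, hr1⟩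
  rw [div_mul_cancel₀ _ hT'.ne', Nat.ceil_natCast, contSum_one] at this
  have h2 := hcle (ξ * (i / T)) ⟨by nlinarith [hξ.1], by nlinarith [hξ.1, hξ.2]⟩
  linarith [(abs_le.1 this).1]

/-- The weights of the predictions of `Y_i` are of the order `i⁻¹`, uniformly in the bandwidth. -/
lemma exists_weight_bound (hB : ∀ u, 0 ≤ u → |K u| ≤ B)
    (hc : ∀ᵐ u ∂(volume.restrict (Ioi (0 : ℝ))), ContinuousAt K u)
    (hpos : ∀ x ∈ Ioc 0 Ξ, 0 < ∫ u in (0 : ℝ)..x, K u) (hΞ : 0 < Ξ)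
    (hnear : ∃ C η : ℝ, 0 < η ∧ ∀ u ∈ Ioc 0 η, 0 < K u ∧ ∀ v ∈ Ioc 0 (2 * u), K v ≤ C * K u) :
    ∃ C > 0, ∀ᶠ T : ℕ in atTop, ∀ ξ ∈ Icc 1 Ξ, ∀ i : ℕ, 2 ≤ i → i ≤ T →
      0 < discSum K (fun _ => 1) T ξ i ∧ ∀ k ∈ Finset.Icc 1 (i - 1),
        ((T : ℝ) / ξ)⁻¹ * |K ((k : ℝ) / (T / ξ))| ≤ C / i * discSum K (fun _ => 1) T ξ i := by
  obtain ⟨C, η, hη, hnear⟩ := hnear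
  have hC : 1 ≤ C := by
    have h1 := hnear η ⟨hη, le_rfl⟩
    have h2 := h1.2 η ⟨hη, by linarith⟩
    nlinarith [h1.1]
  -- The threshold η/Ξ separates two regimes. For i ≥ (η/Ξ)T the normalizing constant is at least c;
  -- for smaller i every lag satisfies k/h ≤ η, so only the behaviour of `K` near 0 matters.
  obtain ⟨c, hc0, hcT⟩ := exists_pos_le_discSum_one hB hc hpos hΞ.le
    (δ := η / Ξ) (by positivity)
  have hB0 : 0 ≤ B := (abs_nonneg _).trans (hB 0 le_rfl)
  have hC' : 0 < 2 * C + B * Ξ / c := by positivity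
  refine ⟨2 * C + B * Ξ / c, hC', ?_⟩
  filter_upwards [hcT] with T hT ξ hξ i hi hiT
  have hi0 : (0 : ℝ) < i := by exact_mod_cast (by omega : 0 < i)
  have hiT' : (i : ℝ) ≤ T := by exact_mod_cast hiT
  have hT' : (0 : ℝ) < T := hi0.trans_le hiT'
  have hξ0 : 0 < ξ := by linarith [hξ.1]
  set h : ℝ := T / ξ with hh
  have hh0 : 0 < h := by positivity
  rcases le_or_gt (η / Ξ * T) i with hcase | hcase
  · have hN := hT ξ hξ i hcase hiT
    refine ⟨hc0.trans_le hN, fun k hk => ?_⟩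
    have h1 : h⁻¹ ≤ Ξ / i := by
      rw [hh, inv_div]
      exact div_le_div₀ hΞ.le hξ.2 hi0 hiT'
    calc h⁻¹ * |K (k / h)| ≤ Ξ / i * B := by
          gcongr
          exact hB _ (by positivity)
      _ = B * Ξ / c / i * c := by field_simp
      _ ≤ (2 * C + B * Ξ / c) / i * discSum K (fun _ => 1) T ξ i := by
          gcongr
          linarith
  · have hsmall : ∀ k ∈ Finset.Icc 1 (i - 1), (k : ℝ) / h ∈ Ioc 0 η := by
      intro k hk
      rw [Finset.mem_Icc] at hk
      have hk0 : (0 : ℝ) < k := by exact_mod_cast hk.1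
      have hki : (k : ℝ) ≤ i := by exact_mod_cast (by omega : k ≤ i)
      refine ⟨by positivity, ?_⟩
      rw [div_le_iff₀ hh0]
      refine (hki.trans hcase.le).trans ?_
      rw [hh, div_mul_eq_mul_div, mul_div_assoc]
      gcongr
      exact hξ.2
    have hsum : discSum K (fun _ => 1) T ξ i = h⁻¹ * ∑ k ∈ Finset.Icc 1 (i - 1), K (k / h) := by
      rw [discSum_eq_lag]; simp [hh]
    have hposK : ∀ k ∈ Finset.Icc 1 (i - 1), 0 < K ((k : ℝ) / h) :=
      fun k hk => (hnear _ (hsmall k hk)).1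
    have hkey : ∀ k ∈ Finset.Icc 1 (i - 1), h⁻¹ * |K ((k : ℝ) / h)| ≤
        (2 * C) / i * discSum K (fun _ => 1) T ξ i := by
      intro k hk
      -- Every l ≥ ⌊i/2⌋ satisfies k ≤ i - 1 ≤ 2l, so K(k/h) ≤ C K(l/h). Averaging over these at
      -- least i/2 values of l bounds one weight by O(1/i) times the sum of all weights.
      have hsub : Finset.Icc (i / 2) (i - 1) ⊆ Finset.Icc 1 (i - 1) :=
        Finset.Icc_subset_Icc_left (by omega)
      have hcard : ∑ l ∈ Finset.Icc (i / 2) (i - 1), K ((k : ℝ) / h) ≤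
          C * ∑ l ∈ Finset.Icc 1 (i - 1), K ((l : ℝ) / h) := by
        rw [Finset.mul_sum]
        refine (Finset.sum_le_sum fun l hl => ?_).trans
          (Finset.sum_le_sum_of_subset_of_nonneg hsub fun l hl _ =>
            mul_nonneg (by linarith) (hposK l hl).le)
        refine (hnear _ (hsmall l (hsub hl))).2 _ ⟨(hsmall k hk).1, ?_⟩
        rw [Finset.mem_Icc] at hk hl
        have : (k : ℝ) ≤ 2 * l := by exact_mod_cast (by omega : k ≤ 2 * l)
        rw [← mul_div_assoc]
        gcongr
      rw [Finset.sum_const, Nat.card_Icc, nsmul_eq_mul] at hcard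
      have hcnt : (i : ℝ) / 2 ≤ ((i - 1 + 1 - i / 2 : ℕ) : ℝ) := by
        rw [div_le_iff₀ (by norm_num)]
        exact_mod_cast (by omega : i ≤ (i - 1 + 1 - i / 2) * 2)
      rw [abs_of_pos (hposK k hk), hsum]
      have h3 := (mul_le_mul_of_nonneg_right hcnt (hposK k hk).le).trans hcard
      have h4 : K ((k : ℝ) / h) ≤ 2 * C / i * ∑ l ∈ Finset.Icc 1 (i - 1), K ((l : ℝ) / h) := by
        rw [div_mul_eq_mul_div, le_div_iff₀ hi0]
        linarith
      calc h⁻¹ * K (k / h) ≤ h⁻¹ * (2 * C / i * ∑ l ∈ Finset.Icc 1 (i - 1), K ((l : ℝ) / h)) := by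
            gcongr
        _ = _ := by ring
    have hN : 0 < discSum K (fun _ => 1) T ξ i := by
      rw [hsum]
      exact mul_pos (inv_pos.2 hh0) (Finset.sum_pos hposK ⟨1, by simp; omega⟩)
    refine ⟨hN, fun k hk => (hkey k hk).trans ?_⟩
    gcongr
    linarith [show 0 ≤ B * Ξ / c by positivity]

end Deterministic

/-! ### Predictions from the noiseless regression function -/

/-- The sequential prediction computed from the values `q (j / T)`. -/
noncomputable def discPred (K q : ℝ → ℝ) (T : ℕ) (ξ : ℝ) (i : ℕ) : ℝ :=
  (discSum K (fun _ => 1) T ξ i)⁻¹ * discSum K q T ξ i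

/-- The sequential prediction computed from a sequence `x`. -/
noncomputable def seqPred (K : ℝ → ℝ) (x : ℕ → ℝ) (T : ℕ) (ξ : ℝ) (i : ℕ) : ℝ :=
  (discSum K (fun _ => 1) T ξ i)⁻¹ *
    (((T : ℝ) / ξ)⁻¹ * ∑ j ∈ Finset.Ico 1 i, K (((i : ℝ) - j) / (T / ξ)) * x j)

lemma discPred_eq_seqPred (K q : ℝ → ℝ) (T : ℕ) (ξ : ℝ) (i : ℕ) :
    discPred K q T ξ i = seqPred K (fun j => q ((j : ℝ) / T)) T ξ i := rfl

lemma seqPred_add (K : ℝ → ℝ) (x y : ℕ → ℝ) (T : ℕ) (ξ : ℝ) (i : ℕ) :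
    seqPred K (fun j => x j + y j) T ξ i = seqPred K x T ξ i + seqPred K y T ξ i := by
  simp only [seqPred, mul_add, Finset.sum_add_distrib]

lemma contSum_eq_integral (K q : ℝ → ℝ) {ξ : ℝ} (hξ : ξ ≠ 0) (r : ℝ) :
    contSum K q ξ r = ∫ u in (0 : ℝ)..r, ξ * K (ξ * (r - u)) * q u := by
  have := intervalIntegral.mul_integral_comp_sub_mul (a := 0) (b := r)
    (f := fun v => K v * q (r - v / ξ)) ξ (ξ * r)
  rw [sub_self, mul_zero, sub_zero] at this
  rw [contSum, ← this, ← intervalIntegral.integral_const_mul]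
  refine intervalIntegral.integral_congr fun u _ => ?_
  have h1 : r - (ξ * r - ξ * u) / ξ = u := by field_simp; ring
  simp only [h1]
  rw [← mul_sub]
  ring

lemma limPred_eq (K q : ℝ → ℝ) {ξ : ℝ} (hξ : ξ ≠ 0) (r : ℝ) :
    limPred K q ξ r = contSum K q ξ r / contSum K (fun _ => 1) ξ r := by
  simp [limPred, contSum_eq_integral _ _ hξ]

/-- The event that the predictions of `Y_i` have weights of order `i⁻¹`, for all bandwidths. -/
def HasWeightBound (K : ℝ → ℝ) (Ξ C : ℝ) (T : ℕ) : Prop :=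
  ∀ ξ ∈ Icc 1 Ξ, ∀ i : ℕ, 2 ≤ i → i ≤ T →
    0 < discSum K (fun _ => 1) T ξ i ∧ ∀ k ∈ Finset.Icc 1 (i - 1),
      ((T : ℝ) / ξ)⁻¹ * |K ((k : ℝ) / (T / ξ))| ≤ C / i * discSum K (fun _ => 1) T ξ i

lemma IsBoundedKernel.exists_hasWeightBound {K : ℝ → ℝ} {Ξ : ℝ} (hK : IsBoundedKernel K Ξ)
    (hΞ : 0 < Ξ) : ∃ C > 0, ∀ᶠ T : ℕ in atTop, HasWeightBound K Ξ C T := by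
  obtain ⟨B, hB⟩ := hK.bounded
  exact exists_weight_bound hB hK.ae_continuous hK.integral_pos hΞ hK.near_zero

/-! ### Consequences of the weight bound. -/

section Weights

variable {K : ℝ → ℝ} {Ξ C : ℝ} {T : ℕ}

lemma HasWeightBound.abs_seqPred_le (hw : HasWeightBound K Ξ C T) (x : ℕ → ℝ) {ξ : ℝ}
    (hξ : ξ ∈ Icc 1 Ξ) {i : ℕ} (hi : i ≤ T) :
    |seqPred K x T ξ i| ≤ C / i * ∑ j ∈ Finset.Ico 1 i, |x j| := by
  rcases Nat.lt_or_ge i 2 with h2 | h2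
  · have : Finset.Ico 1 i = ∅ := Finset.Ico_eq_empty (by omega)
    simp [seqPred, this]
  obtain ⟨hN, hk⟩ := hw ξ hξ i h2 hi
  have hξ0 : 0 < ξ := by linarith [hξ.1]
  rw [seqPred, abs_mul, abs_inv, abs_of_pos hN, inv_mul_le_iff₀ hN, abs_mul,
    abs_of_nonneg (show 0 ≤ ((T : ℝ) / ξ)⁻¹ by positivity), Finset.mul_sum, Finset.mul_sum]
  refine (mul_le_mul_of_nonneg_left (Finset.abs_sum_le_sum_abs _ _) (by positivity)).trans ?_
  rw [Finset.mul_sum]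
  refine Finset.sum_le_sum fun j hj => ?_
  rw [Finset.mem_Ico] at hj
  have := hk (i - j) (by rw [Finset.mem_Icc]; omega)
  rw [Nat.cast_sub hj.2.le] at this
  rw [abs_mul, ← mul_assoc]
  calc _ ≤ C / i * discSum K (fun _ => 1) T ξ i * |x j| :=
        mul_le_mul_of_nonneg_right this (abs_nonneg _)
    _ = _ := by ring

lemma HasWeightBound.abs_discPred_le (hw : HasWeightBound K Ξ C T) (hC : 0 < C) {q : ℝ → ℝ}
    {Bq : ℝ} (hqB : ∀ x, |q x| ≤ Bq) {ξ : ℝ} (hξ : ξ ∈ Icc 1 Ξ) {i : ℕ} (hi : i ≤ T) :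
    |discPred K q T ξ i| ≤ C * Bq := by
  have hBq0 : 0 ≤ Bq := (abs_nonneg _).trans (hqB 0)
  refine (hw.abs_seqPred_le _ hξ hi).trans ?_
  rcases Nat.eq_zero_or_pos i with h0 | h0
  · subst h0; simp; positivity
  have hi0 : (0 : ℝ) < i := by exact_mod_cast h0
  have : ∑ j ∈ Finset.Ico 1 i, |q ((j : ℝ) / T)| ≤ i * Bq := by
    refine (Finset.sum_le_sum (g := fun _ => Bq) fun (j : ℕ) _ => hqB _).trans ?_
    rw [Finset.sum_const, Nat.card_Ico, nsmul_eq_mul]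
    gcongr
    exact Nat.sub_le _ _
  calc C / i * _ ≤ C / i * (i * Bq) := by gcongr
    _ = _ := by field_simp

lemma HasWeightBound.seqPred_sq_le (hw : HasWeightBound K Ξ C T) (hC : 0 < C) (x : ℕ → ℝ) {ξ : ℝ}
    (hξ : ξ ∈ Icc 1 Ξ) {i : ℕ} (hi : i ≤ T) :
    seqPred K x T ξ i ^ 2 ≤ C ^ 2 * ((i : ℝ)⁻¹ * ∑ j ∈ Finset.Ico 1 i, x j ^ 2) := by
  have h1 := pow_le_pow_left₀ (abs_nonneg _) (hw.abs_seqPred_le x hξ hi) 2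
  rw [sq_abs] at h1
  refine h1.trans ?_
  rcases Nat.eq_zero_or_pos i with h0 | h0
  · subst h0; simp
  have hi0 : (0 : ℝ) < i := by exact_mod_cast h0
  have h2 := sq_sum_le_card_mul_sum_sq (s := Finset.Ico 1 i) (f := fun j => |x j|)
  simp only [sq_abs, Nat.card_Ico] at h2
  have h3 : (∑ j ∈ Finset.Ico 1 i, |x j|) ^ 2 ≤ i * ∑ j ∈ Finset.Ico 1 i, x j ^ 2 := by
    refine h2.trans ?_
    gcongr
    exact Nat.sub_le _ _
  calc (C / i * ∑ j ∈ Finset.Ico 1 i, |x j|) ^ 2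
      = C ^ 2 / (i : ℝ) ^ 2 * (∑ j ∈ Finset.Ico 1 i, |x j|) ^ 2 := by ring
    _ ≤ C ^ 2 / (i : ℝ) ^ 2 * (i * ∑ j ∈ Finset.Ico 1 i, x j ^ 2) := by gcongr
    _ = _ := by field_simp

end Weights

section Predictions

variable {K q : ℝ → ℝ} {Ξ Bq : ℝ} {L : NNReal}

/-- Here a/b - a'/b' = ((a - a') - (a/b)(b - b'))/b'. A quantitative lower bound is needed for b'
alone; for b the bound on the ratio a/b takes its place. -/
lemma abs_div_sub_div_le {a b a' b' c M ρ : ℝ} (hc : 0 < c) (hb' : c ≤ b') (hb : 0 < b)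
    (hM : |a / b| ≤ M) (ha : |a - a'| ≤ ρ) (hbb : |b - b'| ≤ ρ) :
    |a / b - a' / b'| ≤ (1 + M) * ρ / c := by
  have hb'0 : 0 < b' := hc.trans_le hb'
  have h : a / b - a' / b' = ((a - a') - a / b * (b - b')) / b' := by field_simp; ring
  have hρ : 0 ≤ ρ := (abs_nonneg _).trans ha
  rw [h, abs_div, abs_of_pos hb'0]
  have h2 : |(a - a') - a / b * (b - b')| ≤ (1 + M) * ρ := by
    refine (abs_sub _ _).trans ?_
    rw [abs_mul, add_mul, one_mul]
    exact add_le_add ha (mul_le_mul hM hbb (abs_nonneg _) ((abs_nonneg _).trans hM))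
  have : 0 ≤ (1 + M) * ρ := (abs_nonneg _).trans h2
  gcongr

lemma eventually_abs_discPred_sub_limPred_le (hK : IsBoundedKernel K Ξ) (hΞ : 0 < Ξ)
    (hq : LipschitzWith L q) (hqB : ∀ x, |q x| ≤ Bq) {δ ρ : ℝ} (hδ : 0 < δ) (hρ : 0 < ρ) :
    ∀ᶠ T : ℕ in atTop, ∀ ξ ∈ Icc 1 Ξ, ∀ r ∈ Icc δ 1,
      |discPred K q T ξ ⌈r * T⌉₊ - limPred K q ξ r| ≤ ρ := by
  obtain ⟨B, hB⟩ := hK.bounded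
  obtain ⟨C, hC, hw⟩ := hK.exists_hasWeightBound hΞ
  obtain ⟨c, hc, hcle⟩ := exists_pos_le_integral hB hK.ae_continuous hK.integral_pos hδ
  obtain ⟨c', hc', hcle'⟩ := exists_pos_le_discSum_one hB hK.ae_continuous hK.integral_pos hΞ.le hδ
  have hBq0 : 0 ≤ Bq := (abs_nonneg _).trans (hqB 0)
  have hρ' : 0 < ρ * c / (1 + C * Bq) := by positivity
  filter_upwards [hw, hcle', eventually_gt_atTop 0,
    eventually_abs_discSum_sub_contSum_le hB hK.ae_continuous hΞ.le hq hqB hρ',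
    eventually_abs_discSum_sub_contSum_le hB hK.ae_continuous hΞ.le
      (LipschitzWith.const (1 : ℝ)) (Bq := 1) (by simp) hρ'] with T h1 h2 hT h3 h4 ξ hξ r hr
  have hT' : (0 : ℝ) < T := by exact_mod_cast hT
  have hr0 : r ∈ Ioc (0 : ℝ) 1 := ⟨hδ.trans_le hr.1, hr.2⟩
  have hiT : ⌈r * T⌉₊ ≤ T := Nat.ceil_le.2 (by nlinarith [hr.2])
  have hb := h2 ξ hξ ⌈r * T⌉₊
    ((mul_le_mul_of_nonneg_right hr.1 hT'.le).trans (Nat.le_ceil _)) hiT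
  have hD := h1.abs_discPred_le hC hqB hξ hiT
  have hcont : c ≤ contSum K (fun _ => 1) ξ r := by
    rw [contSum_one]
    exact hcle _ ⟨by nlinarith [hξ.1, hr.1], by nlinarith [hξ.1, hξ.2, hr.1, hr.2]⟩
  rw [limPred_eq K q (by linarith [hξ.1])]
  rw [discPred, inv_mul_eq_div] at hD ⊢
  refine (abs_div_sub_div_le hc hcont (hc'.trans_le hb) hD (h3 ξ hξ r hr0)
    (h4 ξ hξ r hr0)).trans (le_of_eq ?_)
  field_simp

/-- Near r = 0 the denominator of the limiting prediction tends to 0, so a direct estimate fails.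
The bound is inherited from the discrete predictions, which the weight bound controls uniformly in
i; the extra 1 is the approximation error. -/
lemma exists_abs_limPred_le (hK : IsBoundedKernel K Ξ) (hΞ : 0 < Ξ)
    (hq : LipschitzWith L q) (hqB : ∀ x, |q x| ≤ Bq) :
    ∃ A, 0 < A ∧ (∀ ξ ∈ Icc 1 Ξ, ∀ r ∈ Ioc (0 : ℝ) 1, |limPred K q ξ r| ≤ A) ∧
      ∀ᶠ T : ℕ in atTop, ∀ ξ ∈ Icc 1 Ξ, ∀ i ≤ T, |discPred K q T ξ i| ≤ A := by
  obtain ⟨C, hC, hw⟩ := hK.exists_hasWeightBound hΞ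
  have hBq0 : 0 ≤ Bq := (abs_nonneg _).trans (hqB 0)
  refine ⟨C * Bq + 1, by positivity, fun ξ hξ r hr => ?_, ?_⟩
  · obtain ⟨T, h1, h2⟩ := (hw.and
      (eventually_abs_discPred_sub_limPred_le hK hΞ hq hqB hr.1 one_pos)).exists
    have h3 := h2 ξ hξ r ⟨le_rfl, hr.2⟩
    have h4 := h1.abs_discPred_le hC hqB hξ (i := ⌈r * T⌉₊)
      (Nat.ceil_le.2 (mul_le_of_le_one_left (Nat.cast_nonneg T) hr.2))
    rw [abs_le] at h3 h4 ⊢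
    constructor <;> linarith
  · filter_upwards [hw] with T h1 ξ hξ i hi
    linarith [h1.abs_discPred_le hC hqB hξ hi]

/-- The discrete predictions, as step functions of r, converge pointwise on (0, 1]. -/
lemma aestronglyMeasurable_limPred (hK : IsBoundedKernel K Ξ) (hΞ : 0 < Ξ)
    (hq : LipschitzWith L q) (hqB : ∀ x, |q x| ≤ Bq) {ξ : ℝ} (hξ : ξ ∈ Icc 1 Ξ) :
    AEStronglyMeasurable (limPred K q ξ) (volume.restrict (Ioc 0 1)) := by
  refine aestronglyMeasurable_of_tendsto_ae (atTop : Filter ℕ)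
    (f := fun (T : ℕ) (r : ℝ) => discPred K q T ξ ⌈r * T⌉₊)
    (fun T => (measurable_comp_ceil (discPred K q T ξ) T).aestronglyMeasurable) ?_
  filter_upwards [ae_restrict_mem measurableSet_Ioc] with r hr
  rw [Metric.tendsto_nhds]
  intro ρ hρ
  filter_upwards [eventually_abs_discPred_sub_limPred_le hK hΞ hq hqB hr.1 (half_pos hρ)]
    with T hT
  rw [Real.dist_eq]
  linarith [hT ξ hξ r ⟨le_rfl, hr.2⟩]

/-- The noiseless predictions vary slowly in time, away from time zero. -/
lemma exists_abs_discPred_succ_sub_le (hK : IsBoundedKernel K Ξ) (hΞ : 0 < Ξ)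
    (hq : LipschitzWith L q) (hqB : ∀ x, |q x| ≤ Bq) {δ : ℝ} (hδ : 0 < δ) :
    ∃ Λ : ℝ, 0 ≤ Λ ∧ ∀ᶠ T : ℕ in atTop, ∀ ξ ∈ Icc 1 Ξ, ∀ i : ℕ, δ * T ≤ i → i + 1 ≤ T →
      |discPred K q T ξ (i + 1) - discPred K q T ξ i| ≤ Λ / T := by
  obtain ⟨B, hB⟩ := hK.bounded
  obtain ⟨c, hc, hcle⟩ := exists_pos_le_discSum_one hB hK.ae_continuous hK.integral_pos hΞ.le hδ
  obtain ⟨A, hA, -, hAD⟩ := exists_abs_limPred_le hK hΞ hq hqB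
  have hB0 : 0 ≤ B := (abs_nonneg _).trans (hB 0 le_rfl)
  have hBq0 : 0 ≤ Bq := (abs_nonneg _).trans (hqB 0)
  have hdiff : ∀ (p : ℝ → ℝ) (L' : NNReal) (Bp : ℝ), LipschitzWith L' p → (∀ x, |p x| ≤ Bp) →
      ∀ T : ℕ, ∀ ξ ∈ Icc 1 Ξ, ∀ i : ℕ, i + 1 ≤ T →
      |discSum K p T ξ (i + 1) - discSum K p T ξ i| ≤ Ξ * (B * Bp + B * L') / T := by
    intro p L' Bp hp hpB T ξ hξ i hi
    have hξ0 : 0 < ξ := by linarith [hξ.1]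
    have hT' : (0 : ℝ) < T := by exact_mod_cast (by omega : 0 < T)
    have hBp0 : 0 ≤ Bp := (abs_nonneg _).trans (hpB 0)
    rcases Nat.eq_zero_or_pos i with h0 | h0
    · subst h0
      simp only [discSum, zero_add, Finset.Ico_self, Finset.sum_empty, mul_zero]
      rw [Finset.Ico_eq_empty (by omega)]
      simp only [Finset.sum_empty, mul_zero, sub_self, abs_zero]
      positivity
    obtain ⟨n, rfl⟩ : ∃ n, i = n + 1 := ⟨i - 1, by omega⟩
    set h : ℝ := T / ξ with hh
    have hh0 : 0 < h := by positivity
    -- In lag form, advancing i by one shifts the argument of p by 1/T and appends a single term.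
    -- The kernel itself is never differenced, so its discontinuities do no harm.
    have e : discSum K p T ξ (n + 1 + 1) - discSum K p T ξ (n + 1) =
        h⁻¹ * ((∑ k ∈ Finset.Icc 1 n, K ((k : ℝ) / h) * (p ((((n + 1 + 1 : ℕ) : ℝ) - k) / T)
          - p ((((n + 1 : ℕ) : ℝ) - k) / T)))
          + K (((n + 1 : ℕ) : ℝ) / h)
            * p ((((n + 1 + 1 : ℕ) : ℝ) - ((n + 1 : ℕ) : ℝ)) / T)) := by
      rw [discSum_eq_lag, discSum_eq_lag]
      simp only [Nat.add_sub_cancel]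
      rw [Finset.sum_Icc_succ_top (by omega)]
      simp only [mul_sub, Finset.sum_sub_distrib]
      ring
    have hterm : ∀ k ∈ Finset.Icc 1 n, |K ((k : ℝ) / h) * (p ((((n + 1 + 1 : ℕ) : ℝ) - k) / T)
          - p ((((n + 1 : ℕ) : ℝ) - k) / T))| ≤ B * (L' * (1 / T)) := by
      intro k _
      rw [abs_mul]
      refine mul_le_mul (hB _ (by positivity)) ((hp.dist_le_mul _ _).trans (le_of_eq ?_))
        (abs_nonneg _) hB0
      rw [Real.dist_eq, ← sub_div]
      push_cast
      rw [show ((n : ℝ) + 1 + 1 - k - (n + 1 - k)) = 1 by ring, abs_of_pos (by positivity)]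
    have hs := (Finset.abs_sum_le_sum_abs _ _).trans (Finset.sum_le_sum hterm)
    rw [Finset.sum_const, Nat.card_Icc, nsmul_eq_mul] at hs
    have hn : ((n + 1 - 1 : ℕ) : ℝ) ≤ T := by exact_mod_cast (by omega : n + 1 - 1 ≤ T)
    have hs2 : ((n + 1 - 1 : ℕ) : ℝ) * (B * (L' * (1 / T))) ≤ B * L' := by
      calc _ ≤ (T : ℝ) * (B * (L' * (1 / T))) := by gcongr
        _ = _ := by field_simp
    have hl : |K (((n + 1 : ℕ) : ℝ) / h)
            * p ((((n + 1 + 1 : ℕ) : ℝ) - ((n + 1 : ℕ) : ℝ)) / T)| ≤ B * Bp := by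
      rw [abs_mul]
      exact mul_le_mul (hB _ (by positivity)) (hpB _) (abs_nonneg _) hB0
    have hinv : h⁻¹ ≤ Ξ / T := by
      rw [hh, inv_div]; gcongr; exact hξ.2
    rw [e, abs_mul, abs_of_pos (inv_pos.2 hh0), mul_div_right_comm]
    refine mul_le_mul hinv ((abs_add_le _ _).trans ?_) (abs_nonneg _) (by positivity)
    linarith
  -- The two entries serve the numerator, with p = q, and the denominator, with p = 1 of Lipschitz
  -- constant 0.
  set P := max (Ξ * (B * Bq + B * L)) (Ξ * (B * 1 + B * (0 : NNReal))) with hP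
  have hP0 : 0 ≤ P := le_max_of_le_left (by positivity)
  refine ⟨(1 + A) * P / c, by positivity, ?_⟩
  filter_upwards [hcle, hAD] with T h1 h2 ξ hξ i hi hiT
  have hT' : (0 : ℝ) < T := by exact_mod_cast (by omega : 0 < T)
  have hb := h1 ξ hξ i hi (by omega)
  have hb' := h1 ξ hξ (i + 1) (hi.trans (by simp)) hiT
  have hM := h2 ξ hξ i (by omega)
  have ha := hdiff q L Bq hq hqB T ξ hξ i hiT
  have hbb := hdiff (fun _ => 1) 0 1 (LipschitzWith.const (1 : ℝ)) (by simp) T ξ hξ i hiT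
  rw [abs_sub_comm]
  rw [discPred, inv_mul_eq_div] at hM ⊢
  rw [discPred, inv_mul_eq_div]
  rw [abs_sub_comm] at ha hbb
  refine (abs_div_sub_div_le hc hb' (hc.trans_le hb) hM (ρ := P / T)
    (ha.trans ?_) (hbb.trans ?_)).trans (le_of_eq (by ring))
  · gcongr; exact le_max_left _ _
  · gcongr; exact le_max_right _ _

end Predictions

/-! ### The limiting objective -/

section Objective

variable {K q : ℝ → ℝ} {Ξ Bq : ℝ} {L : NNReal}

/-- Convergence of the predictions is uniform only away from 0; on (0, δ] boundedness costs at most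
Mδ. -/
lemma abs_integral_le_of_small_away {φ : ℝ → ℝ} {M ρ δ b : ℝ}
    (hφ : IntervalIntegrable φ volume 0 1) (hb : b ∈ Icc (0 : ℝ) 1) (hδ : 0 < δ) (hρ : 0 ≤ ρ)
    (hM : ∀ u ∈ Ioc (0 : ℝ) 1, |φ u| ≤ M) (hs : ∀ u ∈ Icc δ 1, |φ u| ≤ ρ) :
    |∫ u in (0 : ℝ)..b, φ u| ≤ M * δ + ρ := by
  have hM0 : 0 ≤ M := (abs_nonneg _).trans (hM 1 ⟨one_pos, le_rfl⟩)
  have hcase : ∀ x ∈ Icc 0 δ, x ≤ 1 → |∫ u in (0 : ℝ)..x, φ u| ≤ M * δ := by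
    intro x hx hx1
    have := intervalIntegral.norm_integral_le_of_norm_le_const (a := 0) (b := x) (f := φ)
      (C := M) (fun u hu => by
        rw [uIoc_of_le hx.1] at hu
        exact hM u ⟨hu.1, hu.2.trans hx1⟩)
    rw [sub_zero, abs_of_nonneg hx.1] at this
    exact this.trans (mul_le_mul_of_nonneg_left hx.2 hM0)
  rcases le_total b δ with h | h
  · linarith [hcase b ⟨hb.1, h⟩ hb.2]
  · have h1 : δ ≤ 1 := h.trans hb.2
    have i1 : IntervalIntegrable φ volume 0 δ := hφ.mono_set (by
      rw [uIcc_of_le hδ.le, uIcc_of_le zero_le_one]; exact Icc_subset_Icc_right h1)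
    have i2 : IntervalIntegrable φ volume δ b := hφ.mono_set (by
      rw [uIcc_of_le h, uIcc_of_le zero_le_one]; exact Icc_subset_Icc hδ.le hb.2)
    rw [← intervalIntegral.integral_add_adjacent_intervals i1 i2]
    have := intervalIntegral.norm_integral_le_of_norm_le_const (a := δ) (b := b) (f := φ)
      (C := ρ) (fun u hu => by
        rw [uIoc_of_le h] at hu
        exact hs u ⟨hu.1.le, hu.2.trans hb.2⟩)
    rw [abs_of_nonneg (by linarith), Real.norm_eq_abs] at this
    have h3 : ρ * (b - δ) ≤ ρ := mul_le_of_le_one_right hρ (by linarith [hb.2])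
    exact (abs_add_le _ _).trans (add_le_add (hcase δ ⟨hδ.le, le_rfl⟩ h1) (this.trans h3))

/-- The integrand of the limiting objective. -/
noncomputable def limIntegrand (K q : ℝ → ℝ) (ξ r : ℝ) : ℝ :=
  limPred K q ξ r ^ 2 - 2 * (q r * limPred K q ξ r)

lemma intervalIntegrable_of_bound_unit {φ : ℝ → ℝ} {M s : ℝ}
    (hφ : AEStronglyMeasurable φ (volume.restrict (Ioc 0 1))) (hM : ∀ u ∈ Ioc (0 : ℝ) 1, |φ u| ≤ M)
    (hs : s ∈ Icc (0 : ℝ) 1) : IntervalIntegrable φ volume 0 s := by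
  rw [intervalIntegrable_iff, uIoc_of_le hs.1]
  have hi : Integrable φ (volume.restrict (Ioc 0 1)) :=
    Integrable.of_bound hφ M ((ae_restrict_iff' measurableSet_Ioc).2 (ae_of_all _ hM))
  exact hi.mono_measure (Measure.restrict_mono (Ioc_subset_Ioc_right hs.2) le_rfl)

lemma abs_quadratic_le {d y A M : ℝ} (hd : |d| ≤ A) (hy : |y| ≤ M) :
    |d ^ 2 - 2 * (y * d)| ≤ A ^ 2 + 2 * M * A := by
  have h1 : |d| ^ 2 ≤ A ^ 2 := pow_le_pow_left₀ (abs_nonneg _) hd 2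
  have h2 : |y| * |d| ≤ M * A := mul_le_mul hy hd (abs_nonneg _) ((abs_nonneg _).trans hy)
  refine (abs_sub _ _).trans ?_
  rw [abs_pow, abs_mul, abs_mul, abs_two]
  linarith

lemma limObj_eq (hK : IsBoundedKernel K Ξ) (hΞ : 0 < Ξ)
    (hq : LipschitzWith L q) (hqB : ∀ x, |q x| ≤ Bq) {ξ s : ℝ} (hξ : ξ ∈ Icc 1 Ξ)
    (hs : s ∈ Icc (0 : ℝ) 1) : limObj K q s ξ = ∫ r in (0 : ℝ)..s, limIntegrand K q ξ r := by
  obtain ⟨A, hA, hAb, -⟩ := exists_abs_limPred_le hK hΞ hq hqB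
  have hmeas := aestronglyMeasurable_limPred hK hΞ hq hqB hξ
  have h1 : IntervalIntegrable (fun r => limPred K q ξ r ^ 2) volume 0 s :=
    intervalIntegrable_of_bound_unit (M := A ^ 2) (hmeas.pow 2) (fun u hu => by
      rw [abs_pow]; exact pow_le_pow_left₀ (abs_nonneg _) (hAb ξ hξ u hu) 2) hs
  have h2 : IntervalIntegrable (fun r => q r * limPred K q ξ r) volume 0 s :=
    intervalIntegrable_of_bound_unit (M := Bq * A)
      (hq.continuous.aestronglyMeasurable.mul hmeas) (fun u hu => by
      rw [abs_mul]
      exact mul_le_mul (hqB u) (hAb ξ hξ u hu) (abs_nonneg _) ((abs_nonneg _).trans (hqB u))) hs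
  simp only [limIntegrand]
  rw [intervalIntegral.integral_sub h1 (h2.const_mul 2), intervalIntegral.integral_const_mul, limObj]
  ring

lemma aestronglyMeasurable_limIntegrand (hK : IsBoundedKernel K Ξ) (hΞ : 0 < Ξ)
    (hq : LipschitzWith L q) (hqB : ∀ x, |q x| ≤ Bq) {ξ : ℝ} (hξ : ξ ∈ Icc 1 Ξ) :
    AEStronglyMeasurable (limIntegrand K q ξ) (volume.restrict (Ioc 0 1)) := by
  have hmeas := aestronglyMeasurable_limPred hK hΞ hq hqB hξ
  exact (hmeas.pow 2).sub ((hq.continuous.aestronglyMeasurable.mul hmeas).const_mul 2)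

/-- Without noise, the objective converges uniformly in the bandwidth and in the time horizon. -/
lemma eventually_abs_sum_discPred_sub_limObj_le (hK : IsBoundedKernel K Ξ) (hΞ : 0 < Ξ)
    (hq : LipschitzWith L q) (hqB : ∀ x, |q x| ≤ Bq) {ρ : ℝ} (hρ : 0 < ρ) :
    ∀ᶠ T : ℕ in atTop, ∀ ξ ∈ Icc 1 Ξ, ∀ s ∈ Icc (0 : ℝ) 1,
      |(T : ℝ)⁻¹ * ∑ i ∈ Finset.Icc 1 ⌊(T : ℝ) * s⌋₊,
        (discPred K q T ξ i ^ 2 - 2 * (q ((i : ℝ) / T) * discPred K q T ξ i))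
          - limObj K q s ξ| ≤ ρ := by
  obtain ⟨A, hA, hAb, hAD⟩ := exists_abs_limPred_le hK hΞ hq hqB
  have hBq0 : 0 ≤ Bq := (abs_nonneg _).trans (hqB 0)
  set Γ : ℝ := A ^ 2 + 2 * Bq * A with hΓ
  have hΓ0 : 0 < Γ := by positivity
  -- The error has four parts of size ρ/4: the interval [0, δ], the error of the predictions, the
  -- Lipschitz error of `q`, and the end piece [b, s].
  set δ : ℝ := ρ / (8 * Γ) with hδ
  have hδ0 : 0 < δ := by positivity
  set ρ' : ℝ := ρ / (8 * (A + Bq)) with hρ'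
  have hρ'0 : 0 < ρ' := by positivity
  filter_upwards [hAD, eventually_abs_discPred_sub_limPred_le hK hΞ hq hqB hδ0 hρ'0,
    (tendsto_const_div_atTop_nhds_zero_nat (2 * A * L)).eventually_le_const
      (show 0 < ρ / 4 by positivity),
    (tendsto_const_div_atTop_nhds_zero_nat Γ).eventually_le_const
      (show 0 < ρ / 4 by positivity), eventually_gt_atTop 0] with T h1 h2 h3 h4 hT ξ hξ s hs
  have hT' : (0 : ℝ) < T := by exact_mod_cast hT
  rw [limObj_eq hK hΞ hq hqB hξ hs]
  set g := limIntegrand K q ξ with hg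
  set F : ℕ → ℝ := fun i => discPred K q T ξ i ^ 2 - 2 * (q ((i : ℝ) / T) * discPred K q T ξ i)
    with hF
  have hgΓ : ∀ u ∈ Ioc (0 : ℝ) 1, |g u| ≤ Γ := fun u hu => abs_quadratic_le (hAb ξ hξ u hu) (hqB u)
  have hgm := aestronglyMeasurable_limIntegrand hK hΞ hq hqB hξ
  set n := ⌊(T : ℝ) * s⌋₊ with hn
  have hns : (n : ℝ) ≤ T * s := Nat.floor_le (mul_nonneg hT'.le hs.1)
  have hns' : (T : ℝ) * s < n + 1 := Nat.lt_floor_add_one _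
  set b : ℝ := n / T with hb
  have hb0 : 0 ≤ b := by positivity
  have hbs : b ≤ s := by rw [hb, div_le_iff₀ hT']; linarith
  have hsb : s - b ≤ 1 / T := by
    rw [hb, le_div_iff₀ hT', sub_mul, div_mul_cancel₀ _ hT'.ne']; linarith
  have hb1 : b ∈ Icc (0 : ℝ) 1 := ⟨hb0, hbs.trans hs.2⟩
  have hF1 := (integral_comp_ceil F hT' T).1
  rw [div_self hT'.ne'] at hF1
  have hFn := (integral_comp_ceil F hT' n)
  have hgb := intervalIntegrable_of_bound_unit hgm hgΓ hb1
  have hgs := intervalIntegrable_of_bound_unit hgm hgΓ hs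
  have hg1 := intervalIntegrable_of_bound_unit hgm hgΓ ⟨zero_le_one, le_rfl⟩
  have hgbs : IntervalIntegrable g volume b s := hgb.symm.trans hgs
  have hceil : ∀ u ∈ Ioc (0 : ℝ) 1, ⌈u * T⌉₊ ≤ T := fun u hu =>
    Nat.ceil_le.2 (mul_le_of_le_one_left hT'.le hu.2)
  rw [← hFn.2, ← intervalIntegral.integral_add_adjacent_intervals hgb hgbs, ← sub_sub,
    ← intervalIntegral.integral_sub hFn.1 hgb]
  have key : |∫ u in (0 : ℝ)..b, (F ⌈u * T⌉₊ - g u)| ≤ 2 * Γ * δ + ρ / 2 := by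
    refine abs_integral_le_of_small_away (hF1.sub hg1) hb1 hδ0 (by positivity) ?_ ?_
    · intro u hu
      have e1 : |F ⌈u * T⌉₊| ≤ Γ := abs_quadratic_le (h1 ξ hξ _ (hceil u hu)) (hqB _)
      have e2 := hgΓ u hu
      rw [abs_le] at e1 e2 ⊢
      constructor <;> linarith
    · intro u hu
      have hu0 : u ∈ Ioc (0 : ℝ) 1 := ⟨hδ0.trans_le hu.1, hu.2⟩
      set d := discPred K q T ξ ⌈u * T⌉₊ with hd
      set a := limPred K q ξ u with ha
      set y := q ((⌈u * T⌉₊ : ℝ) / T) with hy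
      have e1 : |d - a| ≤ ρ' := h2 ξ hξ u hu
      have e2 : |d| ≤ A := h1 ξ hξ _ (hceil u hu0)
      have e3 : |a| ≤ A := hAb ξ hξ u hu0
      have e4 : |y - q u| ≤ L * (1 / T) := by
        refine (hq.dist_le_mul _ _).trans (mul_le_mul_of_nonneg_left ?_ L.2)
        have c1 : u * T ≤ ⌈u * T⌉₊ := Nat.le_ceil _
        have c2 : (⌈u * T⌉₊ : ℝ) < u * T + 1 := Nat.ceil_lt_add_one (by have := hu0.1; positivity)
        rw [Real.dist_eq, show (⌈u * T⌉₊ : ℝ) / T - u = (⌈u * T⌉₊ - u * T) / T by field_simp,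
          abs_of_nonneg (div_nonneg (by linarith) hT'.le)]
        gcongr
        linarith
      -- This factorization separates the error of the prediction from that of the regression value.
      have e : F ⌈u * T⌉₊ - g u = (d - a) * (d + a - 2 * y) - 2 * a * (y - q u) := by
        simp only [hF, hg, limIntegrand, ← hd, ← ha, ← hy]; ring
      rw [e]
      have e5 : |d + a - 2 * y| ≤ 2 * A + 2 * Bq := by
        have := hqB ((⌈u * T⌉₊ : ℝ) / T)
        rw [← hy] at this
        rw [abs_le] at e2 e3 this ⊢
        constructor <;> linarith
      have e6 : |(d - a) * (d + a - 2 * y)| ≤ ρ' * (2 * A + 2 * Bq) := by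
        rw [abs_mul]; exact mul_le_mul e1 e5 (abs_nonneg _) hρ'0.le
      have e7 : |2 * a * (y - q u)| ≤ 2 * A * (L * (1 / T)) := by
        rw [abs_mul, abs_mul, abs_two]
        gcongr
      have e8 : ρ' * (2 * A + 2 * Bq) = ρ / 4 := by rw [hρ']; field_simp; ring
      have e9 : 2 * A * (L * (1 / T)) = 2 * A * L / T := by ring
      have := abs_sub ((d - a) * (d + a - 2 * y)) (2 * a * (y - q u))
      linarith
  have hend : |∫ u in b..s, g u| ≤ Γ / T := by
    have := intervalIntegral.norm_integral_le_of_norm_le_const (a := b) (b := s) (f := g)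
      (C := Γ) (fun u hu => by
        rw [uIoc_of_le hbs] at hu
        exact hgΓ u ⟨hb0.trans_lt hu.1, hu.2.trans hs.2⟩)
    rw [Real.norm_eq_abs, abs_of_nonneg (show 0 ≤ s - b by linarith)] at this
    refine this.trans ?_
    rw [div_eq_mul_one_div Γ]
    gcongr
  have : 2 * Γ * δ = ρ / 4 := by rw [hδ]; field_simp; ring
  have := abs_sub (∫ u in (0 : ℝ)..b, (F ⌈u * T⌉₊ - g u)) (∫ u in b..s, g u)
  linarith

/-- After the substitution v = ξ(r - u), the parameter ξ enters only through the argument of `q` and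
the upper limit, so the integral is Lipschitz in ξ although `K` may be discontinuous. In the
splitting used, r - v/ξ can be negative, which is why `q` is defined on the whole line. -/
lemma continuousOn_contSum {B : ℝ} (hB : ∀ u, 0 ≤ u → |K u| ≤ B)
    (hc : ∀ᵐ u ∂(volume.restrict (Ioi (0 : ℝ))), ContinuousAt K u)
    (hq : LipschitzWith L q) (hqB : ∀ x, |q x| ≤ Bq) {r : ℝ} (hr : r ∈ Ioc (0 : ℝ) 1) :
    ContinuousOn (fun ξ => contSum K q ξ r) (Icc 1 Ξ) := by
  have hB0 : 0 ≤ B := (abs_nonneg _).trans (hB 0 le_rfl)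
  have hBq0 : 0 ≤ Bq := (abs_nonneg _).trans (hqB 0)
  have hlip : ∀ ξ ∈ Icc 1 Ξ, ∀ ξ' ∈ Icc 1 Ξ,
      |contSum K q ξ' r - contSum K q ξ r| ≤ (B * L * Ξ * Ξ + B * Bq) * |ξ' - ξ| := by
    intro ξ hξ ξ' hξ'
    have hξ0 : 0 < ξ := by linarith [hξ.1]
    have hξ'0 : 0 < ξ' := by linarith [hξ'.1]
    have hx : 0 ≤ ξ * r := mul_nonneg hξ0.le hr.1.le
    have hx' : 0 ≤ ξ' * r := mul_nonneg hξ'0.le hr.1.le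
    have hΞ0 : 0 ≤ Ξ := hξ0.le.trans hξ.2
    have hx'Ξ : ξ' * r ≤ Ξ := by nlinarith [hξ'.2, hr.2, hr.1]
    have i0 := integrable_contSum (a := 0) (b := ξ' * r) hB hc hq.continuous hqB ξ r le_rfl hx'
    have i0' := integrable_contSum (a := 0) (b := ξ' * r) hB hc hq.continuous hqB ξ' r le_rfl hx'
    have i1 := integrable_contSum (a := 0) (b := ξ * r) hB hc hq.continuous hqB ξ r le_rfl hx
    have e : contSum K q ξ' r - contSum K q ξ r =
        (∫ v in (0 : ℝ)..ξ' * r, (K v * q (r - v / ξ') - K v * q (r - v / ξ)))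
          + ∫ v in ξ * r..ξ' * r, K v * q (r - v / ξ) := by
      rw [intervalIntegral.integral_sub i0' i0, contSum, contSum,
        ← intervalIntegral.integral_add_adjacent_intervals i1 (i1.symm.trans i0)]
      ring
    have b1 := intervalIntegral.norm_integral_le_of_norm_le_const (a := 0) (b := ξ' * r)
      (f := fun v => K v * q (r - v / ξ') - K v * q (r - v / ξ))
      (C := B * (L * (Ξ * |ξ' - ξ|))) (fun v hv => by
        rw [uIoc_of_le hx'] at hv
        rw [← mul_sub, Real.norm_eq_abs, abs_mul]
        refine mul_le_mul (hB v hv.1.le) ((hq.dist_le_mul _ _).trans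
          (mul_le_mul_of_nonneg_left ?_ L.2)) (abs_nonneg _) hB0
        have h1 : r - v / ξ' - (r - v / ξ) = v * ((ξ' - ξ) / (ξ * ξ')) := by field_simp; ring
        rw [Real.dist_eq, h1, abs_mul, abs_of_pos hv.1, abs_div, abs_of_pos (mul_pos hξ0 hξ'0)]
        have h2 : |ξ' - ξ| / (ξ * ξ') ≤ |ξ' - ξ| :=
          div_le_self (abs_nonneg _) (by nlinarith [hξ.1, hξ'.1])
        exact mul_le_mul (hv.2.trans hx'Ξ) h2 (by positivity) hΞ0)
    have b2 := intervalIntegral.norm_integral_le_of_norm_le_const (a := ξ * r) (b := ξ' * r)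
      (f := fun v => K v * q (r - v / ξ)) (C := B * Bq) (fun v hv => by
        rw [Real.norm_eq_abs, abs_mul]
        have : 0 ≤ v := (le_min hx hx').trans (by rw [uIoc, mem_Ioc] at hv; exact hv.1.le)
        exact mul_le_mul (hB v this) (hqB _) (abs_nonneg _) hB0)
    rw [Real.norm_eq_abs] at b1 b2
    rw [sub_zero, abs_of_nonneg hx'] at b1
    rw [← sub_mul, abs_mul, abs_of_pos hr.1] at b2
    rw [e]
    have b3 : B * (L * (Ξ * |ξ' - ξ|)) * (ξ' * r) ≤ B * (L * (Ξ * |ξ' - ξ|)) * Ξ := by gcongr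
    have b4 : B * Bq * (|ξ' - ξ| * r) ≤ B * Bq * (|ξ' - ξ| * 1) := by
      gcongr; exact hr.2
    refine (abs_add_le _ _).trans ?_
    linarith
  intro ξ hξ
  rw [ContinuousWithinAt, tendsto_iff_dist_tendsto_zero]
  refine squeeze_zero' (Eventually.of_forall fun _ => dist_nonneg)
    (eventually_nhdsWithin_of_forall fun ξ' hξ' => hlip ξ hξ ξ' hξ') ?_
  have : ContinuousWithinAt (fun ξ' => (B * L * Ξ * Ξ + B * Bq) * |ξ' - ξ|) (Icc 1 Ξ) ξ := by
    fun_prop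
  simpa [ContinuousWithinAt] using this

lemma continuousOn_limPred (hK : IsBoundedKernel K Ξ)
    (hq : LipschitzWith L q) (hqB : ∀ x, |q x| ≤ Bq) {r : ℝ} (hr : r ∈ Ioc (0 : ℝ) 1) :
    ContinuousOn (fun ξ => limPred K q ξ r) (Icc 1 Ξ) := by
  obtain ⟨B, hB⟩ := hK.bounded
  refine ContinuousOn.congr (f := fun ξ => contSum K q ξ r / contSum K (fun _ => 1) ξ r)
    (ContinuousOn.div (continuousOn_contSum hB hK.ae_continuous hq hqB hr)
      (continuousOn_contSum hB hK.ae_continuous (LipschitzWith.const (1 : ℝ)) (Bq := 1) (by simp) hr)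
      fun ξ hξ => ?_) fun ξ hξ => limPred_eq K q (by linarith [hξ.1]) r
  rw [contSum_one]
  refine (hK.integral_pos _ ⟨mul_pos (by linarith [hξ.1]) hr.1, ?_⟩).ne'
  nlinarith [hξ.1, hξ.2, hr.1, hr.2]

lemma continuousOn_limObj (hK : IsBoundedKernel K Ξ) (hΞ : 0 < Ξ)
    (hq : LipschitzWith L q) (hqB : ∀ x, |q x| ≤ Bq) {s : ℝ} (hs : s ∈ Icc (0 : ℝ) 1) :
    ContinuousOn (limObj K q s) (Icc 1 Ξ) := by
  obtain ⟨A, hA, hAb, -⟩ := exists_abs_limPred_le hK hΞ hq hqB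
  have hsub : uIoc 0 s ⊆ Ioc 0 1 := by rw [uIoc_of_le hs.1]; exact Ioc_subset_Ioc_right hs.2
  refine ContinuousOn.congr (f := fun ξ => ∫ r in (0 : ℝ)..s, limIntegrand K q ξ r) ?_
    fun ξ hξ => limObj_eq hK hΞ hq hqB hξ hs
  intro ξ hξ
  refine intervalIntegral.continuousWithinAt_of_dominated_interval
    (bound := fun _ => A ^ 2 + 2 * Bq * A) ?_ ?_ intervalIntegrable_const ?_
  · exact eventually_nhdsWithin_of_forall fun ξ' hξ' =>
      (aestronglyMeasurable_limIntegrand hK hΞ hq hqB hξ').mono_set hsub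
  · exact eventually_nhdsWithin_of_forall fun ξ' hξ' => ae_of_all _ fun u hu =>
      abs_quadratic_le (hAb ξ' hξ' u (hsub hu)) (hqB u)
  · refine ae_of_all _ fun u hu => ?_
    have h := continuousOn_limPred hK hq hqB (hsub hu) ξ hξ
    exact (h.pow 2).sub ((continuousWithinAt_const.mul h).const_mul 2)

end Objective

/-! ### Square integrable functions -/

section SquareIntegrable

variable {α : Type*} {mα : MeasurableSpace α} {μ : Measure α}

lemma eLpNorm_two_eq_ofReal_sqrt {f : α → ℝ} (hf : MemLp f 2 μ) :
    eLpNorm f 2 μ = ENNReal.ofReal √(∫ x, f x ^ 2 ∂μ) := by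
  rw [hf.eLpNorm_eq_integral_rpow_norm (by norm_num) (by norm_num), Real.sqrt_eq_rpow]
  norm_num

lemma integral_sq_le_of_eLpNorm_le {f : α → ℝ} (hf : MemLp f 2 μ) {a : ℝ} (ha : 0 ≤ a)
    (h : eLpNorm f 2 μ ≤ ENNReal.ofReal a) : ∫ x, f x ^ 2 ∂μ ≤ a ^ 2 := by
  rw [eLpNorm_two_eq_ofReal_sqrt hf, ENNReal.ofReal_le_ofReal_iff ha] at h
  exact (Real.sqrt_le_left ha).1 h

/-- Cauchy-Schwarz: the quadratic t ↦ ∫ (f + t g)² is nonnegative, so its discriminant is not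
positive. -/
lemma sq_integral_mul_le {f g : α → ℝ} (hf : MemLp f 2 μ) (hg : MemLp g 2 μ) :
    (∫ x, f x * g x ∂μ) ^ 2 ≤ (∫ x, f x ^ 2 ∂μ) * ∫ x, g x ^ 2 ∂μ := by
  have h : ∀ t : ℝ, 0 ≤ (∫ x, g x ^ 2 ∂μ) * (t * t) + (2 * ∫ x, f x * g x ∂μ) * t
      + ∫ x, f x ^ 2 ∂μ := by
    intro t
    have h1 : ∫ x, (f x + t * g x) ^ 2 ∂μ = (∫ x, g x ^ 2 ∂μ) * (t * t)
        + (2 * ∫ x, f x * g x ∂μ) * t + ∫ x, f x ^ 2 ∂μ := by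
      have e : (fun x => (f x + t * g x) ^ 2)
          = fun x => (t * t) * g x ^ 2 + ((2 * t) * (f x * g x) + f x ^ 2) := by
        funext x; ring
      have i1 : Integrable (fun x => f x * g x) μ := hf.integrable_mul hg
      have i2 : Integrable (fun x => (2 * t) * (f x * g x) + f x ^ 2) μ :=
        (i1.const_mul _).add hf.integrable_sq
      rw [e, integral_add (hg.integrable_sq.const_mul _) i2,
        integral_add (i1.const_mul _) hf.integrable_sq, integral_const_mul, integral_const_mul]
      ring
    rw [← h1]
    exact integral_nonneg fun x => sq_nonneg _
  have := discrim_le_zero h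
  rw [discrim] at this
  nlinarith

lemma abs_integral_mul_le {f g : α → ℝ} (hf : MemLp f 2 μ) (hg : MemLp g 2 μ) :
    |∫ x, f x * g x ∂μ| ≤ √(∫ x, f x ^ 2 ∂μ) * √(∫ x, g x ^ 2 ∂μ) := by
  rw [← Real.sqrt_mul (integral_nonneg fun x => sq_nonneg _)]
  exact Real.abs_le_sqrt (sq_integral_mul_le hf hg)

end SquareIntegrable

/-! ### Predictions from noise -/

lemma sum_Icc_by_parts (a e : ℕ → ℝ) {p n : ℕ} (hp : 1 ≤ p) (hpn : p ≤ n) :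
    ∑ j ∈ Finset.Icc p n, a j * e j =
      a n * (∑ k ∈ Finset.Icc 1 n, e k) - a p * (∑ k ∈ Finset.Icc 1 (p - 1), e k)
        - ∑ j ∈ Finset.Ico p n, (a (j + 1) - a j) * ∑ k ∈ Finset.Icc 1 j, e k := by
  induction n, hpn using Nat.le_induction with
  | base =>
    obtain ⟨m, rfl⟩ : ∃ m, p = m + 1 := ⟨p - 1, by omega⟩
    simp [Finset.sum_Icc_succ_top]
    ring
  | succ n hn ih =>
    rw [Finset.sum_Icc_succ_top (by omega), Finset.sum_Icc_succ_top (by omega),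
      Finset.sum_Ico_succ_top hn, ih]
    ring

/-- Summation by parts moves all dependence on the coefficients into their size and increments. The
maximal partial sum M is then the same for all bandwidths, which gives uniformity in ξ. -/
lemma abs_sum_Icc_mul_le {a e : ℕ → ℝ} {p n : ℕ} {A Λ M : ℝ} (hp : 1 ≤ p)
    (hM : ∀ k ≤ n, |∑ j ∈ Finset.Icc 1 k, e j| ≤ M)
    (hA : ∀ j ∈ Finset.Icc p n, |a j| ≤ A) (hΛ0 : 0 ≤ Λ) (hA0 : 0 ≤ A)
    (hΛ : ∀ j ∈ Finset.Ico p n, |a (j + 1) - a j| ≤ Λ) :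
    |∑ j ∈ Finset.Icc p n, a j * e j| ≤ (2 * A + n * Λ) * M := by
  have hM0 : 0 ≤ M := (abs_nonneg _).trans (hM 0 (Nat.zero_le _))
  rcases lt_or_ge n p with h | hpn
  · rw [Finset.Icc_eq_empty (by omega)]; simp; positivity
  rw [sum_Icc_by_parts a e hp hpn]
  have h1 : |a n * (∑ k ∈ Finset.Icc 1 n, e k)| ≤ A * M := by
    rw [abs_mul]
    exact mul_le_mul (hA n (Finset.mem_Icc.2 ⟨hpn, le_rfl⟩)) (hM n le_rfl) (abs_nonneg _) hA0
  have h2 : |a p * (∑ k ∈ Finset.Icc 1 (p - 1), e k)| ≤ A * M := by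
    rw [abs_mul]
    exact mul_le_mul (hA p (Finset.mem_Icc.2 ⟨le_rfl, hpn⟩)) (hM _ (by omega)) (abs_nonneg _) hA0
  have h3 : |∑ j ∈ Finset.Ico p n, (a (j + 1) - a j) * ∑ k ∈ Finset.Icc 1 j, e k|
      ≤ n * (Λ * M) := by
    refine (Finset.abs_sum_le_sum_abs _ _).trans ((Finset.sum_le_sum
      (g := fun _ => Λ * M) fun j hj => ?_).trans ?_)
    · rw [abs_mul]
      exact mul_le_mul (hΛ j hj) (hM j (Finset.mem_Ico.1 hj).2.le) (abs_nonneg _) hΛ0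
    · rw [Finset.sum_const, Nat.card_Ico, nsmul_eq_mul]
      gcongr
      exact Nat.sub_le _ _
  have h4 := abs_sub (a n * (∑ k ∈ Finset.Icc 1 n, e k)
    - a p * (∑ k ∈ Finset.Icc 1 (p - 1), e k))
    (∑ j ∈ Finset.Ico p n, (a (j + 1) - a j) * ∑ k ∈ Finset.Icc 1 j, e k)
  have h5 := abs_sub (a n * (∑ k ∈ Finset.Icc 1 n, e k))
    (a p * (∑ k ∈ Finset.Icc 1 (p - 1), e k))
  linarith

/-- The mean square of the first `T` terms. -/
noncomputable def meanSq (e : ℕ → ℝ) (T : ℕ) : ℝ := (T : ℝ)⁻¹ * ∑ i ∈ Finset.Icc 1 T, e i ^ 2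

lemma meanSq_nonneg (e : ℕ → ℝ) (T : ℕ) : 0 ≤ meanSq e T :=
  mul_nonneg (by positivity) (Finset.sum_nonneg fun _ _ => sq_nonneg _)

/-! ### Control of the predicted noise by its partial sums and mean square. -/

section Noise

variable {K : ℝ → ℝ} {Ξ B : ℝ}

/-- Summation by parts requires coefficients with small increments, which a discontinuous kernel
does not give. Smooth compactly supported functions are dense in L²(0, Ξ) and are Lipschitz. -/
lemma exists_lipschitz_approx (hB : ∀ u, 0 ≤ u → |K u| ≤ B)
    (hc : ∀ᵐ u ∂(volume.restrict (Ioi (0 : ℝ))), ContinuousAt K u) (hΞ : 0 ≤ Ξ) {ρ : ℝ}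
    (hρ : 0 < ρ) :
    ∃ (φ : ℝ → ℝ) (L : NNReal) (A : ℝ), LipschitzWith L φ ∧ (∀ x, |φ x| ≤ A) ∧
      ∫ u in (0 : ℝ)..Ξ, (K u - φ u) ^ 2 ≤ ρ := by
  have hKm : AEStronglyMeasurable K (volume.restrict (Ioc 0 Ξ)) :=
    (aestronglyMeasurable_of_ae_continuousAt hc).mono_set fun x hx => hx.1
  have hK2 : MemLp K 2 (volume.restrict (Ioc 0 Ξ)) :=
    MemLp.of_bound hKm B ((ae_restrict_iff' measurableSet_Ioc).2
      (ae_of_all _ fun u hu => hB u hu.1.le))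
  obtain ⟨φ, hφc, hφs, hφ⟩ := hK2.exist_eLpNorm_sub_le (by norm_num) (by norm_num)
    (Real.sqrt_pos.2 hρ)
  obtain ⟨L, hL⟩ := hφs.lipschitzWith_of_hasCompactSupport hφc (by simp)
  obtain ⟨A, hA⟩ := hφc.exists_bound_of_continuous hL.continuous
  refine ⟨φ, L, A, hL, hA, ?_⟩
  have hφ2 : MemLp φ 2 (volume.restrict (Ioc 0 Ξ)) :=
    MemLp.of_bound hL.continuous.aestronglyMeasurable A (ae_of_all _ hA)
  have := integral_sq_le_of_eLpNorm_le (hK2.sub hφ2) (Real.sqrt_nonneg _) hφ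
  rw [Real.sq_sqrt hρ.le] at this
  rw [intervalIntegral.integral_of_le hΞ]
  simpa using this

/-- The predictions from noise are small uniformly in the bandwidth, if the partial sums of the
noise are. -/
lemma exists_seqPred_sq_le (hK : IsBoundedKernel K Ξ) (hΞ : 0 < Ξ) {δ ρ : ℝ} (hδ : 0 < δ)
    (hρ : 0 < ρ) :
    ∃ D : ℝ, 0 ≤ D ∧ ∀ᶠ T : ℕ in atTop, ∀ (e : ℕ → ℝ) (Q : ℝ), 0 ≤ Q →
      (∀ n ≤ T, (∑ j ∈ Finset.Icc 1 n, e j) ^ 2 ≤ (T : ℝ) ^ 2 * Q) →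
      ∀ ξ ∈ Icc 1 Ξ, ∀ i : ℕ, δ * T ≤ i → i ≤ T →
        seqPred K e T ξ i ^ 2 ≤ ρ * meanSq e T + D * Q := by
  obtain ⟨B, hB⟩ := hK.bounded
  obtain ⟨c, hc, hcle⟩ := exists_pos_le_discSum_one hB hK.ae_continuous hK.integral_pos hΞ.le hδ
  set ρ₁ : ℝ := ρ * c ^ 2 / (4 * Ξ) with hρ₁
  have hρ₁0 : 0 < ρ₁ := by positivity
  obtain ⟨φ, L, A, hL, hA, hφ⟩ := exists_lipschitz_approx hB hK.ae_continuous hΞ.le hρ₁0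
  have hA0 : 0 ≤ A := (abs_nonneg _).trans (hA 0)
  have hB0 : 0 ≤ B := (abs_nonneg _).trans (hB 0 le_rfl)
  -- The squared error is again bounded and a.e. continuous, so its Riemann sums approach its
  -- integral, which is at most ρ₁; for large T they stay below 2ρ₁.
  set g : ℝ → ℝ := fun u => (K u - φ u) ^ 2 with hg
  have hgB : ∀ u, 0 ≤ u → |g u| ≤ (B + A) ^ 2 := by
    intro u hu
    rw [hg, abs_pow]
    exact pow_le_pow_left₀ (abs_nonneg _)
      ((abs_sub _ _).trans (add_le_add (hB u hu) (hA u))) 2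
  have hgc : ∀ᵐ u ∂(volume.restrict (Ioi (0 : ℝ))), ContinuousAt g u := by
    filter_upwards [hK.ae_continuous] with u hu
    exact (hu.sub hL.continuous.continuousAt).pow 2
  have hgm := aestronglyMeasurable_of_ae_continuousAt hgc
  have hgi := intervalIntegrable_of_abs_le le_rfl hΞ.le hgm hgB
  -- This constant depends on ρ through the bound `A` and the Lipschitz constant `L` of φ.
  refine ⟨2 * (Ξ * (2 * A + L * Ξ)) ^ 2 / c ^ 2, by positivity, ?_⟩
  filter_upwards [hcle, eventually_gt_atTop 0, eventually_bandwidth (Ξ := Ξ)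
    ((tendsto_integral_abs_comp_ceil_sub hgB hgc hΞ.le).eventually_le_const hρ₁0)]
    with T h1 hT h2 e Q hQ hS ξ hξ i hi hiT
  have hT' : (0 : ℝ) < T := by exact_mod_cast hT
  have hξ0 : 0 < ξ := by linarith [hξ.1]
  have hN := h1 ξ hξ i hi hiT
  have h3 := h2 ξ hξ
  set h : ℝ := T / ξ with hh
  have hh0 : 0 < h := by positivity
  have hhΞ : h⁻¹ ≤ Ξ / T := by rw [hh, inv_div]; gcongr; exact hξ.2
  -- the Riemann sum of `g`
  have hi1 : 1 ≤ i := by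
    have : (0 : ℝ) < i := (by positivity : 0 < δ * T).trans_le hi
    exact_mod_cast this
  have hlagle : ((i - 1 : ℕ) : ℝ) / h ≤ Ξ := by
    rw [div_le_iff₀ hh0, hh]
    have h4 : ((i - 1 : ℕ) : ℝ) ≤ T := by exact_mod_cast (by omega : i - 1 ≤ T)
    refine h4.trans ?_
    rw [mul_div_assoc', le_div_iff₀ hξ0, mul_comm]
    gcongr
    exact hξ.2
  have hRie : h⁻¹ * ∑ k ∈ Finset.Icc 1 (i - 1), g (k / h) ≤ 2 * ρ₁ := by
    obtain ⟨hi1, hi2⟩ := integral_comp_ceil (fun k => g (k / h)) hh0 (i - 1)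
    have hgb : ∀ k : ℕ, |g ((k : ℝ) / h)| ≤ (B + A) ^ 2 := fun k => hgB _ (by positivity)
    have hiΞ := intervalIntegrable_comp_ceil hgb h 0 Ξ
    rw [← hi2]
    calc ∫ u in (0 : ℝ)..((i - 1 : ℕ) : ℝ) / h, g (⌈u * h⌉₊ / h)
        ≤ ∫ u in (0 : ℝ)..Ξ, g (⌈u * h⌉₊ / h) :=
          intervalIntegral.integral_mono_interval le_rfl (by positivity) hlagle
            (ae_of_all _ fun _ => sq_nonneg _) hiΞ
      _ ≤ ∫ u in (0 : ℝ)..Ξ, (g u + |g (⌈u * h⌉₊ / h) - g u|) := by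
          refine intervalIntegral.integral_mono hΞ.le hiΞ (hgi.add (hiΞ.sub hgi).abs) fun u => ?_
          have := le_abs_self (g (⌈u * h⌉₊ / h) - g u)
          simp only
          linarith
      _ ≤ 2 * ρ₁ := by
          rw [intervalIntegral.integral_add hgi (hiΞ.sub hgi).abs]
          linarith
  have hVsum : ∑ j ∈ Finset.Ico 1 i, e j ^ 2 ≤ T * meanSq e T := by
    rw [meanSq, mul_inv_cancel_left₀ hT'.ne']
    refine Finset.sum_le_sum_of_subset_of_nonneg (fun j hj => ?_) fun _ _ _ => sq_nonneg _
    rw [Finset.mem_Ico] at hj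
    rw [Finset.mem_Icc]; omega
  -- U carries the error K - φ and is bounded by Cauchy-Schwarz; W carries φ and is bounded by
  -- summation by parts.
  set U : ℝ := h⁻¹ * ∑ j ∈ Finset.Ico 1 i, (K (((i : ℝ) - j) / h) - φ (((i : ℝ) - j) / h)) * e j
    with hU
  set W : ℝ := h⁻¹ * ∑ j ∈ Finset.Ico 1 i, φ (((i : ℝ) - j) / h) * e j with hW
  have hUW : h⁻¹ * ∑ j ∈ Finset.Ico 1 i, K (((i : ℝ) - j) / h) * e j = U + W := by
    rw [hU, hW, ← mul_add, ← Finset.sum_add_distrib]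
    congr 1
    exact Finset.sum_congr rfl fun j _ => by ring
  have hUle : U ^ 2 ≤ 2 * ρ₁ * Ξ * meanSq e T := by
    have hcs := Finset.sum_mul_sq_le_sq_mul_sq (Finset.Ico 1 i)
      (fun j : ℕ => K (((i : ℝ) - j) / h) - φ (((i : ℝ) - j) / h)) e
    have hlag := sum_Ico_lag (fun a _ => g (a / h)) i
    simp only [hg] at hlag
    rw [hlag] at hcs
    calc U ^ 2 = h⁻¹ ^ 2 * (∑ j ∈ Finset.Ico 1 i,
          (K (((i : ℝ) - j) / h) - φ (((i : ℝ) - j) / h)) * e j) ^ 2 := by rw [hU]; ring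
      _ ≤ h⁻¹ ^ 2 * ((∑ k ∈ Finset.Icc 1 (i - 1), g (k / h)) * ∑ j ∈ Finset.Ico 1 i, e j ^ 2) := by
          gcongr
      _ = (h⁻¹ * ∑ k ∈ Finset.Icc 1 (i - 1), g (k / h))
            * (h⁻¹ * ∑ j ∈ Finset.Ico 1 i, e j ^ 2) := by ring
      _ ≤ (2 * ρ₁) * (Ξ / T * (T * meanSq e T)) := by
          refine mul_le_mul hRie (mul_le_mul hhΞ hVsum (Finset.sum_nonneg fun _ _ => sq_nonneg _)
            (by positivity)) (mul_nonneg (inv_nonneg.2 hh0.le)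
              (Finset.sum_nonneg fun _ _ => sq_nonneg _)) (by positivity)
      _ = _ := by field_simp
  have hWle : W ^ 2 ≤ (Ξ * (2 * A + L * Ξ)) ^ 2 * Q := by
    have hM : ∀ k ≤ i - 1, |∑ j ∈ Finset.Icc 1 k, e j| ≤ T * √Q := by
      intro k hk
      have := Real.abs_le_sqrt (hS k (by omega))
      rwa [Real.sqrt_mul (by positivity), Real.sqrt_sq hT'.le] at this
    have hsum := abs_sum_Icc_mul_le (a := fun j : ℕ => φ (((i : ℝ) - j) / h)) (e := e)
      (p := 1) (n := i - 1) (A := A) (Λ := L * (Ξ / T)) le_rfl hM (fun j _ => hA _)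
      (by positivity) hA0 (fun j _ => by
        refine (hL.dist_le_mul _ _).trans (mul_le_mul_of_nonneg_left ?_ L.2)
        rw [Real.dist_eq, ← sub_div]
        push_cast
        rw [show (i : ℝ) - (j + 1) - (i - j) = -1 by ring, abs_div, abs_neg, abs_one,
          abs_of_pos hh0, one_div]
        exact hhΞ)
    rw [show Finset.Icc 1 (i - 1) = Finset.Ico 1 i by ext j; simp; omega] at hsum
    have hn : ((i - 1 : ℕ) : ℝ) ≤ T := by exact_mod_cast (by omega : i - 1 ≤ T)
    have habs : |W| ≤ Ξ * (2 * A + L * Ξ) * √Q := by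
      rw [hW, abs_mul, abs_of_pos (inv_pos.2 hh0)]
      calc _ ≤ Ξ / T * ((2 * A + ((i - 1 : ℕ) : ℝ) * (L * (Ξ / T))) * (T * √Q)) := by gcongr
        _ ≤ Ξ / T * ((2 * A + (T : ℝ) * (L * (Ξ / T))) * (T * √Q)) := by gcongr
        _ = _ := by field_simp
    calc W ^ 2 = |W| ^ 2 := (sq_abs W).symm
      _ ≤ (Ξ * (2 * A + L * Ξ) * √Q) ^ 2 := by gcongr
      _ = _ := by rw [mul_pow, Real.sq_sqrt hQ]
  rw [seqPred, hUW]
  have hinv : (discSum K (fun _ => 1) T ξ i)⁻¹ ≤ c⁻¹ := by gcongr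
  have hinv0 : 0 ≤ (discSum K (fun _ => 1) T ξ i)⁻¹ := inv_nonneg.2 (hc.le.trans hN)
  have hsq : (U + W) ^ 2 ≤ 2 * (2 * ρ₁ * Ξ * meanSq e T + (Ξ * (2 * A + L * Ξ)) ^ 2 * Q) := by
    nlinarith [sq_nonneg (U - W)]
  rw [mul_pow]
  calc _ ≤ c⁻¹ ^ 2 * (2 * (2 * ρ₁ * Ξ * meanSq e T + (Ξ * (2 * A + L * Ξ)) ^ 2 * Q)) := by
        gcongr
    _ = _ := by rw [hρ₁]; field_simp; ring

end Noise

/-! ### Pathwise comparison of the objectives -/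

/-- The cross-validation objective computed from `q (i / T) + e i`. -/
noncomputable def seqObj (K q : ℝ → ℝ) (e : ℕ → ℝ) (T : ℕ) (s ξ : ℝ) : ℝ :=
  (T : ℝ)⁻¹ * ∑ i ∈ Finset.Icc 1 ⌊(T : ℝ) * s⌋₊,
    (seqPred K (fun j => q ((j : ℝ) / T) + e j) T ξ i ^ 2
      - 2 * ((q ((i : ℝ) / T) + e i) * seqPred K (fun j => q ((j : ℝ) / T) + e j) T ξ i))

lemma cvObj_eq_seqObj {Ω : Type*} {K m q : ℝ → ℝ} (hqm : ∀ t, 0 ≤ t → q t = m t)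
    (ε : ℤ → Ω → ℝ) (T : ℕ) (s ξ : ℝ) (ω : Ω) :
    cvObj K m ε T s ξ ω = seqObj K q (fun j => ε j ω) T s ξ := by
  have hobs : ∀ j : ℕ, obs m ε T j ω = q ((j : ℝ) / T) + ε j ω := fun j => by
    rw [obs, hqm _ (by positivity)]
  have hloo : ∀ i : ℕ, looPred K m ε T (T / ξ) i ω
      = seqPred K (fun j => q ((j : ℝ) / T) + ε j ω) T ξ i := fun i => by
    simp only [looPred, seqPred, hobs, normConst_eq_discSum]
  -- There is nothing to predict from at i = 1: the empty sum makes this prediction 0, so starting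
  -- the outer sum at 1 instead of 2 changes nothing.
  have h1 : seqPred K (fun j => q ((j : ℝ) / T) + ε j ω) T ξ 1 = 0 := by simp [seqPred]
  simp only [cvObj, seqObj, hobs, hloo]
  set P := seqPred K (fun j => q ((j : ℝ) / T) + ε j ω) T ξ with hP
  have hsum : ∀ f : ℕ → ℝ, f 1 = 0 → ∀ n, ∑ i ∈ Finset.Icc 1 n, f i
      = ∑ i ∈ Finset.Icc 2 n, f i := by
    intro f hf n
    rcases Nat.eq_zero_or_pos n with h0 | h0
    · subst h0; simp
    · rw [← Finset.add_sum_Ioc_eq_sum_Icc h0, hf, zero_add]; rfl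
  rw [hsum _ (by simp [h1]), Finset.sum_sub_distrib, ← Finset.mul_sum]
  ring

/-- For early times, where R is not small: a crude bound suffices because there are at most δT of
them. -/
lemma abs_cross_small_le {d y e R A M : ℝ} (hd : |d| ≤ A) (hy : |y| ≤ M) :
    |2 * d * R + R ^ 2 - 2 * y * R - 2 * e * R - 2 * (d * e)|
      ≤ 2 * A ^ 2 + M ^ 2 + 4 * R ^ 2 + 2 * e ^ 2 := by
  have h1 : d ^ 2 ≤ A ^ 2 := sq_le_sq' (abs_le.1 hd).1 (abs_le.1 hd).2
  have h2 : y ^ 2 ≤ M ^ 2 := sq_le_sq' (abs_le.1 hy).1 (abs_le.1 hy).2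
  rw [abs_le]
  constructor <;>
  nlinarith [sq_nonneg (d + R), sq_nonneg (d - R), sq_nonneg (y + R), sq_nonneg (y - R),
    sq_nonneg (e + R), sq_nonneg (e - R), sq_nonneg (d + e), sq_nonneg (d - e), sq_nonneg R]

/-- Young's inequality with weight l, for later times: a small l damps the terms that are merely
bounded, and the factor 1/l falls on R², which is small. -/
lemma abs_cross_le {d y e R A M l : ℝ} (hl : 0 < l) (hd : |d| ≤ A) (hy : |y| ≤ M) :
    |2 * d * R + R ^ 2 - 2 * y * R - 2 * e * R|
      ≤ 2 * l * ((A + M) ^ 2 + e ^ 2) + (1 / l + 1) * R ^ 2 := by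
  have h1 : |2 * d * R + R ^ 2 - 2 * y * R - 2 * e * R| ≤ 2 * (|R| * (A + M + |e|)) + R ^ 2 := by
    have : 2 * d * R + R ^ 2 - 2 * y * R - 2 * e * R = 2 * (R * (d - y - e)) + R ^ 2 := by ring
    rw [this]
    refine (abs_add_le _ _).trans ?_
    rw [abs_mul, abs_mul, abs_two, abs_of_nonneg (sq_nonneg R)]
    have h2 : |d - y - e| ≤ A + M + |e| :=
      (abs_sub _ _).trans (by linarith [abs_sub d y])
    gcongr
  have h3 : 2 * (|R| * (A + M + |e|)) ≤ l * (A + M + |e|) ^ 2 + 1 / l * R ^ 2 := by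
    have := sq_nonneg (l * (A + M + |e|) - |R|)
    rw [← sq_abs R]
    have e1 : l * (A + M + |e|) ^ 2 + 1 / l * |R| ^ 2 - 2 * (|R| * (A + M + |e|))
        = (l * (A + M + |e|) - |R|) ^ 2 / l := by field_simp; ring
    have := div_nonneg this hl.le
    linarith
  have h4 : (A + M + |e|) ^ 2 ≤ 2 * ((A + M) ^ 2 + e ^ 2) := by
    rw [← sq_abs e]
    nlinarith [sq_nonneg (A + M - |e|)]
  have h5 : l * (A + M + |e|) ^ 2 ≤ l * (2 * ((A + M) ^ 2 + e ^ 2)) := by gcongr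
  linarith

/-- The contribution of the first observations to the bound of the objective. -/
noncomputable def initialTerm (e : ℕ → ℝ) (δ : ℝ) (T : ℕ) : ℝ :=
  (T : ℝ)⁻¹ * ∑ i ∈ Finset.Icc 1 ⌊δ * (T : ℝ)⌋₊,
    (1 + e i ^ 2 + (i : ℝ)⁻¹ * ∑ j ∈ Finset.Ico 1 i, e j ^ 2)

section Pathwise

variable {K q : ℝ → ℝ} {Ξ Bq : ℝ} {L : NNReal}

/-- The deterministic core: the right-hand side is free of ξ and s, so its mean controls the
supremum. The order of quantifiers matters. `C` precedes δ, so δ can make the initial term small,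
while `D` may be large because Q has small mean. -/
theorem exists_pathwise_bound (hK : IsBoundedKernel K Ξ) (hΞ : 0 < Ξ)
    (hq : LipschitzWith L q) (hqB : ∀ x, |q x| ≤ Bq) :
    ∃ C : ℝ, 0 ≤ C ∧ ∀ δ ρ : ℝ, 0 < δ → 0 < ρ → ∃ D : ℝ, 0 ≤ D ∧
      ∀ᶠ T : ℕ in atTop, ∀ (e : ℕ → ℝ) (Q : ℝ), 0 ≤ Q →
      (∀ n ≤ T, (∑ j ∈ Finset.Icc 1 n, e j) ^ 2 ≤ (T : ℝ) ^ 2 * Q) →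
      ∀ ξ ∈ Icc 1 Ξ, ∀ s ∈ Icc (0 : ℝ) 1,
        |seqObj K q e T s ξ - limObj K q s ξ|
          ≤ ρ * (1 + meanSq e T) + D * Q + C * initialTerm e δ T := by
  obtain ⟨C₁, hC₁, hw⟩ := hK.exists_hasWeightBound hΞ
  obtain ⟨A, hA, -, hAD⟩ := exists_abs_limPred_le hK hΞ hq hqB
  have hBq0 : 0 ≤ Bq := (abs_nonneg _).trans (hqB 0)
  set C : ℝ := 2 * A ^ 2 + Bq ^ 2 + 4 * C₁ ^ 2 + 2 with hC
  refine ⟨C, by positivity, fun δ ρ hδ hρ => ?_⟩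
  -- Chosen so that 2l((A + Bq)² + 1) = ρ/4; below, ρ' is chosen so that (1/l + 1)ρ' = ρ/4.
  set l : ℝ := ρ / (8 * ((A + Bq) ^ 2 + 1)) with hl
  have hl0 : 0 < l := by positivity
  set ρ' : ℝ := ρ / 4 / (1 / l + 1) with hρ'
  have hρ'0 : 0 < ρ' := by positivity
  obtain ⟨Λ, hΛ0, hΛ⟩ := exists_abs_discPred_succ_sub_le hK hΞ hq hqB hδ
  obtain ⟨D', hD'0, hD'⟩ := exists_seqPred_sq_le hK hΞ hδ hρ'0
  -- The first summand comes from R², the second from linearizing √Q in the sum of d_i e_i.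
  refine ⟨(1 / l + 1) * D' + 4 / ρ * (2 * A + Λ) ^ 2, by positivity, ?_⟩
  filter_upwards [hw, hAD, hΛ, hD', eventually_gt_atTop 0,
    eventually_abs_sum_discPred_sub_limObj_le hK hΞ hq hqB (show 0 < ρ / 4 by positivity)]
    with T h1 h2 h3 h4 hT h5 e Q hQ hS ξ hξ s hs
  have hT' : (0 : ℝ) < T := by exact_mod_cast hT
  have h5 := h5 ξ hξ s hs
  have h4 := h4 e Q hQ hS ξ hξ
  set n := ⌊(T : ℝ) * s⌋₊ with hn
  have hnT : n ≤ T := Nat.floor_le_of_le (mul_le_of_le_one_right hT'.le hs.2)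
  set d : ℕ → ℝ := discPred K q T ξ with hd
  set R : ℕ → ℝ := seqPred K e T ξ with hR
  set y : ℕ → ℝ := fun i => q ((i : ℝ) / T) with hy
  set X : ℕ → ℝ := fun i => 2 * d i * R i + R i ^ 2 - 2 * y i * R i - 2 * e i * R i with hX
  have hobj : seqObj K q e T s ξ = (T : ℝ)⁻¹ * ∑ i ∈ Finset.Icc 1 n, (d i ^ 2 - 2 * (y i * d i))
      + (T : ℝ)⁻¹ * ∑ i ∈ Finset.Icc 1 n, (X i - 2 * (d i * e i)) := by
    rw [seqObj, ← mul_add, ← Finset.sum_add_distrib]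
    congr 1
    refine Finset.sum_congr rfl fun i _ => ?_
    rw [seqPred_add K (fun j => q ((j : ℝ) / T)) e, ← discPred_eq_seqPred]
    simp only [hX, hd, hR, hy]
    ring
  -- The minimum covers s < δ, in which case the late range is empty.
  set b := min n ⌊δ * (T : ℝ)⌋₊ with hb
  have hsplit : ∑ i ∈ Finset.Icc 1 n, (X i - 2 * (d i * e i)) =
      ∑ i ∈ Finset.Icc 1 b, (X i - 2 * (d i * e i)) + (∑ i ∈ Finset.Icc (b + 1) n, X i
        - 2 * ∑ i ∈ Finset.Icc (b + 1) n, d i * e i) := by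
    rw [Finset.mul_sum, ← Finset.sum_sub_distrib]
    have hIcc : ∀ u v : ℕ, Finset.Ioc u v = Finset.Icc (u + 1) v := fun u v => by
      ext; simp
    have hc := Finset.sum_Ioc_consecutive (fun i => X i - 2 * (d i * e i)) (Nat.zero_le b)
      (min_le_left n ⌊δ * (T : ℝ)⌋₊)
    rw [hIcc, hIcc, hIcc] at hc
    exact hc.symm
  have hlarge : ∀ i ∈ Finset.Icc (b + 1) n, δ * T ≤ i ∧ i ≤ T := by
    intro i hi
    rw [Finset.mem_Icc] at hi
    refine ⟨?_, hi.2.trans hnT⟩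
    have : ⌊δ * (T : ℝ)⌋₊ < i := by omega
    exact ((Nat.floor_lt (by positivity)).1 this).le
  have hsmall : |∑ i ∈ Finset.Icc 1 b, (X i - 2 * (d i * e i))| ≤ T * (C * initialTerm e δ T) := by
    have e1 : (T : ℝ) * (C * initialTerm e δ T) = ∑ i ∈ Finset.Icc 1 ⌊δ * (T : ℝ)⌋₊,
        C * (1 + e i ^ 2 + (i : ℝ)⁻¹ * ∑ j ∈ Finset.Ico 1 i, e j ^ 2) := by
      rw [initialTerm, ← Finset.mul_sum]
      field_simp
    have hnn : ∀ i : ℕ, 0 ≤ (i : ℝ)⁻¹ * ∑ j ∈ Finset.Ico 1 i, e j ^ 2 := fun i =>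
      mul_nonneg (by positivity) (Finset.sum_nonneg fun _ _ => sq_nonneg _)
    rw [e1]
    refine (Finset.abs_sum_le_sum_abs _ _).trans ((Finset.sum_le_sum fun i hi => ?_).trans
      (Finset.sum_le_sum_of_subset_of_nonneg (Finset.Icc_subset_Icc_right (min_le_right n _))
        fun i _ _ => mul_nonneg (by positivity) (by have := hnn i; positivity)))
    rw [Finset.mem_Icc] at hi
    have hiT : i ≤ T := by omega
    refine (abs_cross_small_le (h2 ξ hξ i hiT) (hqB _)).trans ?_
    have hR2 := h1.seqPred_sq_le hC₁ e hξ hiT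
    rw [← hR] at hR2
    have hnni := hnn i
    set a := (i : ℝ)⁻¹ * ∑ j ∈ Finset.Ico 1 i, e j ^ 2
    have e2 : 0 ≤ (2 * A ^ 2 + Bq ^ 2 + 4 * C₁ ^ 2) * e i ^ 2 := by positivity
    have e3 : 0 ≤ (2 * A ^ 2 + Bq ^ 2 + 2) * a := by positivity
    have e4 : 0 ≤ 4 * C₁ ^ 2 + 2 := by positivity
    rw [hC]
    linarith
  have hcard : ((n + 1 - (b + 1) : ℕ) : ℝ) ≤ T := by exact_mod_cast (by omega)
  have hV : ∑ i ∈ Finset.Icc (b + 1) n, e i ^ 2 ≤ T * meanSq e T := by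
    rw [meanSq, mul_inv_cancel_left₀ hT'.ne']
    exact Finset.sum_le_sum_of_subset_of_nonneg (Finset.Icc_subset_Icc (by omega) hnT)
      fun _ _ _ => sq_nonneg _
  have hV0 := meanSq_nonneg e T
  set V := meanSq e T with hVdef
  have hmid : |∑ i ∈ Finset.Icc (b + 1) n, X i| ≤
      T * (2 * l * ((A + Bq) ^ 2 + V) + (1 / l + 1) * (ρ' * V + D' * Q)) := by
    have hterm : ∀ i ∈ Finset.Icc (b + 1) n, |X i| ≤ 2 * l * e i ^ 2
        + (2 * l * (A + Bq) ^ 2 + (1 / l + 1) * (ρ' * V + D' * Q)) := by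
      intro i hi
      obtain ⟨hi1, hi2⟩ := hlarge i hi
      have e1 := abs_cross_le (e := e i) (R := R i) hl0 (h2 ξ hξ i hi2) (hqB ((i : ℝ) / T))
      have e2 : (1 / l + 1) * R i ^ 2 ≤ (1 / l + 1) * (ρ' * V + D' * Q) := by
        gcongr
        exact h4 i hi1 hi2
      refine e1.trans ?_
      linarith
    refine (Finset.abs_sum_le_sum_abs _ _).trans ((Finset.sum_le_sum hterm).trans ?_)
    rw [Finset.sum_add_distrib, ← Finset.mul_sum, Finset.sum_const, Nat.card_Icc, nsmul_eq_mul]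
    have e3 : 2 * l * ∑ i ∈ Finset.Icc (b + 1) n, e i ^ 2 ≤ 2 * l * (T * V) := by gcongr
    have e4 : ((n + 1 - (b + 1) : ℕ) : ℝ)
        * (2 * l * (A + Bq) ^ 2 + (1 / l + 1) * (ρ' * V + D' * Q))
        ≤ T * (2 * l * (A + Bq) ^ 2 + (1 / l + 1) * (ρ' * V + D' * Q)) := by gcongr
    linarith
  have hlin : |∑ i ∈ Finset.Icc (b + 1) n, d i * e i| ≤ T * ((2 * A + Λ) * √Q) := by
    have hM : ∀ k ≤ n, |∑ j ∈ Finset.Icc 1 k, e j| ≤ T * √Q := by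
      intro k hk
      have := Real.abs_le_sqrt (hS k (by omega))
      rwa [Real.sqrt_mul (by positivity), Real.sqrt_sq hT'.le] at this
    have := abs_sum_Icc_mul_le (a := d) (e := e) (p := b + 1) (n := n) (A := A) (Λ := Λ / T)
      (by omega) hM (fun j hj => h2 ξ hξ j (hlarge j hj).2) (by positivity) hA.le (fun j hj => by
        rw [Finset.mem_Ico] at hj
        exact h3 ξ hξ j (hlarge j (by rw [Finset.mem_Icc]; omega)).1 (by omega))
    refine this.trans ?_
    have hnT' : (n : ℝ) ≤ T := by exact_mod_cast hnT
    calc (2 * A + n * (Λ / T)) * (T * √Q) ≤ (2 * A + T * (Λ / T)) * (T * √Q) := by gcongr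
      _ = _ := by field_simp
  have hlin2 : (2 * A + Λ) * √Q ≤ ρ / 8 + 2 / ρ * ((2 * A + Λ) ^ 2 * Q) := by
    have e1 := sq_nonneg (ρ / 4 - (2 * A + Λ) * √Q)
    have e2 : ρ / 8 + 2 / ρ * ((2 * A + Λ) ^ 2 * √Q ^ 2) - (2 * A + Λ) * √Q
        = (ρ / 4 - (2 * A + Λ) * √Q) ^ 2 * (2 / ρ) := by field_simp; ring
    rw [Real.sq_sqrt hQ] at e2
    have := mul_nonneg e1 (show 0 ≤ 2 / ρ by positivity)
    linarith
  have hl1 : 2 * l * ((A + Bq) ^ 2 + V) ≤ ρ / 4 * (1 + V) := by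
    have e1 : 2 * l * ((A + Bq) ^ 2 + 1) = ρ / 4 := by rw [hl]; field_simp; ring
    rw [← e1]
    have : 0 ≤ 2 * l * (1 + (A + Bq) ^ 2 * V) := by positivity
    linarith
  have hρ1 : (1 / l + 1) * ρ' = ρ / 4 := by rw [hρ']; field_simp
  rw [hobj, hsplit, add_sub_right_comm]
  refine (abs_add_le _ _).trans ?_
  have hfin : |(T : ℝ)⁻¹ * (∑ i ∈ Finset.Icc 1 b, (X i - 2 * (d i * e i))
      + (∑ i ∈ Finset.Icc (b + 1) n, X i - 2 * ∑ i ∈ Finset.Icc (b + 1) n, d i * e i))| ≤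
      C * initialTerm e δ T + (2 * l * ((A + Bq) ^ 2 + V) + (1 / l + 1) * (ρ' * V + D' * Q))
        + 2 * ((2 * A + Λ) * √Q) := by
    rw [abs_mul, abs_of_pos (inv_pos.2 hT'), inv_mul_le_iff₀ hT']
    refine (abs_add_le _ _).trans ?_
    have e1 := abs_sub (∑ i ∈ Finset.Icc (b + 1) n, X i)
      (2 * ∑ i ∈ Finset.Icc (b + 1) n, d i * e i)
    rw [abs_mul, abs_two] at e1
    linarith
  have e5 : (1 / l + 1) * (ρ' * V + D' * Q) = ρ / 4 * V + (1 / l + 1) * D' * Q := by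
    rw [← hρ1]; ring
  have e6 : 2 * (2 / ρ * ((2 * A + Λ) ^ 2 * Q)) = 4 / ρ * (2 * A + Λ) ^ 2 * Q := by ring
  have e7 : 0 ≤ ρ * V := by positivity
  linarith

end Pathwise

/-! ### Covariances of near epoch dependent processes -/

lemma tendsto_of_natCast_mul_tendsto {a : ℕ → ℝ}
    (h : Tendsto (fun k : ℕ => (k : ℝ) * a k) atTop (𝓝 0)) : Tendsto a atTop (𝓝 0) := by
  refine squeeze_zero_norm' ?_ (by simpa using h.norm)
  filter_upwards [eventually_ge_atTop 1] with k hk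
  have : (1 : ℝ) ≤ k := by exact_mod_cast hk
  rw [Real.norm_eq_abs]
  nlinarith [abs_nonneg (a k)]

lemma sigmaField_mono {Ω : Type*} (Z : ℤ → Ω → ℝ) {J J' : Set ℤ} (h : J ⊆ J') :
    sigmaField Z J ≤ sigmaField Z J' := biSup_mono fun _ hi => h hi

section Mixing

variable {Ω : Type*} [mΩ : MeasurableSpace Ω] {μ : Measure Ω}

/-- A bounded sequence in `L²` which is asymptotically orthogonal to the indicators of a σ-field is
asymptotically orthogonal to the square integrable variables measurable for it. -/
lemma tendsto_integral_mul_of_tendsto_setIntegral {m : MeasurableSpace Ω} (hm : m ≤ mΩ)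
    {Y : ℕ → Ω → ℝ} {σ : ℝ} (hY : ∀ k, MemLp (Y k) 2 μ) (hσ : ∀ k, √(∫ ω, Y k ω ^ 2 ∂μ) ≤ σ)
    (hA : ∀ A, MeasurableSet[m] A → Tendsto (fun k => ∫ ω in A, Y k ω ∂μ) atTop (𝓝 0))
    {X : Ω → ℝ} (hX : MemLp X 2 μ) (hXm : StronglyMeasurable[m] X) :
    Tendsto (fun k => ∫ ω, X ω * Y k ω ∂μ) atTop (𝓝 0) := by
  have : Fact (1 ≤ (2 : ENNReal)) := ⟨by norm_num⟩
  have hσ0 : 0 ≤ σ := (Real.sqrt_nonneg _).trans (hσ 0)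
  -- Indicators are covered by `hA`, and sums by linearity. For L² limits, the uniform bound σ on
  -- the norms of `Y k` makes the error of approximating X uniform in k.
  refine MemLp.induction_stronglyMeasurable hm (p := 2) (by norm_num)
    (fun f : Ω → ℝ => Tendsto (fun k => ∫ ω, f ω * Y k ω ∂μ) atTop (𝓝 0))
    ?_ ?_ ?_ ?_ hX hXm.aestronglyMeasurable
  · intro c A hAm _
    have e : ∀ k, ∫ ω, A.indicator (fun _ => c) ω * Y k ω ∂μ = c * ∫ ω in A, Y k ω ∂μ := by
      intro k
      rw [← integral_const_mul, ← integral_indicator (hm _ hAm)]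
      refine integral_congr_ae (ae_of_all _ fun ω => ?_)
      by_cases h : ω ∈ A <;> simp [h]
    simp only [e]
    simpa using (hA A hAm).const_mul c
  · intro f g _ hf hg _ _ hPf hPg
    have e : ∀ k, ∫ ω, (f + g) ω * Y k ω ∂μ
        = ∫ ω, f ω * Y k ω ∂μ + ∫ ω, g ω * Y k ω ∂μ := by
      intro k
      have k1 : Integrable (fun ω => f ω * Y k ω) μ := hf.integrable_mul (hY k)
      have k2 : Integrable (fun ω => g ω * Y k ω) μ := hg.integrable_mul (hY k)
      rw [← integral_add k1 k2]
      simp [add_mul]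
    simp only [e]
    simpa using hPf.add hPg
  · refine isClosed_of_closure_subset fun f hf => ?_
    rw [mem_ofPred_eq, Metric.tendsto_nhds]
    intro r hr
    obtain ⟨g, hg, hfg⟩ := Metric.mem_closure_iff.1 hf (r / (2 * (σ + 1))) (by positivity)
    filter_upwards [(Metric.tendsto_nhds.1 hg) (r / 2) (half_pos hr)] with k hk
    have hf2 : MemLp ((f : Lp ℝ 2 μ) : Ω → ℝ) 2 μ := Lp.memLp _
    have hg2 : MemLp ((g : Lp ℝ 2 μ) : Ω → ℝ) 2 μ := Lp.memLp _
    rw [Subtype.dist_eq, Lp.dist_def, eLpNorm_two_eq_ofReal_sqrt (hf2.sub hg2),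
      ENNReal.toReal_ofReal (Real.sqrt_nonneg _)] at hfg
    have e := abs_integral_mul_le (hf2.sub hg2) (hY k)
    have e2 : ∫ ω, (((f : Lp ℝ 2 μ) : Ω → ℝ) - ((g : Lp ℝ 2 μ) : Ω → ℝ)) ω * Y k ω ∂μ
        = ∫ ω, ((f : Lp ℝ 2 μ) : Ω → ℝ) ω * Y k ω ∂μ
          - ∫ ω, ((g : Lp ℝ 2 μ) : Ω → ℝ) ω * Y k ω ∂μ := by
      have k1 : Integrable (fun ω => ((f : Lp ℝ 2 μ) : Ω → ℝ) ω * Y k ω) μ :=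
        hf2.integrable_mul (hY k)
      have k2 : Integrable (fun ω => ((g : Lp ℝ 2 μ) : Ω → ℝ) ω * Y k ω) μ :=
        hg2.integrable_mul (hY k)
      rw [← integral_sub k1 k2]
      simp [sub_mul]
    rw [e2] at e
    have e3 := e.trans (mul_le_mul hfg.le (hσ k) (Real.sqrt_nonneg _) (by positivity))
    have e4 : r / (2 * (σ + 1)) * σ < r / 2 := by
      rw [div_mul_eq_mul_div, div_lt_div_iff₀ (by positivity) (by norm_num)]
      nlinarith
    rw [Real.dist_eq, sub_zero] at hk ⊢
    rw [abs_lt] at hk ⊢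
    rw [abs_le] at e3
    constructor <;> linarith
  · intro f g hfg _ hPf
    refine hPf.congr fun k => integral_congr_ae ?_
    filter_upwards [hfg] with ω hω
    rw [hω]

lemma sigmaField_le {Z : ℤ → Ω → ℝ} {J : Set ℤ} (h : ∀ t ∈ J, Measurable (Z t)) :
    sigmaField Z J ≤ mΩ := iSup₂_le fun i hi => (h i hi).comap_le

variable [IsProbabilityMeasure μ]

/-- A mixing inequality for an event and a centred square integrable variable. -/
lemma abs_setIntegral_le_of_mixing {m : MeasurableSpace Ω} (hm : m ≤ mΩ) {A : Set Ω}
    (hA : MeasurableSet[mΩ] A) {a : ℝ}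
    (ha : ∀ B, MeasurableSet[m] B → |μ.real (A ∩ B) - μ.real A * μ.real B| ≤ a)
    {Y : Ω → ℝ} (hYm : StronglyMeasurable[m] Y) (hY : MemLp Y 2 μ) (hY0 : ∫ ω, Y ω ∂μ = 0) :
    |∫ ω in A, Y ω ∂μ| ≤ √(2 * a) * √(∫ ω, Y ω ^ 2 ∂μ) := by
  -- As Y is centred and measurable for the σ-field, its integral over A equals E[UY] = E[WY] with W
  -- = E[U | m]. Since |W| ≤ 1, E[W²] ≤ E|W|, and Cauchy-Schwarz then needs only a second moment of
  -- Y.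
  set U : Ω → ℝ := fun ω => A.indicator (fun _ => (1 : ℝ)) ω - μ.real A with hU
  have hi1 : Integrable (A.indicator (fun _ => (1 : ℝ))) μ :=
    (integrable_const (1 : ℝ)).indicator hA
  have hUi : Integrable U μ := hi1.sub (integrable_const _)
  have hUB : ∀ B, MeasurableSet[mΩ] B → ∫ ω in B, U ω ∂μ = μ.real (A ∩ B) - μ.real A * μ.real B := by
    intro B hB
    rw [hU, integral_sub hi1.integrableOn integrableOn_const, setIntegral_indicator hA]
    simp [inter_comm, mul_comm]
  have hUb : ∀ ω, |U ω| ≤ 1 := by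
    intro ω
    have h0 : 0 ≤ μ.real A := measureReal_nonneg
    have h1 : μ.real A ≤ 1 := measureReal_le_one
    by_cases h : ω ∈ A <;> simp only [hU, h, indicator_of_mem, indicator_of_notMem,
      not_false_eq_true, abs_le] <;> constructor <;> linarith
  have hU2 : MemLp U 2 μ := MemLp.of_bound hUi.aestronglyMeasurable 1 (ae_of_all _ hUb)
  set W := μ[U | m] with hW
  have hW2 : MemLp W 2 μ := hU2.condExp (by norm_num)
  have hWi : Integrable W μ := integrable_condExp
  have hWm : StronglyMeasurable[m] W := stronglyMeasurable_condExp
  have hWb : ∀ᵐ ω ∂μ, |W ω| ≤ 1 := ae_bdd_abs_condExp_of_ae_bdd_abs (ae_of_all _ hUb)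
  -- Splitting by the sign of W gives two events of the σ-field, each contributing at most a.
  have hWabs : ∫ ω, |W ω| ∂μ ≤ 2 * a := by
    have hB : MeasurableSet[m] {ω | 0 < W ω} := hWm.measurable measurableSet_Ioi
    set B := {ω | 0 < W ω} with hBdef
    have e1 : ∫ ω in B, |W ω| ∂μ = ∫ ω in B, W ω ∂μ :=
      setIntegral_congr_fun (hm _ hB) fun ω hω => abs_of_pos hω
    have e2 : ∫ ω in Bᶜ, |W ω| ∂μ = - ∫ ω in Bᶜ, W ω ∂μ := by
      rw [← integral_neg]
      exact setIntegral_congr_fun (hm _ hB).compl fun ω hω =>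
        abs_of_nonpos (not_lt.1 hω)
    rw [← integral_add_compl (hm _ hB) hWi.abs, e1, e2, setIntegral_condExp hm hUi hB,
      setIntegral_condExp hm hUi hB.compl, hUB _ (hm _ hB), hUB _ (hm _ hB).compl]
    have a1 := (abs_le.1 (ha _ hB)).2
    have a2 := (abs_le.1 (ha _ hB.compl)).1
    linarith
  have hWsq : ∫ ω, W ω ^ 2 ∂μ ≤ 2 * a := by
    refine (integral_mono_ae hW2.integrable_sq hWi.abs ?_).trans hWabs
    filter_upwards [hWb] with ω hω
    rw [← sq_abs]
    nlinarith [abs_nonneg (W ω)]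
  have hUY : Integrable (U * Y) μ := hU2.integrable_mul hY
  have e3 : ∫ ω, W ω * Y ω ∂μ = ∫ ω, U ω * Y ω ∂μ := by
    have := integral_condExp (μ := μ) hm (f := U * Y)
    rw [integral_congr_ae (condExp_mul_of_stronglyMeasurable_right hYm hUY hUi)] at this
    simpa using this
  have e4 : ∫ ω in A, Y ω ∂μ = ∫ ω, U ω * Y ω ∂μ := by
    have hYi : Integrable Y μ := hY.integrable (by norm_num)
    have e5 : (fun ω => U ω * Y ω) = fun ω => A.indicator Y ω - μ.real A * Y ω := by
      funext ω
      by_cases h : ω ∈ A <;> simp [hU, h, sub_mul]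
    rw [e5, integral_sub (hYi.indicator hA) (hYi.const_mul _), integral_const_mul, hY0, mul_zero,
      sub_zero, integral_indicator hA]
  rw [e4, ← e3]
  refine (abs_integral_mul_le hW2 hY).trans ?_
  gcongr

lemma abs_measureReal_inter_sub_le_alphaCoeff {I : Set ℤ} {Z : ℤ → Ω → ℝ} {k : ℕ} {t : ℤ}
    {A B : Set Ω} (hA : MeasurableSet[sigmaField Z (I ∩ Iic t)] A)
    (hB : MeasurableSet[sigmaField Z (I ∩ Ici (t + k))] B) :
    |μ.real (A ∩ B) - μ.real A * μ.real B| ≤ alphaCoeff μ I Z k := by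
  -- The values are bounded by 1, so `sSup` is a true supremum and not its default value.
  refine le_csSup ⟨1, ?_⟩ ⟨t, A, B, hA, hB, rfl⟩
  rintro x ⟨t, A, B, -, -, rfl⟩
  have h1 : μ.real (A ∩ B) ∈ Icc (0 : ℝ) 1 := ⟨measureReal_nonneg, measureReal_le_one⟩
  have h2 : μ.real A ∈ Icc (0 : ℝ) 1 := ⟨measureReal_nonneg, measureReal_le_one⟩
  have h3 : μ.real B ∈ Icc (0 : ℝ) 1 := ⟨measureReal_nonneg, measureReal_le_one⟩
  have h4 := mul_nonneg h2.1 h3.1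
  have h5 := mul_le_one₀ h2.2 h3.1 h3.2
  rw [abs_le]
  constructor <;> linarith [h1.1, h1.2]

/-- The covariances of a stationary near epoch dependent process vanish at large lags. -/
lemma tendsto_integral_mul_of_isNED {ε Z : ℤ → Ω → ℝ} {J : Set ℤ} {v : ℝ}
    (hε2 : ∀ t : ℤ, 1 ≤ t → MemLp (ε t) 2 μ) (hε0 : ∀ t : ℤ, 1 ≤ t → ∫ ω, ε t ω ∂μ = 0)
    (hv : ∀ t : ℤ, 1 ≤ t → ∫ ω, ε t ω ^ 2 ∂μ = v)
    (hZ : IsMixingSeries μ J Z) (hned : IsNED μ 2 (Ici 1) ε J Z) :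
    Tendsto (fun k : ℕ => ∫ ω, ε 1 ω * ε (1 + k) ω ∂μ) atTop (𝓝 0) := by
  obtain ⟨d, ν, hd0, hd, hν0, -, hν, happ⟩ := hned
  set σ : ℝ := √v with hσ
  have hσ0 : 0 ≤ σ := Real.sqrt_nonneg _
  have hv0 : 0 ≤ v := by rw [← hv 1 le_rfl]; exact integral_nonneg fun _ => sq_nonneg _
  have hσv : ∀ t : ℤ, 1 ≤ t → √(∫ ω, ε t ω ^ 2 ∂μ) = σ := fun t ht => by rw [hv t ht]
  have hd' : ∀ t : ℤ, 1 ≤ t → d t ≤ 2 * σ := by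
    intro t ht
    have h := hd t ht
    simp only [hε0 t ht, sub_zero] at h
    rw [eLpNorm_two_eq_ofReal_sqrt (hε2 t ht), hσv t ht,
      show (2 : ENNReal) = ENNReal.ofReal 2 by simp, ← ENNReal.ofReal_mul (by norm_num)] at h
    exact (ENNReal.ofReal_le_ofReal_iff (by positivity)).1 h
  have hsub : ∀ J', J' ⊆ J → sigmaField Z J' ≤ mΩ := fun J' hJ' =>
    sigmaField_le fun t ht => hZ.weaklyStationary.measurable t (hJ' ht)
  set E : ℤ → ℕ → Ω → ℝ := fun t l => μ[ε t | sigmaField Z (J ∩ Icc (t - l) (t + l))] with hE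
  have hE2 : ∀ t : ℤ, 1 ≤ t → ∀ l, MemLp (E t l) 2 μ := fun t ht l =>
    (hε2 t ht).condExp (by norm_num)
  have hEσ : ∀ t : ℤ, 1 ≤ t → ∀ l, √(∫ ω, E t l ω ^ 2 ∂μ) ≤ σ := by
    intro t ht l
    have h := eLpNorm_condExp_le_eLpNorm (m := sigmaField Z (J ∩ Icc (t - l) (t + l))) (μ := μ)
      (ε t) (p := 2) (by norm_num)
    rw [eLpNorm_two_eq_ofReal_sqrt (hE2 t ht l), eLpNorm_two_eq_ofReal_sqrt (hε2 t ht),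
      hσv t ht] at h
    exact (ENNReal.ofReal_le_ofReal_iff hσ0).1 h
  have hEapp : ∀ t : ℤ, 1 ≤ t → ∀ l, √(∫ ω, (ε t - E t l) ω ^ 2 ∂μ) ≤ 2 * σ * ν l := by
    intro t ht l
    have h := happ t ht l
    rw [eLpNorm_two_eq_ofReal_sqrt ((hε2 t ht).sub (hE2 t ht l))] at h
    exact ((ENNReal.ofReal_le_ofReal_iff (mul_nonneg (hd0 t ht) (hν0 l))).1 h).trans
      (mul_le_mul_of_nonneg_right (hd' t ht) (hν0 l))
  have hα := tendsto_of_natCast_mul_tendsto hZ.tendsto_alpha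
  have hone : ∀ k : ℕ, (1 : ℤ) ≤ 1 + k := fun k => by omega
  -- the approximating process is asymptotically uncorrelated
  have hlim : ∀ l, Tendsto (fun k : ℕ => ∫ ω, E 1 l ω * E (1 + k) l ω ∂μ) atTop (𝓝 0) := by
    intro l
    refine tendsto_integral_mul_of_tendsto_setIntegral
      (m := sigmaField Z (J ∩ Icc (1 - l) (1 + l))) (hsub _ inter_subset_left)
      (fun k => hE2 _ (hone k) l) (fun k => hEσ _ (hone k) l) (fun A hA => ?_)
      (hE2 1 le_rfl l) stronglyMeasurable_condExp
    have hA' : MeasurableSet[sigmaField Z (J ∩ Iic (1 + (l : ℤ)))] A :=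
      sigmaField_mono Z (inter_subset_inter_right J fun x hx => hx.2) _ hA
    have hbound : ∀ᶠ k : ℕ in atTop, ‖∫ ω in A, E (1 + k) l ω ∂μ‖
        ≤ √(2 * alphaCoeff μ J Z (k - 2 * l)) * σ := by
      filter_upwards [eventually_ge_atTop (2 * l)] with k hk
      refine (abs_setIntegral_le_of_mixing
        (m := sigmaField Z (J ∩ Icc ((1 + k : ℤ) - l) (1 + k + l))) (hsub _ inter_subset_left)
        (hsub _ inter_subset_left _ hA) (fun B hB => abs_measureReal_inter_sub_le_alphaCoeff hA'
          (sigmaField_mono Z (inter_subset_inter_right J fun x hx => ?_) _ hB))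
        stronglyMeasurable_condExp (hE2 _ (hone k) l) ?_).trans
        (mul_le_mul_of_nonneg_left (hEσ _ (hone k) l) (Real.sqrt_nonneg _))
      · rw [mem_Ici]
        have := hx.1
        push_cast [hk]
        linarith
      · rw [integral_condExp (hsub _ inter_subset_left), hε0 _ (hone k)]
    refine squeeze_zero_norm' hbound ?_
    have h1 : Tendsto (fun k => √(2 * alphaCoeff μ J Z (k - 2 * l)) * σ) atTop
        (𝓝 (√(2 * 0) * σ)) :=
      (((hα.comp (tendsto_sub_atTop_nat (2 * l))).const_mul 2).sqrt).mul_const σ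
    simpa using h1
  rw [Metric.tendsto_nhds]
  intro r hr
  -- Replacing each factor by its conditional expectation costs at most 2σ²ν_l ≤ r/4.
  obtain ⟨l, hl⟩ := (hν.eventually_le_const (show 0 < r / (8 * (σ ^ 2 + 1)) by positivity)).exists
  filter_upwards [Metric.tendsto_nhds.1 (hlim l) (r / 2) (half_pos hr)] with k hk
  rw [Real.dist_eq, sub_zero] at hk ⊢
  have i1 := (hε2 1 le_rfl)
  have i2 := hε2 _ (hone k)
  have j1 := hE2 1 le_rfl l
  have j2 := hE2 _ (hone k) l
  have e1 := abs_integral_mul_le (i1.sub j1) i2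
  have e2 := abs_integral_mul_le j1 (i2.sub j2)
  have s1 := e1.trans (mul_le_mul (hEapp 1 le_rfl l) (hσv _ (hone k)).le (Real.sqrt_nonneg _)
    (mul_nonneg (by positivity) (hν0 l)))
  have s2 := e2.trans (mul_le_mul (hEσ 1 le_rfl l) (hEapp _ (hone k) l) (Real.sqrt_nonneg _) hσ0)
  have e3 : ∫ ω, ε 1 ω * ε (1 + k) ω ∂μ = ∫ ω, (ε 1 - E 1 l) ω * ε (1 + k) ω ∂μ
      + ∫ ω, E 1 l ω * (ε (1 + k) - E (1 + k) l) ω ∂μ + ∫ ω, E 1 l ω * E (1 + k) l ω ∂μ := by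
    have k1 : Integrable (fun ω => (ε 1 - E 1 l) ω * ε (1 + k) ω) μ :=
      (i1.sub j1).integrable_mul i2
    have k2 : Integrable (fun ω => E 1 l ω * (ε (1 + k) - E (1 + k) l) ω) μ :=
      j1.integrable_mul (i2.sub j2)
    have k3 : Integrable (fun ω => E 1 l ω * E (1 + k) l ω) μ := j1.integrable_mul j2
    have k12 : Integrable (fun ω => (ε 1 - E 1 l) ω * ε (1 + k) ω
        + E 1 l ω * (ε (1 + k) - E (1 + k) l) ω) μ := k1.add k2
    rw [← integral_add k1 k2, ← integral_add k12 k3]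
    refine integral_congr_ae (ae_of_all _ fun ω => ?_)
    simp only [Pi.sub_apply]
    ring
  have e4 : 2 * σ * ν l * σ ≤ r / 4 := by
    have : 2 * σ * ν l * σ ≤ 2 * σ ^ 2 * (r / (8 * (σ ^ 2 + 1))) := by
      rw [show 2 * σ * ν l * σ = 2 * σ ^ 2 * ν l by ring]
      gcongr
    refine this.trans ?_
    rw [mul_div_assoc', div_le_div_iff₀ (by positivity) (by norm_num)]
    nlinarith
  have e5 : σ * (2 * σ * ν l) = 2 * σ * ν l * σ := by ring
  rw [e3]
  rw [abs_lt] at hk ⊢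
  rw [abs_le] at s1 s2
  constructor <;> linarith

end Mixing

/-! ### Partial sums of the errors -/

lemma sum_Icc_intCast (f : ℤ → ℝ) (n : ℕ) :
    ∑ j ∈ Finset.Icc (1 : ℤ) n, f j = ∑ j ∈ Finset.Icc 1 n, f (j : ℤ) := by
  refine Finset.sum_nbij' Int.toNat (fun j : ℕ => (j : ℤ)) ?_ ?_ ?_ ?_ ?_
  · intro j hj; rw [Finset.mem_Icc] at hj ⊢; omega
  · intro j hj; rw [Finset.mem_Icc] at hj ⊢; omega
  · intro j hj; rw [Finset.mem_Icc] at hj; omega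
  · intro j _; simp
  · intro j hj
    rw [Finset.mem_Icc] at hj
    rw [Int.toNat_of_nonneg (by omega)]

section PartialSums

variable {Ω : Type*} [mΩ : MeasurableSpace Ω] {μ : Measure Ω}

lemma memLp_two_sum {ε : ℤ → Ω → ℝ} (hε2 : ∀ t : ℤ, 1 ≤ t → MemLp (ε t) 2 μ) (n : ℕ) :
    MemLp (fun ω => ∑ j ∈ Finset.Icc 1 n, ε (j : ℤ) ω) 2 μ :=
  memLp_finsetSum _ fun (j : ℕ) hj => hε2 _ (by rw [Finset.mem_Icc] at hj; omega)

lemma integral_sq_sum_eq {ε : ℤ → Ω → ℝ} (hε2 : ∀ t : ℤ, 1 ≤ t → MemLp (ε t) 2 μ) (n : ℕ) :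
    ∫ ω, (∑ j ∈ Finset.Icc 1 n, ε (j : ℤ) ω) ^ 2 ∂μ
      = ∑ j ∈ Finset.Icc 1 n, ∑ k ∈ Finset.Icc 1 n, ∫ ω, ε (j : ℤ) ω * ε (k : ℤ) ω ∂μ := by
  have hint : ∀ j ∈ Finset.Icc 1 n, ∀ k ∈ Finset.Icc 1 n,
      Integrable (fun ω => ε (j : ℤ) ω * ε (k : ℤ) ω) μ := fun j hj k hk => by
    rw [Finset.mem_Icc] at hj hk
    exact (hε2 _ (by omega)).integrable_mul (hε2 _ (by omega))
  simp only [sq, Finset.sum_mul_sum]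
  rw [integral_finsetSum _ fun (j : ℕ) hj => integrable_finsetSum _ (hint j hj)]
  exact Finset.sum_congr rfl fun (j : ℕ) hj => integral_finsetSum _ (hint j hj)

/-- The variance of the partial sums of a stationary process, in terms of its autocovariances. -/
lemma integral_sq_sum_le_of_stationary {ε : ℤ → Ω → ℝ}
    (hε2 : ∀ t : ℤ, 1 ≤ t → MemLp (ε t) 2 μ) {γ : ℕ → ℝ}
    (hγ : ∀ t : ℤ, 1 ≤ t → ∀ k : ℕ, ∫ ω, ε t ω * ε (t + k) ω ∂μ = γ k) (n : ℕ) :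
    ∫ ω, (∑ j ∈ Finset.Icc 1 n, ε (j : ℤ) ω) ^ 2 ∂μ
      ≤ 2 * n * ∑ k ∈ Finset.range n, |γ k| := by
  induction n with
  | zero => simp
  | succ n ih =>
    have hS := memLp_two_sum hε2 n
    have hn : (1 : ℤ) ≤ (n + 1 : ℕ) := by omega
    have hE := hε2 _ hn
    set S : Ω → ℝ := fun ω => ∑ j ∈ Finset.Icc 1 n, ε (j : ℤ) ω with hSdef
    have i1 : Integrable (fun ω => S ω * ε ((n + 1 : ℕ) : ℤ) ω) μ := hS.integrable_mul hE
    have e1 : ∫ ω, (∑ j ∈ Finset.Icc 1 (n + 1), ε (j : ℤ) ω) ^ 2 ∂μ = ∫ ω, S ω ^ 2 ∂μ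
        + 2 * ∫ ω, S ω * ε ((n + 1 : ℕ) : ℤ) ω ∂μ + ∫ ω, ε ((n + 1 : ℕ) : ℤ) ω ^ 2 ∂μ := by
      have i2 : Integrable (fun ω => S ω ^ 2 + 2 * (S ω * ε ((n + 1 : ℕ) : ℤ) ω)) μ :=
        hS.integrable_sq.add (i1.const_mul 2)
      rw [← integral_const_mul, ← integral_add hS.integrable_sq (i1.const_mul 2),
        ← integral_add i2 hE.integrable_sq]
      refine integral_congr_ae (ae_of_all _ fun ω => ?_)
      simp only [hSdef]
      rw [Finset.sum_Icc_succ_top (by omega)]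
      ring
    have e2 : ∫ ω, S ω * ε ((n + 1 : ℕ) : ℤ) ω ∂μ = ∑ k ∈ Finset.Icc 1 n, γ k := by
      have h := sum_Ico_reflect_lag (fun a _ => γ a) (n + 1)
      rw [Nat.add_sub_cancel] at h
      rw [← h]
      simp only [hSdef, Finset.sum_mul]
      rw [integral_finsetSum]
      · refine Finset.sum_congr (by ext; simp) fun (j : ℕ) hj => ?_
        rw [Finset.mem_Ico] at hj
        rw [← hγ j (by omega), show (j : ℤ) + ((n + 1 - j : ℕ) : ℤ) = ((n + 1 : ℕ) : ℤ) by omega]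
      · intro j hj
        rw [Finset.mem_Icc] at hj
        exact (hε2 j (by omega)).integrable_mul hE
    have e3 : ∫ ω, ε ((n + 1 : ℕ) : ℤ) ω ^ 2 ∂μ = γ 0 := by
      rw [← hγ _ hn 0]
      simp [sq]
    have e4 : ∑ k ∈ Finset.Icc 1 n, γ k + γ 0 ≤ ∑ k ∈ Finset.range (n + 1), |γ k| := by
      rw [Finset.range_eq_Ico, Finset.sum_eq_sum_Ico_succ_bot (by omega), add_comm,
        show Finset.Icc 1 n = Finset.Ico (0 + 1) (n + 1) by ext; simp]
      exact add_le_add (le_abs_self _) (Finset.sum_le_sum fun _ _ => le_abs_self _)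
    -- Nonnegativity allows the increment 2(γ_1 + ... + γ_n) + γ_0 to be enlarged to twice the full
    -- sum.
    have e5 : γ 0 ≥ 0 := by rw [← e3]; exact integral_nonneg fun _ => sq_nonneg _
    have e6 : ∑ k ∈ Finset.range n, |γ k| ≤ ∑ k ∈ Finset.range (n + 1), |γ k| :=
      Finset.sum_le_sum_of_subset_of_nonneg (Finset.range_subset_range.2 (by omega))
        fun _ _ _ => abs_nonneg _
    have e7 : 2 * (n : ℝ) * ∑ k ∈ Finset.range n, |γ k|
        ≤ 2 * (n : ℝ) * ∑ k ∈ Finset.range (n + 1), |γ k| := by gcongr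
    rw [e1, e2, e3]
    push_cast
    linarith

/-- Both error classes enter the rest of the argument through these facts. In the mixing case the
variance of the partial sums is O(n) by the second-order bound; in the near epoch dependent case the
autocovariances tend to 0, hence so do their Cesàro means, and the variance is o(n²). -/
lemma IsErrorProcess.exists_variance [IsProbabilityMeasure μ] {ε : ℤ → Ω → ℝ}
    (hε : IsErrorProcess μ ε) :
    ∃ v : ℝ, (∀ t : ℤ, 1 ≤ t → MemLp (ε t) 2 μ) ∧ (∀ t : ℤ, 1 ≤ t → ∫ ω, ε t ω ^ 2 ∂μ = v) ∧
      ∀ ρ : ℝ, 0 < ρ → ∀ᶠ n : ℕ in atTop,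
        ∫ ω, (∑ j ∈ Finset.Icc 1 n, ε (j : ℤ) ω) ^ 2 ∂μ ≤ ρ * (n : ℝ) ^ 2 := by
  obtain ⟨h0, hε⟩ := hε
  have hws : IsWeaklyStationary μ (Ici 1) ε := hε.elim (fun h => h.weaklyStationary) fun h => h.1
  have hε2 : ∀ t : ℤ, 1 ≤ t → MemLp (ε t) 2 μ := fun t ht => hws.memLp_two t ht
  have hcov : ∀ s t : ℤ, 1 ≤ s → 1 ≤ t → covariance (ε s) (ε t) μ = ∫ ω, ε s ω * ε t ω ∂μ := by
    intro s t hs ht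
    simp [covariance, h0 s hs, h0 t ht]
  have hγ : ∀ t : ℤ, 1 ≤ t → ∀ k : ℕ,
      ∫ ω, ε t ω * ε (t + k) ω ∂μ = ∫ ω, ε 1 ω * ε (1 + k) ω ∂μ := by
    intro t ht k
    rw [← hcov t (t + k) ht (by omega), ← hcov 1 (1 + k) le_rfl (by omega), covariance_comm,
      covariance_comm (ε 1)]
    exact hws.cov_eq t ht 1 (mem_Ici.2 le_rfl) k
  refine ⟨∫ ω, ε 1 ω ^ 2 ∂μ, hε2, fun t ht => ?_, fun ρ hρ => ?_⟩
  · have := hγ t ht 0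
    simpa [sq] using this
  rcases hε with hmix | ⟨-, -, J, Z, -, hZ, hned⟩
  · obtain ⟨B, hB⟩ := hmix.second_order
    filter_upwards [(tendsto_natCast_atTop_atTop (R := ℝ)).eventually_ge_atTop (B / ρ),
      eventually_ge_atTop 1] with n hn hn1
    have hn0 : (0 : ℝ) < n := by exact_mod_cast hn1
    have h1 := hB n hn1
    rw [inv_mul_le_iff₀ hn0, sum_Icc_intCast] at h1
    rw [div_le_iff₀ hρ] at hn
    rw [integral_sq_sum_eq hε2]
    calc _ ≤ _ := Finset.sum_le_sum fun (j : ℕ) hj => ?_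
      _ ≤ (n : ℝ) * B := h1
      _ ≤ n * (n * ρ) := by gcongr
      _ = _ := by ring
    rw [sum_Icc_intCast]
    refine Finset.sum_le_sum fun k hk => ?_
    rw [Finset.mem_Icc] at hj hk
    rw [hcov j k (by omega) (by omega)]
    exact le_abs_self _
  · have hlim := tendsto_integral_mul_of_isNED hε2 h0 (v := ∫ ω, ε 1 ω ^ 2 ∂μ)
      (fun t ht => by simpa [sq] using hγ t ht 0) hZ hned
    have hces := hlim.abs.cesaro
    rw [abs_zero] at hces
    filter_upwards [hces.eventually_le_const (half_pos hρ), eventually_ge_atTop 1] with n hn hn1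
    have hn0 : (0 : ℝ) < n := by exact_mod_cast hn1
    rw [inv_mul_le_iff₀ hn0] at hn
    refine (integral_sq_sum_le_of_stationary hε2 hγ n).trans ?_
    calc _ ≤ 2 * (n : ℝ) * (n * (ρ / 2)) := by gcongr
      _ = _ := by ring

/-- The finitely many n below the threshold have bounded second moments, which ρT² eventually
exceeds. -/
lemma eventually_integral_sq_sum_le {ε : ℤ → Ω → ℝ}
    (h : ∀ ρ : ℝ, 0 < ρ → ∀ᶠ n : ℕ in atTop,
        ∫ ω, (∑ j ∈ Finset.Icc 1 n, ε (j : ℤ) ω) ^ 2 ∂μ ≤ ρ * (n : ℝ) ^ 2) {ρ : ℝ} (hρ : 0 < ρ) :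
    ∀ᶠ T : ℕ in atTop, ∀ n ≤ T,
      ∫ ω, (∑ j ∈ Finset.Icc 1 n, ε (j : ℤ) ω) ^ 2 ∂μ ≤ ρ * (T : ℝ) ^ 2 := by
  obtain ⟨n₀, hn₀⟩ := eventually_atTop.1 (h ρ hρ)
  set c : ℝ := ∑ n ∈ Finset.range n₀, ∫ ω, (∑ j ∈ Finset.Icc 1 n, ε (j : ℤ) ω) ^ 2 ∂μ with hc
  filter_upwards [(tendsto_natCast_atTop_atTop (R := ℝ)).eventually_ge_atTop (c / ρ),
    eventually_ge_atTop 1] with T hT hT1 n hn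
  have hT' : (1 : ℝ) ≤ T := by exact_mod_cast hT1
  rcases le_or_gt n₀ n with h1 | h1
  · refine (hn₀ n h1).trans ?_
    gcongr
  · have h2 : ∫ ω, (∑ j ∈ Finset.Icc 1 n, ε (j : ℤ) ω) ^ 2 ∂μ ≤ c :=
      Finset.single_le_sum (f := fun n : ℕ => ∫ ω, (∑ j ∈ Finset.Icc 1 n, ε (j : ℤ) ω) ^ 2 ∂μ)
        (fun n _ => integral_nonneg fun _ => sq_nonneg _) (Finset.mem_range.2 h1)
    rw [div_le_iff₀ hρ] at hT
    have h3 : ρ * (T : ℝ) ≤ ρ * (T : ℝ) ^ 2 := by gcongr; nlinarith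
    linarith

/-- A maximal inequality by discretization: each n ≤ T lies within T/N + 1 above a grid point
⌊lT/N⌋. The partial sum up to the grid point is one of N + 1 fixed sums, and the remaining short
block is bounded by Cauchy-Schwarz and the mean square. -/
lemma sq_sum_Icc_le_blocks (e : ℕ → ℝ) {N T : ℕ} (hN : 1 ≤ N) (hT : 1 ≤ T) {n : ℕ} (hn : n ≤ T) :
    (∑ j ∈ Finset.Icc 1 n, e j) ^ 2 ≤
      (T : ℝ) ^ 2 * (2 * ((T : ℝ) ^ 2)⁻¹ * (∑ l ∈ Finset.range (N + 1),
        (∑ j ∈ Finset.Icc 1 (l * T / N), e j) ^ 2)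
        + 2 * (1 / N + 1 / T) * meanSq e T) := by
  have hT' : (0 : ℝ) < T := by exact_mod_cast hT
  have hN' : (0 : ℝ) < N := by exact_mod_cast hN
  set l := n * N / T with hl
  set p := l * T / N with hp
  have hlN : l ≤ N := by
    rw [hl]
    exact Nat.div_le_of_le_mul (Nat.mul_le_mul_right N hn)
  have hlT : l * T ≤ n * N := Nat.div_mul_le_self _ _
  have hlT' : n * N < (l + 1) * T := by
    rw [hl, mul_comm (n * N / T + 1)]
    exact Nat.lt_mul_div_succ (n * N) hT
  have hpn : p ≤ n := Nat.div_le_of_le_mul (by rw [mul_comm N]; exact hlT)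
  have hp' : l * T < N * (p + 1) := Nat.lt_mul_div_succ (l * T) hN
  have hlen : ((n - p : ℕ) : ℝ) ≤ T / N + 1 := by
    rw [Nat.cast_sub hpn]
    have h1 : (n : ℝ) * N < (l + 1) * T := by exact_mod_cast hlT'
    have h2 : (l : ℝ) * T < N * (p + 1) := by exact_mod_cast hp'
    have h3 : (n : ℝ) < T / N + (p + 1) := by
      have : (n : ℝ) * N < (T / N + (p + 1)) * N := by
        rw [add_mul, div_mul_cancel₀ _ hN'.ne']; linarith
      exact lt_of_mul_lt_mul_right this hN'.le
    linarith
  have hsplit : ∑ j ∈ Finset.Icc 1 n, e j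
      = ∑ j ∈ Finset.Icc 1 p, e j + ∑ j ∈ Finset.Ioc p n, e j :=
    (Finset.sum_Ioc_consecutive e (Nat.zero_le p) hpn).symm
  have hcs := sq_sum_le_card_mul_sum_sq (s := Finset.Ioc p n) (f := e)
  rw [Nat.card_Ioc] at hcs
  have hV : ∑ j ∈ Finset.Ioc p n, e j ^ 2 ≤ T * meanSq e T := by
    rw [meanSq, mul_inv_cancel_left₀ hT'.ne']
    refine Finset.sum_le_sum_of_subset_of_nonneg (fun (j : ℕ) hj => ?_) fun _ _ _ => sq_nonneg _
    rw [Finset.mem_Ioc] at hj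
    exact Finset.mem_Icc.2 ⟨(Nat.zero_le p).trans_lt hj.1, hj.2.trans hn⟩
  have hV0 := meanSq_nonneg e T
  have h4 : (∑ j ∈ Finset.Ioc p n, e j) ^ 2 ≤ (T / N + 1) * (T * meanSq e T) :=
    hcs.trans (mul_le_mul hlen hV (Finset.sum_nonneg fun _ _ => sq_nonneg _) (by positivity))
  have h5 : (∑ j ∈ Finset.Icc 1 p, e j) ^ 2 ≤ ∑ l ∈ Finset.range (N + 1),
      (∑ j ∈ Finset.Icc 1 (l * T / N), e j) ^ 2 :=
    Finset.single_le_sum (a := l) (f := fun l => (∑ j ∈ Finset.Icc 1 (l * T / N), e j) ^ 2)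
      (fun _ _ => sq_nonneg _) (Finset.mem_range.2 (by omega))
  have h6 : (T : ℝ) ^ 2 * (2 * ((T : ℝ) ^ 2)⁻¹ * (∑ l ∈ Finset.range (N + 1),
        (∑ j ∈ Finset.Icc 1 (l * T / N), e j) ^ 2)
        + 2 * (1 / N + 1 / T) * meanSq e T) = 2 * (∑ l ∈ Finset.range (N + 1),
        (∑ j ∈ Finset.Icc 1 (l * T / N), e j) ^ 2) + 2 * ((T / N + 1) * (T * meanSq e T)) := by
    field_simp
  rw [h6, hsplit]
  nlinarith [sq_nonneg (∑ j ∈ Finset.Icc 1 p, e j - ∑ j ∈ Finset.Ioc p n, e j)]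

/-! ### Integrable envelopes and their means. -/

section Envelope

variable {ε : ℤ → Ω → ℝ} {v : ℝ}

lemma integrable_meanSq (hε2 : ∀ t : ℤ, 1 ≤ t → MemLp (ε t) 2 μ) (T : ℕ) :
    Integrable (fun ω => meanSq (fun j => ε j ω) T) μ :=
  (integrable_finsetSum _ fun (j : ℕ) hj =>
    (hε2 j (by rw [Finset.mem_Icc] at hj; omega)).integrable_sq).const_mul _

lemma integral_meanSq (hε2 : ∀ t : ℤ, 1 ≤ t → MemLp (ε t) 2 μ)
    (hv : ∀ t : ℤ, 1 ≤ t → ∫ ω, ε t ω ^ 2 ∂μ = v) {T : ℕ} (hT : 1 ≤ T) :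
    ∫ ω, meanSq (fun j => ε j ω) T ∂μ = v := by
  have hT' : (0 : ℝ) < T := by exact_mod_cast hT
  simp only [meanSq]
  rw [integral_const_mul, integral_finsetSum _ fun (j : ℕ) hj =>
    (hε2 j (by rw [Finset.mem_Icc] at hj; omega)).integrable_sq,
    Finset.sum_congr rfl fun (j : ℕ) hj => hv j (by rw [Finset.mem_Icc] at hj; omega),
    Finset.sum_const, Nat.card_Icc, nsmul_eq_mul, Nat.add_sub_cancel, inv_mul_cancel_left₀ hT'.ne']

lemma integrable_initialTerm [IsProbabilityMeasure μ] (hε2 : ∀ t : ℤ, 1 ≤ t → MemLp (ε t) 2 μ)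
    (δ : ℝ) (T : ℕ) : Integrable (fun ω => initialTerm (fun j => ε j ω) δ T) μ := by
  refine (integrable_finsetSum _ fun (i : ℕ) hi => ?_).const_mul _
  rw [Finset.mem_Icc] at hi
  exact ((integrable_const (1 : ℝ)).add (hε2 i (by omega)).integrable_sq).add
    ((integrable_finsetSum _ fun (j : ℕ) hj =>
      (hε2 j (by rw [Finset.mem_Ico] at hj; omega)).integrable_sq).const_mul _)

lemma integral_initialTerm_le [IsProbabilityMeasure μ]
    (hε2 : ∀ t : ℤ, 1 ≤ t → MemLp (ε t) 2 μ)
    (hv : ∀ t : ℤ, 1 ≤ t → ∫ ω, ε t ω ^ 2 ∂μ = v) {δ : ℝ} (hδ : 0 ≤ δ) {T : ℕ} (hT : 1 ≤ T) :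
    ∫ ω, initialTerm (fun j => ε j ω) δ T ∂μ ≤ δ * (1 + 2 * v) := by
  have hT' : (0 : ℝ) < T := by exact_mod_cast hT
  have hv0 : 0 ≤ v := by rw [← hv 1 le_rfl]; exact integral_nonneg fun _ => sq_nonneg _
  have hin : ∀ i : ℕ, Integrable (fun ω => ∑ j ∈ Finset.Ico 1 i, ε (j : ℤ) ω ^ 2) μ := fun i =>
    integrable_finsetSum _ fun (j : ℕ) hj => (hε2 j (by rw [Finset.mem_Ico] at hj; omega)).integrable_sq
  have hone : ∀ i ∈ Finset.Icc 1 ⌊δ * (T : ℝ)⌋₊,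
      Integrable (fun ω => 1 + ε (i : ℤ) ω ^ 2) μ := fun (i : ℕ) hi => by
    rw [Finset.mem_Icc] at hi
    exact (integrable_const (1 : ℝ)).add (hε2 i (by omega)).integrable_sq
  have hall : ∀ i ∈ Finset.Icc 1 ⌊δ * (T : ℝ)⌋₊, Integrable (fun ω => 1 + ε (i : ℤ) ω ^ 2
      + (i : ℝ)⁻¹ * ∑ j ∈ Finset.Ico 1 i, ε (j : ℤ) ω ^ 2) μ := fun i hi =>
    (hone i hi).add ((hin i).const_mul _)
  simp only [initialTerm]
  rw [integral_const_mul, integral_finsetSum _ hall]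
  have hterm : ∀ i ∈ Finset.Icc 1 ⌊δ * (T : ℝ)⌋₊, ∫ ω, (1 + ε (i : ℤ) ω ^ 2
      + (i : ℝ)⁻¹ * ∑ j ∈ Finset.Ico 1 i, ε (j : ℤ) ω ^ 2) ∂μ ≤ 1 + 2 * v := by
    intro i hi
    rw [integral_add (hone i hi) ((hin i).const_mul _)]
    rw [Finset.mem_Icc] at hi
    have hi0 : (0 : ℝ) < i := by exact_mod_cast hi.1
    rw [integral_add (integrable_const _) (hε2 i (by omega)).integrable_sq, hv i (by omega),
      integral_const_mul, integral_finsetSum _ fun (j : ℕ) hj =>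
      (hε2 j (by rw [Finset.mem_Ico] at hj; omega)).integrable_sq,
      Finset.sum_congr rfl fun (j : ℕ) hj => hv j (by rw [Finset.mem_Ico] at hj; omega),
      Finset.sum_const, Nat.card_Ico, nsmul_eq_mul]
    have h1 : ((i - 1 : ℕ) : ℝ) ≤ i := by exact_mod_cast Nat.sub_le _ _
    have h2 : (i : ℝ)⁻¹ * (((i - 1 : ℕ) : ℝ) * v) ≤ v := by
      rw [inv_mul_le_iff₀ hi0]
      gcongr
    simp only [integral_const, probReal_univ, smul_eq_mul, mul_one]
    linarith
  rw [inv_mul_le_iff₀ hT']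
  refine (Finset.sum_le_sum hterm).trans ?_
  rw [Finset.sum_const, Nat.card_Icc, nsmul_eq_mul, Nat.add_sub_cancel]
  have : (⌊δ * (T : ℝ)⌋₊ : ℝ) ≤ δ * T := Nat.floor_le (by positivity)
  calc _ ≤ δ * T * (1 + 2 * v) := by gcongr
    _ = _ := by ring

/-- The maximal partial sum has an integrable envelope with small mean. -/
lemma eventually_exists_envelope_sum (hε2 : ∀ t : ℤ, 1 ≤ t → MemLp (ε t) 2 μ)
    (hv : ∀ t : ℤ, 1 ≤ t → ∫ ω, ε t ω ^ 2 ∂μ = v)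
    (hS : ∀ ρ : ℝ, 0 < ρ → ∀ᶠ n : ℕ in atTop,
        ∫ ω, (∑ j ∈ Finset.Icc 1 n, ε (j : ℤ) ω) ^ 2 ∂μ ≤ ρ * (n : ℝ) ^ 2) {ρ : ℝ} (hρ : 0 < ρ) :
    ∀ᶠ T : ℕ in atTop, ∃ Q : Ω → ℝ, Integrable Q μ ∧ (∀ ω, 0 ≤ Q ω) ∧ ∫ ω, Q ω ∂μ ≤ ρ ∧
      ∀ ω, ∀ n ≤ T, (∑ j ∈ Finset.Icc 1 n, ε (j : ℤ) ω) ^ 2 ≤ (T : ℝ) ^ 2 * Q ω := by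
  have hv0 : 0 ≤ v := by rw [← hv 1 le_rfl]; exact integral_nonneg fun _ => sq_nonneg _
  -- The mesh is fixed first, so that short blocks cost at most ρ/3. The N + 1 grid sums then share
  -- another ρ/3 through ρ', and the term 2v/T takes the rest.
  obtain ⟨N, hN, hN1⟩ := (((tendsto_const_div_atTop_nhds_zero_nat (2 * v)).eventually_le_const
    (show 0 < ρ / 3 by positivity)).and (eventually_ge_atTop 1)).exists
  set ρ' : ℝ := ρ / (6 * (N + 1)) with hρ'
  have hρ'0 : 0 < ρ' := by positivity
  filter_upwards [eventually_integral_sq_sum_le hS hρ'0,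
    (tendsto_const_div_atTop_nhds_zero_nat (2 * v)).eventually_le_const
    (show 0 < ρ / 3 by positivity), eventually_ge_atTop 1] with T h1 h2 hT
  have hT' : (0 : ℝ) < T := by exact_mod_cast hT
  have hi1 : Integrable (fun ω => ∑ l ∈ Finset.range (N + 1),
      (∑ j ∈ Finset.Icc 1 (l * T / N), ε (j : ℤ) ω) ^ 2) μ :=
    integrable_finsetSum _ fun l _ => (memLp_two_sum hε2 _).integrable_sq
  have hi2 := integrable_meanSq (μ := μ) hε2 T
  refine ⟨fun ω => 2 * ((T : ℝ) ^ 2)⁻¹ * (∑ l ∈ Finset.range (N + 1),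
        (∑ j ∈ Finset.Icc 1 (l * T / N), ε (j : ℤ) ω) ^ 2)
        + 2 * (1 / N + 1 / T) * meanSq (fun j => ε (j : ℤ) ω) T,
    (hi1.const_mul _).add (hi2.const_mul _), fun ω => ?_, ?_,
    fun ω n hn => sq_sum_Icc_le_blocks (fun j => ε (j : ℤ) ω) hN1 hT hn⟩
  · have := meanSq_nonneg (fun j => ε (j : ℤ) ω) T
    have := Finset.sum_nonneg (s := Finset.range (N + 1))
      (f := fun l => (∑ j ∈ Finset.Icc 1 (l * T / N), ε (j : ℤ) ω) ^ 2) fun _ _ => sq_nonneg _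
    positivity
  · rw [integral_add (hi1.const_mul _) (hi2.const_mul _), integral_const_mul, integral_const_mul,
      integral_meanSq hε2 hv hT,
      integral_finsetSum _ fun l _ => (memLp_two_sum hε2 _).integrable_sq]
    have h3 : ∑ l ∈ Finset.range (N + 1), ∫ ω, (∑ j ∈ Finset.Icc 1 (l * T / N), ε (j : ℤ) ω) ^ 2 ∂μ
        ≤ (N + 1) * (ρ' * (T : ℝ) ^ 2) := by
      refine (Finset.sum_le_sum fun l hl => h1 _ ?_).trans (le_of_eq ?_)
      · rw [Finset.mem_range] at hl
        exact Nat.div_le_of_le_mul (Nat.mul_le_mul_right T (by omega))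
      · rw [Finset.sum_const, Finset.card_range, nsmul_eq_mul]
        push_cast
        ring
    have h4 : 2 * ((T : ℝ) ^ 2)⁻¹ * ((N + 1) * (ρ' * (T : ℝ) ^ 2)) = ρ / 3 := by
      rw [hρ']; field_simp; norm_num
    have h5 : 2 * ((T : ℝ) ^ 2)⁻¹ * ∑ l ∈ Finset.range (N + 1),
        ∫ ω, (∑ j ∈ Finset.Icc 1 (l * T / N), ε (j : ℤ) ω) ^ 2 ∂μ ≤ ρ / 3 := by
      rw [← h4]; gcongr
    have h6 : 2 * (1 / (N : ℝ) + 1 / T) * v = 2 * v / N + 2 * v / T := by ring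
    linarith

end Envelope

end PartialSums

/-! ### Uniform consistency of the objective -/

lemma limObj_congr {K m q : ℝ → ℝ} (hqm : ∀ t, 0 ≤ t → q t = m t) {s : ℝ} (hs : 0 ≤ s) (ξ : ℝ) :
    limObj K m s ξ = limObj K q s ξ := by
  have hpred : ∀ r, 0 ≤ r → limPred K m ξ r = limPred K q ξ r := by
    intro r hr
    simp only [limPred]
    congr 1
    refine intervalIntegral.integral_congr fun u hu => ?_
    rw [uIcc_of_le hr] at hu
    simp only [hqm u hu.1]
  simp only [limObj]
  congr 1
  · congr 1
    refine intervalIntegral.integral_congr fun r hr => ?_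
    rw [uIcc_of_le hs] at hr
    simp only [hpred r hr.1, hqm r hr.1]
  · refine intervalIntegral.integral_congr fun r hr => ?_
    rw [uIcc_of_le hs] at hr
    simp only [hpred r hr.1]

/-- A regression function extends to a bounded Lipschitz function on the line. -/
lemma IsRegressionFunction.exists_extension {m : ℝ → ℝ} (hm : IsRegressionFunction m) :
    ∃ (q : ℝ → ℝ) (L : NNReal) (Bq : ℝ), LipschitzWith L q ∧ (∀ x, |q x| ≤ Bq) ∧
      ∀ t, 0 ≤ t → q t = m t := by
  obtain ⟨L, hL⟩ := hm.lipschitz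
  obtain ⟨B, hB⟩ := hm.bounded
  refine ⟨fun x => m (max x 0), L, B, LipschitzWith.of_dist_le_mul fun x y => ?_,
    fun x => hB _ (le_max_right _ _), fun t ht => by simp [ht]⟩
  refine (hL.dist_le_mul _ (le_max_right x 0) _ (le_max_right y 0)).trans
    (mul_le_mul_of_nonneg_left ?_ L.2)
  rw [Real.dist_eq, Real.dist_eq]
  exact abs_max_sub_max_le_abs x y 0

section Consistency

variable {Ω : Type*} [MeasurableSpace Ω] {μ : Measure Ω} [IsProbabilityMeasure μ]
  {K m : ℝ → ℝ} {ε : ℤ → Ω → ℝ} {Ξ : ℝ}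

/-- The uniform error of the objective has an integrable envelope with small mean. -/
theorem eventually_exists_envelope (hΞ : 0 < Ξ) (hK : IsBoundedKernel K Ξ)
    (hm : IsRegressionFunction m) (hε : IsErrorProcess μ ε) {ρ : ℝ} (hρ : 0 < ρ) :
    ∀ᶠ T : ℕ in atTop, ∃ G : Ω → ℝ, Integrable G μ ∧ (∀ ω, 0 ≤ G ω) ∧ ∫ ω, G ω ∂μ ≤ ρ ∧
      ∀ ω, ∀ ξ ∈ Icc 1 Ξ, ∀ s ∈ Icc (0 : ℝ) 1,
        |cvObj K m ε T s ξ ω - limObj K m s ξ| ≤ G ω := by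
  obtain ⟨q, L, Bq, hq, hqB, hqm⟩ := hm.exists_extension
  obtain ⟨v, hε2, hv, hS⟩ := hε.exists_variance
  have hv0 : 0 ≤ v := by rw [← hv 1 le_rfl]; exact integral_nonneg fun _ => sq_nonneg _
  obtain ⟨C, hC, hpath⟩ := exists_pathwise_bound hK hΞ hq hqB
  -- δ is chosen after `C`, and the mean of Q after `D`; each of the three terms then has mean at
  -- most ρ/3. Adding 1 to `C` and `D` avoids division by zero.
  set δ : ℝ := ρ / (3 * (C + 1) * (1 + 2 * v)) with hδ
  have hδ0 : 0 < δ := by positivity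
  set ρ₁ : ℝ := ρ / (3 * (1 + v)) with hρ₁
  have hρ₁0 : 0 < ρ₁ := by positivity
  obtain ⟨D, hD, hpath⟩ := hpath δ ρ₁ hδ0 hρ₁0
  filter_upwards [hpath, eventually_exists_envelope_sum hε2 hv hS
    (show 0 < ρ / (3 * (D + 1)) by positivity), eventually_ge_atTop 1] with T h1 h2 hT
  obtain ⟨Q, hQi, hQ0, hQ, hQS⟩ := h2
  have i1 := integrable_meanSq (μ := μ) hε2 T
  have i2 := integrable_initialTerm (μ := μ) hε2 δ T
  have i3 : Integrable (fun ω => ρ₁ * (1 + meanSq (fun j => ε (j : ℤ) ω) T)) μ :=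
    ((integrable_const (1 : ℝ)).add i1).const_mul ρ₁
  have i4 : Integrable (fun ω => ρ₁ * (1 + meanSq (fun j => ε (j : ℤ) ω) T) + D * Q ω) μ :=
    i3.add (hQi.const_mul D)
  refine ⟨fun ω => ρ₁ * (1 + meanSq (fun j => ε (j : ℤ) ω) T) + D * Q ω
    + C * initialTerm (fun j => ε (j : ℤ) ω) δ T, i4.add (i2.const_mul C), fun ω => ?_, ?_, ?_⟩
  · have e1 := meanSq_nonneg (fun j => ε (j : ℤ) ω) T
    have e2 := hQ0 ω
    have e3 : 0 ≤ initialTerm (fun j => ε (j : ℤ) ω) δ T :=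
      mul_nonneg (by positivity) (Finset.sum_nonneg fun i _ => by positivity)
    positivity
  · rw [integral_add i4 (i2.const_mul C), integral_add i3 (hQi.const_mul D), integral_const_mul,
      integral_const_mul, integral_const_mul, integral_add (integrable_const _) i1,
      integral_meanSq hε2 hv hT]
    simp only [integral_const, probReal_univ, smul_eq_mul, mul_one]
    have e1 : ρ₁ * (1 + v) = ρ / 3 := by rw [hρ₁]; field_simp
    have e2 : D * ∫ ω, Q ω ∂μ ≤ ρ / 3 := by
      calc _ ≤ D * (ρ / (3 * (D + 1))) := by gcongr
        _ ≤ (D + 1) * (ρ / (3 * (D + 1))) := by gcongr; linarith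
        _ = _ := by field_simp
    have e3 : C * ∫ ω, initialTerm (fun j => ε (j : ℤ) ω) δ T ∂μ ≤ ρ / 3 := by
      calc _ ≤ C * (δ * (1 + 2 * v)) := by
            gcongr; exact integral_initialTerm_le hε2 hv hδ0.le hT
        _ ≤ (C + 1) * (δ * (1 + 2 * v)) := by gcongr; linarith
        _ = _ := by rw [hδ]; field_simp
    linarith
  · intro ω ξ hξ s hs
    rw [cvObj_eq_seqObj hqm, limObj_congr hqm hs.1]
    exact h1 (fun j => ε (j : ℤ) ω) (Q ω) (hQ0 ω) (hQS ω) ξ hξ s hs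

/-- The objective converges in probability, uniformly in the bandwidth and the time horizon. -/
theorem tendsto_measure_exists_le_abs (hΞ : 0 < Ξ) (hK : IsBoundedKernel K Ξ)
    (hm : IsRegressionFunction m) (hε : IsErrorProcess μ ε) {δ : ℝ} (hδ : 0 < δ) :
    Tendsto (fun T : ℕ => μ {ω | ∃ ξ ∈ Icc 1 Ξ, ∃ s ∈ Icc (0 : ℝ) 1,
      δ ≤ |cvObj K m ε T s ξ ω - limObj K m s ξ|}) atTop (𝓝 0) := by
  rw [ENNReal.tendsto_nhds_zero]
  intro η hη
  obtain ⟨ρ, hρ0, hρη⟩ : ∃ ρ : ℝ, 0 < ρ ∧ ENNReal.ofReal ρ ≤ η := by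
    rcases eq_or_ne η ⊤ with h | h
    · exact ⟨1, one_pos, by simp [h]⟩
    · exact ⟨η.toReal, ENNReal.toReal_pos hη.ne' h, ENNReal.ofReal_toReal_le⟩
  filter_upwards [eventually_exists_envelope hΞ hK hm hε (mul_pos hδ hρ0)] with T hT
  obtain ⟨G, hGi, hG0, hG, hGle⟩ := hT
  -- The event involves a supremum over a continuum and need not be measurable; it lies in a level
  -- set of the envelope, to which Markov's inequality applies.
  refine (measure_mono (t := {ω | δ ≤ G ω}) ?_).trans (le_trans ?_ hρη)
  · rintro ω ⟨ξ, hξ, s, hs, h⟩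
    exact h.trans (hGle ω ξ hξ s hs)
  · have h := (mul_meas_ge_le_integral_of_nonneg (ae_of_all _ hG0) hGi δ).trans hG
    have h2 := le_of_mul_le_mul_left h hδ
    rw [← ofReal_measureReal]
    exact ENNReal.ofReal_le_ofReal h2

end Consistency

/-! ### Consistency of the minimizers -/

/-- On the compact set of points at distance at least ρ from x, f attains its minimum, and
uniqueness makes that value exceed f(x). -/
lemma wellSeparatedMin_of_unique {f : ℝ → ℝ} {Ξ x : ℝ} (hf : ContinuousOn f (Icc 1 Ξ))
    (hx : x ∈ Icc 1 Ξ) (hmin : ∀ ξ ∈ Icc 1 Ξ, ξ ≠ x → f x < f ξ) : WellSeparatedMin f Ξ x := by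
  refine ⟨hx, fun ρ hρ => ?_⟩
  have hcl : IsCompact (Icc 1 Ξ ∩ {ξ | ρ ≤ |ξ - x|}) :=
    isCompact_Icc.inter_right (isClosed_le continuous_const (by fun_prop))
  rcases (Icc 1 Ξ ∩ {ξ | ρ ≤ |ξ - x|}).eq_empty_or_nonempty with he | hne
  · exact ⟨1, one_pos, fun ξ hξ h => absurd (show ξ ∈ Icc 1 Ξ ∩ {ξ | ρ ≤ |ξ - x|} from ⟨hξ, h⟩)
      (by simp [he])⟩
  obtain ⟨y, hy, hymin⟩ := hcl.exists_isMinOn hne (hf.mono inter_subset_left)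
  have hyx : y ≠ x := by
    rintro rfl
    have : ρ ≤ |y - y| := hy.2
    simp at this
    linarith
  refine ⟨f y - f x, sub_pos.2 (hmin y hy.1 hyx), fun ξ hξ h => ?_⟩
  have : f y ≤ f ξ := hymin ⟨hξ, h⟩
  linarith

/-- By Rolle's theorem a second minimizer would force a critical point strictly between it and x.
This also covers x at an end point of the interval. -/
lemma OnlyCriticalPoint.lt_of_isMinOn {f : ℝ → ℝ} {Ξ x : ℝ} (hf : OnlyCriticalPoint f Ξ x)
    (hmin : IsMinOn f (Icc 1 Ξ) x) : ∀ ξ ∈ Icc 1 Ξ, ξ ≠ x → f x < f ξ := by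
  obtain ⟨f', -, hd, hx, hzero⟩ := hf
  have hcont : ContinuousOn f (Icc 1 Ξ) := fun ξ hξ => (hd ξ hξ).continuousWithinAt
  -- no value is taken twice with `x` as one of the end points
  have hrolle : ∀ a ∈ Icc 1 Ξ, ∀ b ∈ Icc 1 Ξ, a < b → f a = f b → x ∉ Ioo a b → False := by
    intro a ha b hb hab hfab hxab
    obtain ⟨c, hc, hc0⟩ := exists_hasDerivAt_eq_zero (f' := f') hab
      (hcont.mono (Icc_subset_Icc ha.1 hb.2)) hfab fun ξ hξ =>
        (hd ξ ⟨ha.1.trans hξ.1.le, hξ.2.le.trans hb.2⟩).hasDerivAt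
          (Icc_mem_nhds (ha.1.trans_lt hξ.1) (hξ.2.trans_le hb.2))
    have := (hzero c ⟨ha.1.trans hc.1.le, hc.2.le.trans hb.2⟩).1 hc0
    exact hxab (this ▸ hc)
  intro ξ hξ hne
  refine lt_of_le_of_ne (hmin hξ) fun heq => ?_
  rcases lt_or_gt_of_ne hne with h | h
  · exact hrolle ξ hξ x hx h heq.symm fun hx' => lt_irrefl _ hx'.2
  · exact hrolle x hx ξ hξ h heq fun hx' => lt_irrefl _ hx'.1

lemma IdentifiesMin.wellSeparatedMin {Ω : Type*} [MeasurableSpace Ω] {μ : Measure Ω}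
    {K m : ℝ → ℝ} {ε : ℤ → Ω → ℝ} {Ξ s x : ℝ} (h : IdentifiesMin μ K m ε Ξ s x)
    (hcont : ContinuousOn (limObj K m s) (Icc 1 Ξ)) :
    WellSeparatedMin (limObj K m s) Ξ x := by
  rcases h with h | ⟨h, hmin⟩ | ⟨-, hx, hmin⟩
  · exact h
  · obtain ⟨-, -, -, hx, -⟩ := id h
    exact wellSeparatedMin_of_unique hcont hx (h.lt_of_isMinOn hmin)
  · exact wellSeparatedMin_of_unique hcont hx hmin

theorem theorem7 {Ω : Type*} [MeasurableSpace Ω] (μ : Measure Ω) [IsProbabilityMeasure μ]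
    (K m : ℝ → ℝ) (ε : ℤ → Ω → ℝ) (Ξ s₀ : ℝ) (hΞ : 1 < Ξ) (hs₀ : s₀ ∈ Ioo (0 : ℝ) 1)
    (hK : IsBoundedKernel K Ξ) (hm : IsRegressionFunction m) (hε : IsErrorProcess μ ε) :
    (∀ S : Finset ℝ, (∀ s ∈ S, s ∈ Icc s₀ 1) → ∀ δ : ℝ, 0 < δ →
      Tendsto (fun T : ℕ => μ {ω | ENNReal.ofReal δ <
        ⨆ s ∈ S, ⨆ ξ ∈ Icc 1 Ξ, ENNReal.ofReal |cvObj K m ε T s ξ ω - limObj K m s ξ|})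
        atTop (𝓝 0)) ∧
    (∀ s ∈ Icc s₀ 1, ∀ ξstar : ℝ, IdentifiesMin μ K m ε Ξ s ξstar →
      ∀ ξhat : ℕ → Ω → ℝ,
        (∀ᶠ T : ℕ in atTop, ∀ᵐ ω ∂μ, ξhat T ω ∈ Icc 1 Ξ ∧
          IsMinOn (fun ξ => cvObj K m ε T s ξ ω) (Icc 1 Ξ) (ξhat T ω)) →
        TendstoInMeasure μ ξhat atTop (fun _ => ξstar)) := by
  have hΞ0 : 0 < Ξ := by linarith
  refine ⟨fun S hS δ hδ => ?_, fun s hs x hx ξhat hhat => ?_⟩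
  · refine tendsto_of_tendsto_of_tendsto_of_le_of_le tendsto_const_nhds
      (tendsto_measure_exists_le_abs hΞ0 hK hm hε hδ) (fun _ => zero_le) fun T => ?_
    refine measure_mono fun ω hω => ?_
    rw [mem_ofPred_eq] at hω
    -- The suprema are taken in `ENNReal`, so exceeding δ means that some pair (s, ξ) does, with no
    -- boundedness to check.
    simp only [lt_iSup_iff] at hω
    obtain ⟨s, hs, ξ, hξ, h⟩ := hω
    have hs' := hS s hs
    exact ⟨ξ, hξ, s, ⟨hs₀.1.le.trans hs'.1, hs'.2⟩,
      ((ENNReal.ofReal_lt_ofReal_iff_of_nonneg hδ.le).1 h).le⟩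
  · have hs01 : s ∈ Icc (0 : ℝ) 1 := ⟨hs₀.1.le.trans hs.1, hs.2⟩
    have hcont : ContinuousOn (limObj K m s) (Icc 1 Ξ) := by
      obtain ⟨q, L, Bq, hq, hqB, hqm⟩ := hm.exists_extension
      exact (continuousOn_limObj hK hΞ0 hq hqB hs01).congr fun ξ _ => limObj_congr hqm hs01.1 ξ
    obtain ⟨hxmem, hsep⟩ := hx.wellSeparatedMin hcont
    rw [tendstoInMeasure_iff_norm]
    intro ρ hρ
    obtain ⟨δ, hδ, hsepδ⟩ := hsep ρ hρ
    refine tendsto_of_tendsto_of_tendsto_of_le_of_le' tendsto_const_nhds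
      (tendsto_measure_exists_le_abs hΞ0 hK hm hε (half_pos hδ))
      (Eventually.of_forall fun _ => zero_le) ?_
    filter_upwards [hhat] with T hT
    refine measure_mono_ae ?_
    filter_upwards [hT] with ω hω hfar
    obtain ⟨hmem, hmin⟩ := hω
    have h1 := hsepδ _ hmem hfar
    have h2 : cvObj K m ε T s (ξhat T ω) ω ≤ cvObj K m ε T s x ω := hmin hxmem
    -- If both errors were below δ/2, minimality of the estimate would give C_ξ(s) < C_{ξ*}(s) + δ
    -- at the estimate ξ, against the separation by δ.
    by_contra hcon
    have hlt : ∀ ξ ∈ Icc 1 Ξ, |cvObj K m ε T s ξ ω - limObj K m s ξ| < δ / 2 := fun ξ hξ =>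
      not_le.1 fun h => hcon ⟨ξ, hξ, s, hs01, h⟩
    have h3 := abs_lt.1 (hlt _ hmem)
    have h4 := abs_lt.1 (hlt _ hxmem)
    linarith [h3.1, h4.2]
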